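/- All graphs are finite and simple. "Contains" refers to induced subgraphs: $G$ contains $H$ if $G$ has an induced subgraph isomorphic to $H$. A path (cycle) in $G$ is an induced subgraph of $G$ that is a path (cycle); a path has at least one vertex, and the interior of a path is the path minus its ends. Disjoint vertex sets are anticomplete if there are no edges of $G$ between them. A graph is $(c,o)$-perforated if it has no induced subgraph isomorphic to the disjoint union of $c$ cycles, each of length at least $o+2$; that is, there are no $c$ pairwise disjoint and pairwise anticomplete cycles in $G$, each of length at least $o+2$. A strong $k$-block in $G$ is a set $B$ of at least $k$ vertices of $G$ such that for every $2$-subset $\{x,y\}$ of $B$ there is a collection $\mathcal{P}_{\{x,y\}}$ of at least $k$ distinct and pairwise internally disjoint paths in $G$ from $x$ to $y$, where for all distinct $2$-subsets $\{x,y\},\{x',y'\}$ of $B$, $V(\mathcal{P}_{\{x,y\}})\cap V(\mathcal{P}_{\{x',y'\}})=\{x,y\}\cap\{x',y'\}$; here $V(\mathcal{P})$ is the union of the vertex sets of the paths in $\mathcal{P}$. An $(s,l)$-constellation in $G$ is a pair $(S,\mathcal{L})$ where $\mathcal{L}$ is a set of $l$ pairwise disjoint paths in $G$, $S$ is a stable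 set of $s$ vertices in $G\setminus V(\mathcal{L})$, and every vertex in $S$ has a neighbor in every path in $\mathcal{L}$; it is plain if the paths in $\mathcal{L}$ are pairwise anticomplete. **Theorem 7.1.** For all positive integers $c,l,o,s,t$ there is a positive integer $\Omega=\Omega(c,l,o,s,t)$ such that for every $(c,o)$-perforated graph $G$ in which there is a strong $\Omega$-block, one of the following holds: (a) $G$ contains $K_t$ or $K_{t,t}$; (b) there is a plain $(s,l)$-constellation in $G$. -/

import Mathlib

namespace InducedGrid

variable {V : Type*}

/-- `P` is (the vertex set of) a path in `G` with ends `x` and `y`. Paths in `G` are induced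
subgraphs of `G` that are paths; `n` is the length, and `n = 0` (one vertex) is allowed. -/
def IsPathBetween (G : SimpleGraph V) (P : Set V) (x y : V) : Prop :=
  ∃ (n : ℕ) (f : SimpleGraph.pathGraph (n + 1) ↪g G),
    f 0 = x ∧ f (Fin.last n) = y ∧ Set.range f = P

/-- `P` is (the vertex set of) a path in `G`, that is, an induced path on at least one vertex. -/
def IsPathIn (G : SimpleGraph V) (P : Set V) : Prop :=
  ∃ x y : V, IsPathBetween G P x y

/-- `C` is (the vertex set of) a cycle of length `n` in `G`, that is, an induced subgraph of `G`
that is a cycle on `n ≥ 3` vertices. -/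
def IsCycleIn (G : SimpleGraph V) (C : Set V) (n : ℕ) : Prop :=
  3 ≤ n ∧ ∃ f : SimpleGraph.cycleGraph n ↪g G, Set.range f = C

/-- There are no edges of `G` between `X` and `Y`. -/
def Anticomplete (G : SimpleGraph V) (X Y : Set V) : Prop :=
  ∀ x ∈ X, ∀ y ∈ Y, ¬ G.Adj x y

/-- `G` is `(c, o)`-perforated: no induced subgraph of `G` is the disjoint union of `c` cycles,
each of length at least `o + 2`. -/
def IsPerforated (G : SimpleGraph V) (c o : ℕ) : Prop :=
  ¬ ∃ C : Fin c → Set V,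
      (∀ i, ∃ n, o + 2 ≤ n ∧ IsCycleIn G (C i) n) ∧
      (∀ i j, i ≠ j → Disjoint (C i) (C j) ∧ Anticomplete G (C i) (C j))

/-- `B` is a strong `k`-block in `G`. The value of `𝓟` at the 2-subset `{x, y}` of `B`, written
`s(x, y)`, is the collection of paths chosen for that 2-subset. -/
def IsStrongBlock (G : SimpleGraph V) (k : ℕ) (B : Finset V) : Prop :=
  k ≤ B.card ∧
  ∃ 𝓟 : Sym2 V → Finset (Set V),
    (∀ x ∈ B, ∀ y ∈ B, x ≠ y →
      k ≤ (𝓟 s(x, y)).card ∧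
      (∀ P ∈ 𝓟 s(x, y), IsPathBetween G P x y) ∧
      (∀ P ∈ 𝓟 s(x, y), ∀ Q ∈ 𝓟 s(x, y), P ≠ Q → Disjoint (P \ {x, y}) (Q \ {x, y}))) ∧
    (∀ x ∈ B, ∀ y ∈ B, ∀ x' ∈ B, ∀ y' ∈ B, x ≠ y → x' ≠ y' → s(x, y) ≠ s(x', y') →
      (⋃ P ∈ 𝓟 s(x, y), P) ∩ (⋃ P ∈ 𝓟 s(x', y'), P) = ({x, y} ∩ {x', y'} : Set V))

/-- An `l`-polypath in `G`: a set of `l` pairwise disjoint paths in `G`. -/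
def IsPolypath (G : SimpleGraph V) (l : ℕ) (𝓛 : Finset (Set V)) : Prop :=
  𝓛.card = l ∧ (∀ L ∈ 𝓛, IsPathIn G L) ∧ ∀ L ∈ 𝓛, ∀ L' ∈ 𝓛, L ≠ L' → Disjoint L L'

/-- A polypath is plain if its paths are pairwise anticomplete. -/
def IsPlain (G : SimpleGraph V) (𝓛 : Finset (Set V)) : Prop :=
  ∀ L ∈ 𝓛, ∀ L' ∈ 𝓛, L ≠ L' → Anticomplete G L L'

/-- An `(s, l)`-bundle in `G`. -/
def IsBundle (G : SimpleGraph V) (s l : ℕ) (S : Finset V) (𝓛 : Finset (Set V)) : Prop :=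
  S.card = s ∧ IsPolypath G l 𝓛

/-- An `(s, l)`-constellation in `G`: an `(s, l)`-bundle `(S, 𝓛)` such that `S` is a stable set
avoiding all paths in `𝓛`, and every vertex in `S` has a neighbor in every path in `𝓛`. -/
def IsConstellation (G : SimpleGraph V) (s l : ℕ) (S : Finset V) (𝓛 : Finset (Set V)) : Prop :=
  IsBundle G s l S 𝓛 ∧
  (∀ L ∈ 𝓛, Disjoint (S : Set V) L) ∧
  G.IsIndepSet (S : Set V) ∧
  ∀ x ∈ S, ∀ L ∈ 𝓛, ∃ y ∈ L, G.Adj x y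

end InducedGrid

namespace StrongBlock

open InducedGrid

universe u v w

section

/-! ### Ramsey-type lemmas -/

/-! Suppose that `G` is perforated and contains neither $K_t$, nor $K_{t,t}$, nor a plain
$(s,l)$-constellation (`Good`). By Ramsey's theorem, excluding $K_t$ and $K_{t,t}$ forces large sets
to contain large stable sets, and two large families of disjoint sets of bounded size to contain an
anticomplete pair. Excluding plain constellations forbids many vertices that all see each of many
disjoint, pairwise anticomplete paths (`exists_not_seen`). The lemma `clean` turns the absence of
large bicliques of a relation into large subfamilies on which the relation fails altogether. The
remaining contradictions come from `c` disjoint anticomplete cycles of length at least `o + 2`,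
called long below.

In a set without long cycles, large families of disjoint paths contain anticomplete pairs
(`exists_anticomplete_paths`). Indeed, touching paths can be cut down to at most `o` vertices: in a
minimal choice of subpaths, a longer one would be touched by one path only at its first vertex and
by another only at its last, and these two would close a long cycle.

The core is `not_cleanSystem`: there cannot be many pairs `x e`, `y e`, each joined by many disjoint
long paths, with no edges from the pairs to the paths but the obvious ones. Take a maximal packing
of long cycles; outside its closed neighbourhood there are none. If the paths of `c` pairs avoid
that neighbourhood, two anticomplete paths for each pair form `c` cycles (`not_through`). Otherwise
paths of `c` pairs run into a common cycle of the packing. If no vertex of it receives many of them,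
the attachments are spread out, and intervals of the cycle between two attachments close `c` long
cycles (`not_spread`). Hence some vertex, a hub, is adjacent to the ends of many anticomplete
initial segments of paths of one pair (`exists_hub`). Many hubs for a single pair, with each path
cut at its farthest hub contact, give a plain constellation.

It follows that many vertices cannot all see each of many disjoint paths, even if the paths are not
anticomplete (`exists_not_seen_of_disjoint`): subpaths between consecutive attachments would form a
clean system.

In a strong block, take a large stable subset and the interiors of the paths between its vertices.
Each bundle of paths is seen in common by few vertices, so a counting argument (`exists_avoiding`)
selects block vertices such that the paths see only their own ends. If the paths are long, disjoint
pairs form a clean system. If they are short, they can be chosen pairwise anticomplete, and block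
vertices strung into rings give `c` long cycles (`not_links`). -/

theorem exists_enum {ι : Type u} (S : Finset ι) (hS : S.Nonempty) :
    ∃ h : ℕ → ι, (∀ i < S.card, h i ∈ S) ∧ Set.InjOn h (Set.Iio S.card) ∧
      ∀ x ∈ S, ∃ i < S.card, h i = x := by
  classical
  obtain ⟨x₀, hx₀⟩ := hS
  let e := S.equivFin
  refine ⟨fun n => if hn : n < S.card then (e.symm ⟨n, hn⟩ : ι) else x₀, ?_, ?_, ?_⟩
  · intro i hi
    simp [hi]
  · intro i hi j hj hij
    simp only [Set.mem_Iio] at hi hj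
    simp only [hi, hj, dif_pos] at hij
    have := e.symm.injective (Subtype.ext hij)
    simpa using this
  · intro x hx
    exact ⟨e ⟨x, hx⟩, (e ⟨x, hx⟩).2, by simp⟩

/-- Greedy half of Ramsey's theorem: fix the smallest element, keep a large colour class of the
pairs starting there, and repeat. Pigeonhole on `col` then finishes the proof. -/
theorem exists_end_homogeneous (κ : Type) [Fintype κ] (n : ℕ) :
    ∃ M, ∀ S : Finset ℕ, M ≤ S.card → ∀ f : ℕ → ℕ → κ,
      ∃ T ⊆ S, T.card = n ∧ ∃ col : ℕ → κ, ∀ i ∈ T, ∀ j ∈ T, i < j → f i j = col i := by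
  classical
  induction n with
  | zero => exact ⟨0, fun S _ f => ⟨∅, by simp, by simp, fun i => f 0 0, by simp⟩⟩
  | succ n ih =>
    obtain ⟨M, hM⟩ := ih
    refine ⟨1 + Fintype.card κ * M, fun S hS f => ?_⟩
    have hne : S.Nonempty := Finset.card_pos.mp (by omega)
    set a := S.min' hne with ha
    have haS : a ∈ S := S.min'_mem hne
    have hcard : (S.erase a).card = S.card - 1 := Finset.card_erase_of_mem haS
    obtain ⟨y, -, hy⟩ := Finset.exists_le_card_fiber_of_mul_le_card_of_maps_to
      (s := S.erase a) (t := (Finset.univ : Finset κ)) (f := fun j => f a j) (n := M)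
      (fun _ _ => Finset.mem_univ _) ⟨f 0 0, Finset.mem_univ _⟩
      (by rw [hcard, Finset.card_univ]; omega)
    obtain ⟨T, hT, hTc, col, hcol⟩ := hM _ hy f
    have haT : a ∉ T := fun h => by
      have := hT h
      simp at this
    refine ⟨insert a T, ?_, by rw [Finset.card_insert_of_notMem haT, hTc],
      Function.update col a y, ?_⟩
    · intro x hx
      rcases Finset.mem_insert.mp hx with rfl | hx
      · exact haS
      · exact Finset.mem_of_mem_erase (Finset.mem_filter.mp (hT hx)).1
    · intro i hi j hj hij
      rcases Finset.mem_insert.mp hi with rfl | hi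
      · rcases Finset.mem_insert.mp hj with rfl | hj
        · omega
        · simpa using (Finset.mem_filter.mp (hT hj)).2
      · have hia : i ≠ a := fun h => haT (h ▸ hi)
        rw [Function.update_of_ne hia]
        rcases Finset.mem_insert.mp hj with rfl | hj
        · have := S.min'_le i (Finset.mem_of_mem_erase (Finset.mem_filter.mp (hT hi)).1)
          omega
        · exact hcol i hi j hj hij

theorem exists_monochromatic (κ : Type) [Fintype κ] (m : ℕ) :
    ∃ M, ∀ S : Finset ℕ, M ≤ S.card → ∀ f : ℕ → ℕ → κ,
      ∃ T ⊆ S, T.card = m ∧ ∃ k, ∀ i ∈ T, ∀ j ∈ T, i < j → f i j = k := by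
  classical
  obtain ⟨M, hM⟩ := exists_end_homogeneous κ (Fintype.card κ * m)
  refine ⟨M, fun S hS f => ?_⟩
  obtain ⟨T, hT, hTc, col, hcol⟩ := hM S hS f
  obtain ⟨y, -, hy⟩ := Finset.exists_le_card_fiber_of_mul_le_card_of_maps_to
    (s := T) (t := (Finset.univ : Finset κ)) (f := col) (n := m)
    (fun _ _ => Finset.mem_univ _) ⟨f 0 0, Finset.mem_univ _⟩ (by rw [hTc, Finset.card_univ])
  obtain ⟨T', hT', hc⟩ := Finset.exists_subset_card_eq hy
  refine ⟨T', (hT'.trans (Finset.filter_subset _ _)).trans hT, hc, y, fun i hi j hj hij => ?_⟩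
  have h1 := Finset.mem_filter.mp (hT' hi)
  have h2 := Finset.mem_filter.mp (hT' hj)
  rw [hcol i h1.1 j h2.1 hij, h1.2]

/-- Ramsey's theorem for pairs: every large finite set contains a sequence of `m` distinct
elements on which the colour of a pair, taken in the order of the sequence, is constant. -/
theorem ramsey (κ : Type) [Fintype κ] (m : ℕ) :
    ∃ M, 0 < M ∧ ∀ {ι : Type u} (S : Finset ι), M ≤ S.card → ∀ f : ι → ι → κ,
      ∃ g : ℕ → ι, (∀ i < m, g i ∈ S) ∧ Set.InjOn g (Set.Iio m) ∧
        ∃ k, ∀ i j, i < j → j < m → f (g i) (g j) = k := by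
  obtain ⟨M, hM⟩ := exists_monochromatic κ m
  refine ⟨M + 1, by omega, fun {ι} S hS f => ?_⟩
  obtain ⟨h, hmem, hinj, -⟩ := exists_enum S (Finset.card_pos.mp (by omega))
  obtain ⟨T, hT, hTc, k, hk⟩ := hM (Finset.range S.card) (by simp; omega)
    (fun i j => f (h i) (h j))
  let e := T.orderEmbOfFin hTc
  have he : ∀ i, e i < S.card := fun i => by
    simpa using hT (T.orderEmbOfFin_mem hTc i)
  refine ⟨fun i => if hi : i < m then h (e ⟨i, hi⟩) else h 0, ?_, ?_, k, ?_⟩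
  · intro i hi
    simp only [hi, dif_pos]
    exact hmem _ (he _)
  · intro i hi j hj hij
    simp only [Set.mem_Iio] at hi hj
    simp only [hi, hj, dif_pos] at hij
    have := hinj (he _) (he _) hij
    simpa using e.injective this
  · intro i j hij hj
    have hi : i < m := by omega
    simp only [hi, hj, dif_pos]
    exact hk _ (T.orderEmbOfFin_mem hTc _) _ (T.orderEmbOfFin_mem hTc _)
      ((OrderEmbedding.lt_iff_lt e).mpr (by simpa using hij))

theorem card_image_shift {ι : Type u} [DecidableEq ι] {g : ℕ → ι} {L : ℕ}
    (hg : Set.InjOn g (Set.Iio L)) {a q : ℕ} (h : a + q ≤ L) :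
    ((Finset.range q).image (fun i => g (a + i))).card = q := by
  rw [Finset.card_image_of_injOn, Finset.card_range]
  intro i hi j hj hij
  simp only [Finset.coe_range, Set.mem_Iio] at hi hj
  have := hg (show a + i < L by omega) (show a + j < L by omega) hij
  omega

/-- If a relation has no `q × q` biclique, then any bounded number of large families have large
subfamilies such that the relation fails for all pairs of distinct members. -/
theorem clean (N q m : ℕ) :
    ∃ M, 0 < M ∧ ∀ {ε : Type u} {ι : Type v} (E : Finset ε) (I : ε → Finset ι) (ρ : ι → ι → Prop),
      E.card ≤ N → (∀ e ∈ E, M ≤ (I e).card) →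
      (∀ e ∈ E, ∀ f ∈ E, e ≠ f → Disjoint (I e) (I f)) →
      (∀ A B : Finset ι, A.card = q → B.card = q → Disjoint A B →
        (∀ a ∈ A, ∃ e ∈ E, a ∈ I e) → (∀ b ∈ B, ∃ e ∈ E, b ∈ I e) →
        ∃ a ∈ A, ∃ b ∈ B, ¬ ρ a b) →
      ∃ J : ε → Finset ι, (∀ e ∈ E, J e ⊆ I e ∧ (J e).card = m) ∧
        ∀ e ∈ E, ∀ f ∈ E, ∀ a ∈ J e, ∀ b ∈ J f, a ≠ b → ¬ ρ a b := by
  classical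
  -- Enumerate every family, and colour two positions by the truth table of `ρ` between the members
  -- there, for all pairs of families and in both orders. `2 * q` positions suffice to exhibit a
  -- biclique; `N * m` leave room for a block of `m` positions for each family.
  obtain ⟨M, hM0, hM⟩ := ramsey (Fin N → Fin N → Bool × Bool) (2 * q + N * m)
  refine ⟨M, hM0, fun {ε ι} E I ρ hE hI hdis hq => ?_⟩
  rcases E.eq_empty_or_nonempty with rfl | hne
  · exact ⟨fun _ => ∅, by simp, by simp⟩
  obtain ⟨en, hen, heninj, hensurj⟩ := exists_enum E hne
  have hh : ∀ e, ∃ h : ℕ → ι, e ∈ E → (∀ i < (I e).card, h i ∈ I e) ∧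
      Set.InjOn h (Set.Iio (I e).card) := fun e => by
    by_cases he : e ∈ E
    · obtain ⟨h, h1, h2, -⟩ := exists_enum (I e) (Finset.card_pos.mp (by have := hI e he; omega))
      exact ⟨h, fun _ => ⟨h1, h2⟩⟩
    · obtain ⟨e₁, he₁⟩ := hne
      obtain ⟨x, hx⟩ := Finset.card_pos.mp (show 0 < (I e₁).card by have := hI e₁ he₁; omega)
      exact ⟨fun _ => x, fun h => absurd h he⟩
  choose h hh using hh
  obtain ⟨g, hg, hginj, k, hk⟩ := hM (Finset.range M) (by simp)
    (fun i j (a b : Fin N) => (decide (ρ (h (en a) i) (h (en b) j)),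
      decide (ρ (h (en a) j) (h (en b) i))))
  have hgI : ∀ e ∈ E, ∀ i < 2 * q + N * m, g i < (I e).card := fun e he i hi =>
    lt_of_lt_of_le (by simpa using hg i hi) (hI e he)
  have hinj : ∀ e ∈ E, Set.InjOn (fun i => h e (g i)) (Set.Iio (2 * q + N * m)) :=
    fun e he i hi j hj hij =>
      hginj hi hj ((hh e he).2 (hgI e he i hi) (hgI e he j hj) hij)
  have hdisj : ∀ e ∈ E, ∀ f ∈ E, ∀ i < 2 * q + N * m, ∀ j < 2 * q + N * m, i ≠ j →
      h e (g i) ≠ h f (g j) := by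
    intro e he f hf i hi j hj hij heq
    by_cases hef : e = f
    · subst hef
      exact hij (hinj e he hi hj heq)
    · exact Finset.disjoint_left.mp (hdis e he f hf hef) ((hh e he).1 _ (hgI e he i hi))
        (heq ▸ (hh f hf).1 _ (hgI f hf j hj))
  have hbic : ∀ e ∈ E, ∀ f ∈ E, ∀ x y, x + q ≤ 2 * q → y + q ≤ 2 * q →
      (∀ i < q, ∀ j < q, x + i ≠ y + j) →
      ∃ i < q, ∃ j < q, ¬ ρ (h e (g (x + i))) (h f (g (y + j))) := by
    intro e he f hf x y hx hy hxy
    obtain ⟨a, ha, b, hb, hab⟩ := hq ((Finset.range q).image (fun i => h e (g (x + i))))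
      ((Finset.range q).image (fun i => h f (g (y + i))))
      (card_image_shift (hinj e he) (by omega)) (card_image_shift (hinj f hf) (by omega))
      (by
        rw [Finset.disjoint_left]
        intro z hz hz'
        obtain ⟨i, hi, rfl⟩ := Finset.mem_image.mp hz
        obtain ⟨j, hj, hij⟩ := Finset.mem_image.mp hz'
        simp only [Finset.mem_range] at hi hj
        exact hdisj e he f hf (x + i) (by omega) (y + j) (by omega) (hxy i hi j hj) hij.symm)
      (by
        intro a ha
        obtain ⟨i, hi, rfl⟩ := Finset.mem_image.mp ha
        simp only [Finset.mem_range] at hi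
        exact ⟨e, he, (hh e he).1 _ (hgI e he _ (by omega))⟩)
      (by
        intro a ha
        obtain ⟨i, hi, rfl⟩ := Finset.mem_image.mp ha
        simp only [Finset.mem_range] at hi
        exact ⟨f, hf, (hh f hf).1 _ (hgI f hf _ (by omega))⟩)
    obtain ⟨i, hi, rfl⟩ := Finset.mem_image.mp ha
    obtain ⟨j, hj, rfl⟩ := Finset.mem_image.mp hb
    exact ⟨i, by simpa using hi, j, by simpa using hj, hab⟩
  choose! idx hidx hidx' using hensurj
  -- By homogeneity, one related pair at distinct positions would yield a biclique between the
  -- positions below `q` and the next `q`.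
  have key : ∀ e ∈ E, ∀ f ∈ E, ∀ i < 2 * q + N * m, ∀ j < 2 * q + N * m, i ≠ j →
      ¬ ρ (h e (g i)) (h f (g j)) := by
    intro e he f hf i hi j hj hij hρ
    have hcol : ∀ i j, i < j → j < 2 * q + N * m →
        (decide (ρ (h e (g i)) (h f (g j))), decide (ρ (h e (g j)) (h f (g i)))) =
          k ⟨idx e, (hidx e he).trans_le hE⟩ ⟨idx f, (hidx f hf).trans_le hE⟩ := by
      intro i j hij hj
      have := congrFun (congrFun (hk i j hij hj) ⟨idx e, (hidx e he).trans_le hE⟩)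
        ⟨idx f, (hidx f hf).trans_le hE⟩
      simpa only [hidx' e he, hidx' f hf] using this
    rcases lt_or_gt_of_ne hij with hlt | hlt
    · obtain ⟨i', hi', j', hj', hn⟩ := hbic e he f hf 0 q (by omega) (by omega)
        (fun i hi j hj => by omega)
      have h1 := hcol i j hlt hj
      rw [← hcol (0 + i') (q + j') (by omega) (by omega)] at h1
      have h2 := congrArg Prod.fst h1
      simp only [decide_eq_decide] at h2
      exact hn (h2.mp hρ)
    · obtain ⟨i', hi', j', hj', hn⟩ := hbic e he f hf q 0 (by omega) (by omega)
        (fun i hi j hj => by omega)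
      have h1 := hcol j i hlt hi
      rw [← hcol (0 + j') (q + i') (by omega) (by omega)] at h1
      have h2 := congrArg Prod.snd h1
      simp only [decide_eq_decide] at h2
      exact hn (h2.mp hρ)
  have hlt : ∀ e ∈ E, ∀ r < m, idx e * m + r < 2 * q + N * m := by
    intro e he r hr
    have : idx e + 1 ≤ N := (hidx e he).trans_le hE
    have := Nat.mul_le_mul_right m this
    rw [Nat.succ_mul] at this
    omega
  -- Homogeneity says nothing about members of different families at the same position, so the
  -- families use disjoint blocks of positions.
  refine ⟨fun e => (Finset.range m).image (fun r => h e (g (idx e * m + r))), ?_, ?_⟩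
  · intro e he
    refine ⟨?_, card_image_shift (hinj e he) ?_⟩
    · intro x hx
      obtain ⟨r, hr, rfl⟩ := Finset.mem_image.mp hx
      exact (hh e he).1 _ (hgI e he _ (hlt e he r (by simpa using hr)))
    · have : idx e + 1 ≤ N := (hidx e he).trans_le hE
      have := Nat.mul_le_mul_right m this
      rw [Nat.succ_mul] at this
      omega
  · intro e he f hf a ha b hb hab
    obtain ⟨r, hr, rfl⟩ := Finset.mem_image.mp ha
    obtain ⟨r', hr', rfl⟩ := Finset.mem_image.mp hb
    simp only [Finset.mem_range] at hr hr'
    refine key e he f hf _ (hlt e he r hr) _ (hlt f hf r' hr') fun hEq => hab ?_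
    have hdiv : idx e = idx f := by
      have h1 : (idx e * m + r) / m = idx e := by
        rw [mul_comm, Nat.mul_add_div (by omega), Nat.div_eq_of_lt hr, add_zero]
      have h2 : (idx f * m + r') / m = idx f := by
        rw [mul_comm, Nat.mul_add_div (by omega), Nat.div_eq_of_lt hr', add_zero]
      rw [← h1, hEq, h2]
    have hef : e = f := by rw [← hidx' e he, hdiv, hidx' f hf]
    rw [hEq, hef]

/-- The case of one family of `clean`. -/
theorem clean_one (q m : ℕ) :
    ∃ M, 0 < M ∧ ∀ {ι : Type v} (I : Finset ι) (ρ : ι → ι → Prop), M ≤ I.card →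
      (∀ A B : Finset ι, A.card = q → B.card = q → Disjoint A B → A ⊆ I → B ⊆ I →
        ∃ a ∈ A, ∃ b ∈ B, ¬ ρ a b) →
      ∃ J ⊆ I, J.card = m ∧ ∀ a ∈ J, ∀ b ∈ J, a ≠ b → ¬ ρ a b := by
  obtain ⟨M, hM0, hM⟩ := clean.{0, v} 1 q m
  refine ⟨M, hM0, fun {ι} I ρ hI hq => ?_⟩
  obtain ⟨J, hJ, hJ'⟩ := hM {()} (fun _ => I) ρ (by simp) (by simpa using hI) (by simp)
    (fun A B hA hB hAB h1 h2 => hq A B hA hB hAB (fun a ha => by simpa using h1 a ha)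
      (fun b hb => by simpa using h2 b hb))
  exact ⟨J (), (hJ () (by simp)).1, (hJ () (by simp)).2, hJ' () (by simp) () (by simp)⟩

end

section

variable {V : Type u} {G : SimpleGraph V}

/-! ### Induced paths as sequences -/

/-- The first `n` terms of `p` are, in this order, the vertices of an induced path. -/
def IPath (G : SimpleGraph V) (p : ℕ → V) (n : ℕ) : Prop :=
  Set.InjOn p (Set.Iio n) ∧ ∀ i < n, ∀ j < n, (G.Adj (p i) (p j) ↔ i + 1 = j ∨ j + 1 = i)

/-- The set of the first `n` terms of `p`. -/
def seg (p : ℕ → V) (n : ℕ) : Set V := {v | ∃ i < n, p i = v}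

theorem mem_seg {p : ℕ → V} {n i : ℕ} (hi : i < n) : p i ∈ seg p n := ⟨i, hi, rfl⟩

theorem seg_mono {p : ℕ → V} {n m : ℕ} (h : n ≤ m) : seg p n ⊆ seg p m := by
  rintro _ ⟨i, hi, rfl⟩
  exact mem_seg (hi.trans_le h)

theorem seg_shift_subset {p : ℕ → V} {n m a : ℕ} (h : a + m ≤ n) :
    seg (fun i => p (a + i)) m ⊆ seg p n := by
  rintro _ ⟨i, hi, rfl⟩
  exact mem_seg (by omega)

theorem IPath.shift {p : ℕ → V} {n m a : ℕ} (hp : IPath G p n) (h : a + m ≤ n) :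
    IPath G (fun i => p (a + i)) m := by
  refine ⟨fun i hi j hj hij => ?_, fun i hi j hj => ?_⟩
  · simp only [Set.mem_Iio] at hi hj
    have := hp.1 (show a + i < n by omega) (show a + j < n by omega) hij
    omega
  · rw [hp.2 _ (by omega) _ (by omega)]
    omega

theorem IPath.mono {p : ℕ → V} {n m : ℕ} (hp : IPath G p n) (h : m ≤ n) : IPath G p m :=
  ⟨fun _ hi _ hj hij => hp.1 (lt_of_lt_of_le hi h) (lt_of_lt_of_le hj h) hij,
    fun i hi j hj => hp.2 i (hi.trans_le h) j (hj.trans_le h)⟩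

theorem IPath.reverse {p : ℕ → V} {n : ℕ} (hp : IPath G p n) :
    IPath G (fun i => p (n - 1 - i)) n := by
  refine ⟨fun i hi j hj hij => ?_, fun i hi j hj => ?_⟩
  · simp only [Set.mem_Iio] at hi hj
    have := hp.1 (show n - 1 - i < n by omega) (show n - 1 - j < n by omega) hij
    omega
  · rw [hp.2 _ (by omega) _ (by omega)]
    omega

theorem seg_reverse {p : ℕ → V} {n : ℕ} : seg (fun i => p (n - 1 - i)) n = seg p n := by
  ext v
  constructor
  · rintro ⟨i, hi, rfl⟩
    exact mem_seg (by omega)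
  · rintro ⟨i, hi, rfl⟩
    exact ⟨n - 1 - i, by omega, by simp only; congr 1; omega⟩

theorem IPath.isPathIn {p : ℕ → V} {n : ℕ} (hp : IPath G p n) (hn : 0 < n) :
    IsPathIn G (seg p n) := by
  obtain ⟨k, rfl⟩ : ∃ k, n = k + 1 := ⟨n - 1, by omega⟩
  refine ⟨_, _, k, ⟨⟨fun i : Fin (k + 1) => p i, fun i j hij =>
    Fin.ext (hp.1 i.2 j.2 hij)⟩, fun {i j} => ?_⟩, rfl, rfl, ?_⟩
  · rw [SimpleGraph.pathGraph_adj]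
    exact hp.2 i i.2 j j.2
  · ext v
    constructor
    · rintro ⟨i, rfl⟩
      exact mem_seg i.2
    · rintro ⟨i, hi, rfl⟩
      exact ⟨⟨i, hi⟩, rfl⟩

theorem exists_iPath_of_isPathBetween {P : Set V} {x y : V} (h : IsPathBetween G P x y) :
    ∃ (p : ℕ → V) (n : ℕ), IPath G p (n + 1) ∧ seg p (n + 1) = P ∧ p 0 = x ∧ p n = y := by
  obtain ⟨n, f, h0, hl, hr⟩ := h
  have hf : ∀ i, (hi : i < n + 1) → (if h : i < n + 1 then f ⟨i, h⟩ else x) = f ⟨i, hi⟩ :=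
    fun _ hi => dif_pos hi
  refine ⟨fun i => if hi : i < n + 1 then f ⟨i, hi⟩ else x, n, ⟨?_, ?_⟩, ?_, ?_, ?_⟩
  · intro i hi j hj hij
    simp only [Set.mem_Iio] at hi hj
    simp only [hf i hi, hf j hj] at hij
    simpa using f.injective hij
  · intro i hi j hj
    simp only [hf i hi, hf j hj]
    rw [f.map_adj_iff, SimpleGraph.pathGraph_adj]
  · ext v
    rw [← hr]
    constructor
    · rintro ⟨i, hi, rfl⟩
      exact ⟨⟨i, hi⟩, (hf i hi).symm⟩
    · rintro ⟨i, rfl⟩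
      exact ⟨i, i.2, hf i i.2⟩
  · simp only [hf 0 (by omega)]
    exact h0
  · simp only [hf n (by omega)]
    exact hl

theorem _root_.InducedGrid.Anticomplete.symm {X Y : Set V} (h : Anticomplete G X Y) :
    Anticomplete G Y X :=
  fun y hy x hx hxy => h x hx y hy hxy.symm

theorem _root_.InducedGrid.Anticomplete.mono {X Y X' Y' : Set V}
    (h : Anticomplete G X Y) (hX : X' ⊆ X) (hY : Y' ⊆ Y) : Anticomplete G X' Y' :=
  fun x hx y hy => h x (hX hx) y (hY hy)

theorem not_anticomplete {X Y : Set V} :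
    ¬ Anticomplete G X Y ↔ ∃ x ∈ X, ∃ y ∈ Y, G.Adj x y := by
  simp [Anticomplete]

/-! ### Connected sets and shortest paths -/

/-- The set `D` induces a connected subgraph (or is empty). -/
def Conn (G : SimpleGraph V) (D : Set V) : Prop :=
  ∀ x ∈ D, ∀ y ∈ D, Relation.ReflTransGen (fun a b => a ∈ D ∧ b ∈ D ∧ G.Adj a b) x y

theorem conn_singleton (x : V) : Conn G {x} := by
  rintro _ rfl _ rfl
  exact .refl

theorem Conn.union {A B : Set V} (hA : Conn G A) (hB : Conn G B) {a b : V} (ha : a ∈ A)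
    (hb : b ∈ B) (hab : G.Adj a b) : Conn G (A ∪ B) := by
  have hA' : ∀ x ∈ A, ∀ y ∈ A,
      Relation.ReflTransGen (fun u v => u ∈ A ∪ B ∧ v ∈ A ∪ B ∧ G.Adj u v) x y :=
    fun x hx y hy => Relation.ReflTransGen.mono (fun u v h => ⟨.inl h.1, .inl h.2.1, h.2.2⟩) x y
      (hA x hx y hy)
  have hB' : ∀ x ∈ B, ∀ y ∈ B,
      Relation.ReflTransGen (fun u v => u ∈ A ∪ B ∧ v ∈ A ∪ B ∧ G.Adj u v) x y :=
    fun x hx y hy => Relation.ReflTransGen.mono (fun u v h => ⟨.inr h.1, .inr h.2.1, h.2.2⟩) x y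
      (hB x hx y hy)
  rintro x (hx | hx) y (hy | hy)
  · exact hA' x hx y hy
  · exact ((hA' x hx a ha).tail ⟨.inl ha, .inr hb, hab⟩).trans (hB' b hb y hy)
  · exact ((hB' x hx b hb).tail ⟨.inr hb, .inl ha, hab.symm⟩).trans (hA' a ha y hy)
  · exact hB' x hx y hy

theorem IPath.conn {p : ℕ → V} {n : ℕ} (hp : IPath G p n) : Conn G (seg p n) := by
  have key : ∀ i j, i ≤ j → j < n → Relation.ReflTransGen
      (fun a b => a ∈ seg p n ∧ b ∈ seg p n ∧ G.Adj a b) (p i) (p j) ∧ Relation.ReflTransGen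
      (fun a b => a ∈ seg p n ∧ b ∈ seg p n ∧ G.Adj a b) (p j) (p i) := by
    intro i j hij
    induction j, hij using Nat.le_induction with
    | base => exact fun _ => ⟨.refl, .refl⟩
    | succ j hij ih =>
      intro hj
      have hadj : G.Adj (p j) (p (j + 1)) := (hp.2 j (by omega) _ hj).mpr (.inl rfl)
      exact ⟨(ih (by omega)).1.tail ⟨mem_seg (by omega), mem_seg hj, hadj⟩,
        (ih (by omega)).2.head ⟨mem_seg hj, mem_seg (by omega), hadj.symm⟩⟩
  rintro _ ⟨i, hi, rfl⟩ _ ⟨j, hj, rfl⟩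
  rcases le_total i j with h | h
  · exact (key i j h hj).1
  · exact (key j i h hi).2

theorem exists_walk_of_reflTransGen {D : Set V} {x y : V} (hx : x ∈ D)
    (h : Relation.ReflTransGen (fun a b => a ∈ D ∧ b ∈ D ∧ G.Adj a b) x y) :
    ∃ (k : ℕ) (d : ℕ → V), (∀ i ≤ k, d i ∈ D) ∧ (∀ i < k, G.Adj (d i) (d (i + 1))) ∧
      d 0 = x ∧ d k = y := by
  induction h using Relation.ReflTransGen.head_induction_on with
  | refl => exact ⟨0, fun _ => y, fun _ _ => hx, by simp, rfl, rfl⟩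
  | @head a b hab _ ih =>
    obtain ⟨k, d, h1, h2, h3, h4⟩ := ih hab.2.1
    refine ⟨k + 1, fun i => if i = 0 then a else d (i - 1), ?_, ?_, by simp, by simpa using h4⟩
    · intro i hi
      by_cases h0 : i = 0
      · simpa [h0] using hx
      · simpa [h0] using h1 (i - 1) (by omega)
    · intro i hi
      by_cases h0 : i = 0
      · subst h0
        simpa [h3] using hab.2.2
      · have := h2 (i - 1) (by omega)
        rw [show i - 1 + 1 = i by omega] at this
        simpa [h0] using this

/-- In a connected set, a shortest path from `A` to `B` is induced and meets `A` and `B` only in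
its ends. -/
theorem Conn.exists_shortest {D A B : Set V} (hD : Conn G D) (hA : ∃ a ∈ D, a ∈ A)
    (hB : ∃ b ∈ D, b ∈ B) :
    ∃ (k : ℕ) (d : ℕ → V), IPath G d (k + 1) ∧ (∀ i ≤ k, d i ∈ D) ∧ d 0 ∈ A ∧ d k ∈ B ∧
      (∀ i ≤ k, d i ∈ A → i = 0) ∧ ∀ i ≤ k, d i ∈ B → i = k := by
  classical
  -- Minimising over all walks in `D` from `A` to `B`, with no ends prescribed, excludes chords as
  -- well as further visits to `A` and `B`.
  let P : ℕ → Prop := fun k => ∃ d : ℕ → V, (∀ i ≤ k, d i ∈ D) ∧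
    (∀ i < k, G.Adj (d i) (d (i + 1))) ∧ d 0 ∈ A ∧ d k ∈ B
  have hP : ∃ k, P k := by
    obtain ⟨a, ha, haA⟩ := hA
    obtain ⟨b, hb, hbB⟩ := hB
    obtain ⟨k, d, h1, h2, h3, h4⟩ := exists_walk_of_reflTransGen ha (hD a ha b hb)
    exact ⟨k, d, h1, h2, h3 ▸ haA, h4 ▸ hbB⟩
  obtain ⟨d, h1, h2, h3, h4⟩ := Nat.find_spec hP
  set k := Nat.find hP with hk
  have hmin : ∀ m < k, ¬ P m := fun m hm => Nat.find_min hP hm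
  have hA' : ∀ i ≤ k, d i ∈ A → i = 0 := by
    intro i hi hiA
    by_contra h0
    refine hmin (k - i) (by omega) ⟨fun j => d (i + j), fun j hj => h1 _ (by omega),
      fun j hj => h2 (i + j) (by omega), hiA, ?_⟩
    simpa only [show i + (k - i) = k by omega] using h4
  have hB' : ∀ i ≤ k, d i ∈ B → i = k := by
    intro i hi hiB
    by_contra h0
    exact hmin i (by omega) ⟨d, fun j hj => h1 _ (by omega), fun j hj => h2 j (by omega), h3, hiB⟩
  have hchord : ∀ i r, 1 ≤ r → i + r + 1 ≤ k → ¬ G.Adj (d i) (d (i + r + 1)) := by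
    intro i r hr hir hadj
    refine hmin (k - r) (by omega) ⟨fun x => if x ≤ i then d x else d (x + r), ?_, ?_, by simpa, ?_⟩
    · intro j hj
      by_cases hji : j ≤ i
      · simpa [hji] using h1 j (by omega)
      · simpa [hji] using h1 (j + r) (by omega)
    · intro j hj
      rcases lt_trichotomy j i with hji | hji | hji
      · simpa [hji.le, show j + 1 ≤ i by omega] using h2 j (by omega)
      · subst hji
        simpa [show j + 1 + r = j + r + 1 by omega] using hadj
      · simpa [show ¬ j ≤ i by omega, show ¬ j + 1 ≤ i by omega,
          show j + 1 + r = j + r + 1 by omega] using h2 (j + r) (by omega)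
    · have hkr : ¬ k - r ≤ i := by omega
      simpa only [hkr, if_false, show k - r + r = k by omega] using h4
  have hinj : ∀ i j, i < j → j ≤ k → d i ≠ d j := by
    intro i j hij hj heq
    rcases eq_or_lt_of_le hj with rfl | hj'
    · have := hB' i (by omega) (by rw [heq]; exact h4)
      omega
    · refine hchord i (j - i) (by omega) (by omega) ?_
      rw [heq, show i + (j - i) + 1 = j + 1 by omega]
      exact h2 j hj'
  refine ⟨k, d, ⟨?_, ?_⟩, h1, h3, h4, hA', hB'⟩
  · intro i hi j hj hij
    simp only [Set.mem_Iio] at hi hj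
    rcases lt_trichotomy i j with h | h | h
    · exact absurd hij (hinj i j h (by omega))
    · exact h
    · exact absurd hij.symm (hinj j i h (by omega))
  · have hlt : ∀ i j, i < j → j ≤ k → (G.Adj (d i) (d j) ↔ i + 1 = j) := by
      intro i j hij hj
      refine ⟨fun h => ?_, fun h => h ▸ h2 i (by omega)⟩
      by_contra hne
      refine hchord i (j - i - 1) (by omega) (by omega) ?_
      rwa [show i + (j - i - 1) + 1 = j by omega]
    intro i hi j hj
    rcases lt_trichotomy i j with h | h | h
    · rw [hlt i j h (by omega)]
      omega
    · subst h
      simp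
    · rw [G.adj_comm, hlt j i h (by omega)]
      omega

/-! ### Long induced cycles -/

/-- Some cycle of length at least `o + 2` is contained in `U`. -/
def HasLong (G : SimpleGraph V) (o : ℕ) (U : Set V) : Prop :=
  ∃ C ⊆ U, ∃ n, o + 2 ≤ n ∧ IsCycleIn G C n

theorem HasLong.mono {o : ℕ} {U U' : Set V} (h : HasLong G o U) (hU : U ⊆ U') :
    HasLong G o U' := by
  obtain ⟨C, hC, h⟩ := h
  exact ⟨C, hC.trans hU, h⟩

theorem isCycleIn_seg {f : ℕ → V} {N : ℕ} (hN : 3 ≤ N) (hinj : Set.InjOn f (Set.Iio N))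
    (hadj : ∀ i < N, ∀ j < N, i < j → (G.Adj (f i) (f j) ↔ i + 1 = j ∨ (i = 0 ∧ j + 1 = N))) :
    IsCycleIn G (seg f N) N := by
  refine ⟨hN, ⟨⟨fun i : Fin N => f i, fun i j hij => Fin.ext (hinj i.2 j.2 hij)⟩,
    fun {i j} => ?_⟩, ?_⟩
  · have key : ∀ i j : Fin N, i < j →
        (G.Adj (f i) (f j) ↔ (SimpleGraph.cycleGraph N).Adj i j) := by
      intro i j hij
      rw [SimpleGraph.cycleGraph_adj', hadj i i.2 j j.2 hij, Fin.coe_sub_iff_lt.mpr hij,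
        Fin.sub_val_of_le hij.le]
      have := i.2
      have := j.2
      have : i.val < j.val := hij
      omega
    rcases lt_trichotomy i j with h | h | h
    · exact key i j h
    · subst h
      simp
    · exact (G.adj_comm _ _).trans ((key j i h).trans (SimpleGraph.adj_comm _ _ _))
  · ext v
    constructor
    · rintro ⟨i, rfl⟩
      exact mem_seg i.2
    · rintro ⟨i, hi, rfl⟩
      exact ⟨⟨i, hi⟩, rfl⟩

/-- An induced path together with a disjoint connected set that attaches to both ends and not to
the interior of the path contains a cycle longer than the path. -/
theorem hasLong_of_path {o n : ℕ} {q : ℕ → V} {D : Set V} (hq : IPath G q n) (h2 : 2 ≤ n)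
    (hn : o + 1 ≤ n) (hD : Conn G D) (hdis : Disjoint D (seg q n))
    (h0 : ∃ d ∈ D, G.Adj (q 0) d) (h1 : ∃ d ∈ D, G.Adj (q (n - 1)) d)
    (hmid : ∀ i, 0 < i → i + 1 < n → ∀ d ∈ D, ¬ G.Adj (q i) d) :
    HasLong G o (D ∪ seg q n) := by
  -- The cycle follows `q` and returns by a shortest path in `D` between the neighbourhoods of the
  -- two ends; it has `n + k + 1 ≥ o + 2` vertices.
  obtain ⟨k, d, hd, hdD, hd0, hdk, hA, hB⟩ := hD.exists_shortest (A := {v | G.Adj (q 0) v})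
    (B := {v | G.Adj (q (n - 1)) v}) h0 h1
  simp only [Set.mem_ofPred_eq] at hd0 hdk hA hB
  have hqd : ∀ i < n, ∀ j ≤ k, (G.Adj (q i) (d j) ↔ (i = 0 ∧ j = 0) ∨ (i + 1 = n ∧ j = k)) := by
    intro i hi j hj
    constructor
    · intro h
      rcases Nat.eq_zero_or_pos i with rfl | hi0
      · exact .inl ⟨rfl, hA j hj h⟩
      · by_cases hin : i + 1 < n
        · exact absurd h (hmid i hi0 hin _ (hdD j hj))
        · obtain rfl : i = n - 1 := by omega
          exact .inr ⟨by omega, hB j hj h⟩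
    · rintro (⟨rfl, rfl⟩ | ⟨h, rfl⟩)
      · exact hd0
      · obtain rfl : i = n - 1 := by omega
        exact hdk
  have hne : ∀ i < n, ∀ j ≤ k, q i ≠ d j := fun i hi j hj h =>
    Set.disjoint_left.mp hdis (hdD j hj) (h ▸ mem_seg hi)
  let f : ℕ → V := fun i => if i < n then q i else d (k - (i - n))
  have hf1 : ∀ i, i < n → f i = q i := fun i hi => if_pos hi
  have hf2 : ∀ i, n ≤ i → f i = d (k - (i - n)) := fun i hi => if_neg (by omega)
  refine ⟨seg f (n + k + 1), ?_, n + k + 1, by omega, isCycleIn_seg (by omega) ?_ ?_⟩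
  · rintro _ ⟨i, hi, rfl⟩
    by_cases hin : i < n
    · rw [hf1 i hin]
      exact .inr (mem_seg hin)
    · rw [hf2 i (by omega)]
      exact .inl (hdD _ (by omega))
  · intro i hi j hj hij
    simp only [Set.mem_Iio] at hi hj
    by_cases hin : i < n <;> by_cases hjn : j < n
    · rw [hf1 i hin, hf1 j hjn] at hij
      exact hq.1 hin hjn hij
    · rw [hf1 i hin, hf2 j (by omega)] at hij
      exact absurd hij (hne i hin _ (by omega))
    · rw [hf2 i (by omega), hf1 j hjn] at hij
      exact absurd hij.symm (hne j hjn _ (by omega))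
    · rw [hf2 i (by omega), hf2 j (by omega)] at hij
      have := hd.1 (show k - (i - n) < k + 1 by omega) (show k - (j - n) < k + 1 by omega) hij
      omega
  · intro i hi j hj hij
    by_cases hin : i < n <;> by_cases hjn : j < n
    · rw [hf1 i hin, hf1 j hjn, hq.2 i hin j hjn]
      omega
    · rw [hf1 i hin, hf2 j (by omega), hqd i hin _ (by omega)]
      omega
    · omega
    · rw [hf2 i (by omega), hf2 j (by omega), hd.2 _ (by omega) _ (by omega)]
      omega

theorem not_isPerforated {c o : ℕ} (U : Fin c → Set V) (hU : ∀ i, HasLong G o (U i))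
    (hdis : ∀ i j, i ≠ j → Disjoint (U i) (U j) ∧ Anticomplete G (U i) (U j)) :
    ¬ IsPerforated G c o := by
  choose C hC n hn hcyc using hU
  exact fun h => h ⟨C, fun i => ⟨n i, hn i, hcyc i⟩, fun i j hij =>
    ⟨(hdis i j hij).1.mono (hC i) (hC j), (hdis i j hij).2.mono (hC i) (hC j)⟩⟩

/-! ### The standing assumptions -/

/-- The graph `G` is a potential counterexample: it is perforated, and has neither of the
structures looked for. -/
structure Good (c l o s t : ℕ) (G : SimpleGraph V) : Prop where
  hc : 1 ≤ c
  ho : 1 ≤ o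
  perforated : IsPerforated G c o
  clique : ¬ SimpleGraph.IsIndContained (⊤ : SimpleGraph (Fin t)) G
  biclique : ¬ SimpleGraph.IsIndContained (completeBipartiteGraph (Fin t) (Fin t)) G
  plain : ¬ ∃ (S : Finset V) (𝓛 : Finset (Set V)), IsConstellation G s l S 𝓛 ∧ IsPlain G 𝓛

variable (c l o s t : ℕ)

theorem exists_stable (m : ℕ) : ∃ M, 0 < M ∧ ∀ {V : Type u} {G : SimpleGraph V},
    Good c l o s t G → ∀ A : Finset V, M ≤ A.card →
      ∃ S ⊆ A, S.card = m ∧ G.IsIndepSet (S : Set V) := by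
  classical
  obtain ⟨M, hM0, hM⟩ := ramsey Bool (t + m)
  refine ⟨M, hM0, fun {V G} hG A hA => ?_⟩
  obtain ⟨g, hg, hginj, k, hk⟩ := hM A hA (fun x y => decide (G.Adj x y))
  cases k with
  | true =>
    refine absurd ⟨⟨⟨fun i : Fin t => g i, fun i j hij => Fin.ext (hginj ?_ ?_ hij)⟩,
      fun {i j} => ?_⟩⟩ hG.clique
    · have := i.2
      simp only [Set.mem_Iio]
      omega
    · have := j.2
      simp only [Set.mem_Iio]
      omega
    · have hi := i.2
      have hj := j.2
      rw [SimpleGraph.top_adj]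
      rcases lt_trichotomy i j with h | h | h
      · have := hk i j h (by omega)
        simp only [decide_eq_true_eq] at this
        exact iff_of_true this h.ne
      · subst h
        simp
      · have := hk j i h (by omega)
        simp only [decide_eq_true_eq] at this
        exact iff_of_true this.symm h.ne'
  | false =>
    have h0 := card_image_shift hginj (a := 0) (q := m) (by omega)
    refine ⟨_, ?_, h0, ?_⟩
    · intro x hx
      obtain ⟨i, hi, rfl⟩ := Finset.mem_image.mp hx
      exact hg _ (by simp at hi; omega)
    · intro x hx y hy hxy
      obtain ⟨i, hi, rfl⟩ := Finset.mem_image.mp hx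
      obtain ⟨j, hj, rfl⟩ := Finset.mem_image.mp hy
      simp only [Finset.mem_range] at hi hj
      simp only [zero_add] at hxy ⊢
      rcases lt_trichotomy i j with h | h | h
      · simpa using hk i j h (by omega)
      · exact absurd (by rw [h]) hxy
      · intro hadj
        exact absurd hadj.symm (by simpa using hk j i h (by omega))

/-- Stable `t`-subsets of the two sides of a biclique would induce $K_{t,t}$. Disjointness of `A`
and `B` need not be assumed, since adjacent vertices are distinct. -/
theorem exists_not_adj : ∃ q, 0 < q ∧ ∀ {V : Type u} {G : SimpleGraph V},
    Good c l o s t G → ∀ A B : Finset V, A.card = q → B.card = q →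
      ∃ a ∈ A, ∃ b ∈ B, ¬ G.Adj a b := by
  obtain ⟨M, hM0, hM⟩ := exists_stable c l o s t t
  refine ⟨M, hM0, fun {V G} hG A B hA hB => ?_⟩
  by_contra! hcon
  obtain ⟨A', hA', hAc, hAs⟩ := hM hG A hA.ge
  obtain ⟨B', hB', hBc, hBs⟩ := hM hG B hB.ge
  let eA : Fin t ≃ A' := (A'.equivFinOfCardEq hAc).symm
  let eB : Fin t ≃ B' := (B'.equivFinOfCardEq hBc).symm
  have hAB : ∀ i j, G.Adj (eA i) (eB j) := fun i j => hcon _ (hA' (eA i).2) _ (hB' (eB j).2)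
  have hAA : ∀ i j, ¬ G.Adj (eA i) (eA j) := fun i j h => hAs (eA i).2 (eA j).2 h.ne h
  have hBB : ∀ i j, ¬ G.Adj (eB i) (eB j) := fun i j h => hBs (eB i).2 (eB j).2 h.ne h
  refine hG.biclique ⟨⟨⟨Sum.elim (fun i => (eA i : V)) (fun i => (eB i : V)), ?_⟩, @?_⟩⟩
  · rintro (i | i) (j | j) hij
    · simpa using hij
    · exact absurd hij (hAB i j).ne
    · exact absurd hij (hAB j i).ne'
    · simpa using hij
  · rintro (i | i) (j | j)
    · exact iff_of_false (hAA i j) (by simp)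
    · exact iff_of_true (hAB i j) (by simp)
    · exact iff_of_true (hAB j i).symm (by simp)
    · exact iff_of_false (hBB i j) (by simp)

/-- Among many disjoint sets of bounded size, there are no large bicliques of the relation
"joined by an edge". -/
theorem exists_not_touching (w : ℕ) : ∃ q, 0 < q ∧ ∀ {V : Type u} {G : SimpleGraph V},
    Good c l o s t G → ∀ {ι : Type v} (A B : Finset ι) (F : ι → Fin w → V),
      A.card = q → B.card = q → (∀ a ∈ A, ∀ b ∈ A, a ≠ b → ∀ k k', F a k ≠ F b k') →
      (∀ a ∈ B, ∀ b ∈ B, a ≠ b → ∀ k k', F a k ≠ F b k') →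
      ∃ a ∈ A, ∃ b ∈ B, ∀ k k', ¬ G.Adj (F a k) (F b k') := by
  classical
  obtain ⟨q, hq0, hq⟩ := exists_not_adj.{u} c l o s t
  obtain ⟨M, hM0, hM⟩ := ramsey (Fin w → Fin w → Bool) (q + q)
  refine ⟨M, hM0, fun {V G} hG {ι} A B F hA hB hFA hFB => ?_⟩
  by_contra! hcon
  obtain ⟨hA1, hA2, hA3, -⟩ := exists_enum A (Finset.card_pos.mp (by omega))
  obtain ⟨hB1, hB2, hB3, -⟩ := exists_enum B (Finset.card_pos.mp (by omega))
  -- Two positions are coloured by the coordinate pairs that carry an edge. If all members touch,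
  -- some coordinate pair carries an edge throughout, which gives a biclique between the first `q`
  -- chosen members of `A` and the last `q` of `B`.
  obtain ⟨g, hg, hginj, χ, hχ⟩ := hM (Finset.range M) (by simp)
    (fun i j k k' => decide (G.Adj (F (hA1 i) k) (F (hB1 j) k')))
  have hgM : ∀ i < q + q, g i < M := fun i hi => by simpa using hg i hi
  obtain ⟨k, k', hkk⟩ := hcon _ (hA2 (g 0) (by rw [hA]; exact hgM 0 (by omega)))
    _ (hB2 (g q) (by rw [hB]; exact hgM q (by omega)))
  have hχt : χ k k' = true := by
    rw [← hχ 0 q hq0 (by omega)]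
    simpa using hkk
  have hadj : ∀ i j, i < j → j < q + q → G.Adj (F (hA1 (g i)) k) (F (hB1 (g j)) k') := by
    intro i j hij hj
    have := congrFun (congrFun (hχ i j hij hj) k) k'
    rw [hχt] at this
    simpa using this
  have hIA : Set.InjOn (fun i => F (hA1 (g i)) k) (Set.Iio (q + q)) := by
    intro i hi j hj hij
    by_contra hne
    refine hFA _ (hA2 _ (hA ▸ hgM i hi)) _ (hA2 _ (hA ▸ hgM j hj)) (fun h => hne ?_) k k hij
    exact hginj hi hj (hA3 (hA ▸ hgM i hi) (hA ▸ hgM j hj) h)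
  have hIB : Set.InjOn (fun i => F (hB1 (g i)) k') (Set.Iio (q + q)) := by
    intro i hi j hj hij
    by_contra hne
    refine hFB _ (hB2 _ (hB ▸ hgM i hi)) _ (hB2 _ (hB ▸ hgM j hj)) (fun h => hne ?_) k' k' hij
    exact hginj hi hj (hB3 (hB ▸ hgM i hi) (hB ▸ hgM j hj) h)
  obtain ⟨a, ha, b, hb, hab⟩ := hq hG _ _ (card_image_shift hIA (a := 0) (by omega))
    (card_image_shift hIB (a := q) le_rfl)
  obtain ⟨i, hi, rfl⟩ := Finset.mem_image.mp ha
  obtain ⟨j, hj, rfl⟩ := Finset.mem_image.mp hb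
  simp only [Finset.mem_range] at hi hj
  exact hab (hadj _ _ (by omega) (by omega))

end

section

variable {V : Type u} {G : SimpleGraph V}

/-! ### Disjoint paths without long cycles -/

/-- Touching paths in a set without long cycles can be shortened to at most `o` vertices while
keeping prescribed pairs of paths touching. -/
theorem exists_short_paths {o : ℕ} (ho : 1 ≤ o) {W : Set V} (hW : ¬ HasLong G o W) {ι : Type v}
    (I : Finset ι) (Γ : ι → ι → Prop) (p : ι → ℕ → V) (n : ι → ℕ)
    (hp : ∀ a ∈ I, IPath G (p a) (n a)) (hpW : ∀ a ∈ I, seg (p a) (n a) ⊆ W)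
    (hdis : ∀ a ∈ I, ∀ b ∈ I, a ≠ b → Disjoint (seg (p a) (n a)) (seg (p b) (n b)))
    (hsymm : ∀ a b, Γ a b → Γ b a) (hirr : ∀ a, ¬ Γ a a)
    (htouch : ∀ a ∈ I, ∀ b ∈ I, Γ a b → ¬ Anticomplete G (seg (p a) (n a)) (seg (p b) (n b)))
    (hconn : ∀ a ∈ I, ∀ b ∈ I, ∀ b' ∈ I, Γ a b → Γ a b' → b ≠ b' →
      Γ b b' ∨ ∃ u ∈ I, u ≠ a ∧ Γ u b ∧ Γ u b' ∧
        Anticomplete G (seg (p a) (n a)) (seg (p u) (n u))) :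
    ∃ (p' : ι → ℕ → V) (n' : ι → ℕ),
      (∀ a ∈ I, IPath G (p' a) (n' a) ∧ seg (p' a) (n' a) ⊆ seg (p a) (n a) ∧ n' a ≤ o) ∧
      ∀ a ∈ I, ∀ b ∈ I, Γ a b → ¬ Anticomplete G (seg (p' a) (n' a)) (seg (p' b) (n' b)) := by
  classical
  let F : (ι → ℕ) → (ι → ℕ) → ι → Set V := fun s m a => seg (fun i => p a (s a + i)) (m a)
  -- Among all choices of subpaths that keep the prescribed contacts, take one with the least total
  -- number of vertices.
  let Q : ℕ → Prop := fun N => ∃ s m : ι → ℕ, (∀ a ∈ I, s a + m a ≤ n a) ∧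
    (∀ a ∈ I, ∀ b ∈ I, Γ a b → ¬ Anticomplete G (F s m a) (F s m b)) ∧ ∑ a ∈ I, m a = N
  have hQ : ∃ N, Q N := ⟨_, fun _ => 0, n, fun a _ => by simp, by simpa [F] using htouch, rfl⟩
  obtain ⟨s, m, hsm, ht, hsum⟩ := Nat.find_spec hQ
  have hmin : ∀ N < Nat.find hQ, ¬ Q N := fun N hN => Nat.find_min hQ hN
  have hsub : ∀ a ∈ I, F s m a ⊆ seg (p a) (n a) := fun a ha => seg_shift_subset (hsm a ha)
  have hIP : ∀ a ∈ I, IPath G (fun i => p a (s a + i)) (m a) :=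
    fun a ha => (hp a ha).shift (hsm a ha)
  refine ⟨fun a i => p a (s a + i), m, fun a ha => ⟨hIP a ha, hsub a ha, ?_⟩, ht⟩
  by_contra hlong
  -- Shortening the path `a` by one vertex must destroy a contact. Used for both ends, this gives a
  -- `b` touching it only in its last vertex and a `b'` touching it only in its first.
  have hdrop : ∀ x, x + (m a - 1) ≤ n a →
      ∃ b ∈ I, Γ a b ∧ Anticomplete G (seg (fun i => p a (x + i)) (m a - 1)) (F s m b) := by
    intro x hx
    by_contra! hcon
    let s' := Function.update s a x
    let m' := Function.update m a (m a - 1)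
    have hF : ∀ b, b ≠ a → F s' m' b = F s m b := fun b hb => by
      simp [F, s', m', Function.update_of_ne hb]
    have hFa : F s' m' a = seg (fun i => p a (x + i)) (m a - 1) := by
      simp [F, s', m']
    refine hmin (∑ b ∈ I, m' b) ?_ ⟨s', m', ?_, ?_, rfl⟩
    · rw [← hsum]
      refine Finset.sum_lt_sum (fun b _ => ?_) ⟨a, ha, ?_⟩
      · by_cases hb : b = a
        · subst hb
          simp [m']
        · simp [m', Function.update_of_ne hb]
      · simp only [m', Function.update_self]
        omega
    · intro b hb
      by_cases hba : b = a
      · subst hba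
        simpa [s', m'] using hx
      · simpa [s', m', Function.update_of_ne hba] using hsm b hb
    · intro b hb b' hb' hΓ
      by_cases hba : b = a
      · subst hba
        have hne : b' ≠ b := fun h => hirr b (h ▸ hΓ)
        rw [hFa, hF b' hne]
        exact hcon b' hb' hΓ
      · rw [hF b hba]
        by_cases hba' : b' = a
        · subst hba'
          rw [hFa]
          exact fun h => hcon b hb (hsymm _ _ hΓ) h.symm
        · rw [hF b' hba']
          exact ht b hb b' hb' hΓ
  obtain ⟨b, hb, hΓb, hanb⟩ := hdrop (s a) (by have := hsm a ha; omega)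
  obtain ⟨b', hb', hΓb', hanb'⟩ := hdrop (s a + 1) (by have := hsm a ha; omega)
  obtain ⟨_, ⟨i, hi, rfl⟩, d, hd, hid⟩ := not_anticomplete.mp (ht a ha b hb hΓb)
  obtain ⟨_, ⟨i', hi', rfl⟩, d', hd', hid'⟩ := not_anticomplete.mp (ht a ha b' hb' hΓb')
  have hib : ∀ j < m a, ∀ d ∈ F s m b, G.Adj (p a (s a + j)) d → j = m a - 1 := by
    intro j hj d hd hadj
    by_contra hne
    exact hanb _ ⟨j, by omega, rfl⟩ d hd hadj
  have hib' : ∀ j < m a, ∀ d ∈ F s m b', G.Adj (p a (s a + j)) d → j = 0 := by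
    intro j hj d hd hadj
    by_contra hne
    refine hanb' _ ⟨j - 1, by omega, rfl⟩ d hd ?_
    simpa only [show s a + 1 + (j - 1) = s a + j by omega] using hadj
  obtain rfl := hib i hi d hd hid
  obtain rfl := hib' i' hi' d' hd' hid'
  have hbb : b ≠ b' := by
    rintro rfl
    have := hib' _ hi d hd hid
    omega
  have hnea : ∀ x, Γ a x → a ≠ x := fun x hx h => hirr a (by rw [← h] at hx; exact hx)
  have hdisF : ∀ x ∈ I, a ≠ x → Disjoint (F s m x) (F s m a) := fun x hx hax =>
    ((hdis a ha x hx hax).mono (hsub a ha) (hsub x hx)).symm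
  have key : ∀ D : Set V, Conn G D → F s m b ⊆ D → F s m b' ⊆ D → D ⊆ W →
      Disjoint D (F s m a) → (∀ j, 0 < j → j + 1 < m a → ∀ d ∈ D, ¬ G.Adj (p a (s a + j)) d) →
      False := by
    intro D hD hbD hbD' hDW hDd hmid
    refine hW ((hasLong_of_path (o := o) (hIP a ha) (by omega) (by omega) hD hDd
      ⟨d', hbD' hd', hid'⟩ ⟨d, hbD hd, hid⟩ hmid).mono ?_)
    exact Set.union_subset hDW ((hsub a ha).trans (hpW a ha))
  have hmidb : ∀ j, 0 < j → j + 1 < m a → ∀ d ∈ F s m b, ¬ G.Adj (p a (s a + j)) d :=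
    fun j hj0 hj d hd h => by have := hib j (by omega) d hd h; omega
  have hmidb' : ∀ j, 0 < j → j + 1 < m a → ∀ d ∈ F s m b', ¬ G.Adj (p a (s a + j)) d :=
    fun j hj0 hj d hd h => by have := hib' j (by omega) d hd h; omega
  have hFW : ∀ x ∈ I, F s m x ⊆ W := fun x hx => (hsub x hx).trans (hpW x hx)
  -- The paths `b` and `b'` touch, or are joined through `u`. Either way they lie in a connected set
  -- missing the interior of the path `a`, which closes a long cycle in `W`.
  rcases hconn a ha b hb b' hb' hΓb hΓb' hbb with h | ⟨u, hu, hua, hub, hub', hau⟩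
  · obtain ⟨x, hx, y, hy, hxy⟩ := not_anticomplete.mp (ht b hb b' hb' h)
    refine key (F s m b ∪ F s m b') ((hIP b hb).conn.union (hIP b' hb').conn hx hy hxy)
      Set.subset_union_left Set.subset_union_right (Set.union_subset (hFW b hb) (hFW b' hb'))
      (Set.disjoint_union_left.mpr ⟨hdisF b hb (hnea b hΓb), hdisF b' hb' (hnea b' hΓb')⟩) ?_
    rintro j hj0 hj d (hd | hd)
    · exact hmidb j hj0 hj d hd
    · exact hmidb' j hj0 hj d hd
  · obtain ⟨x, hx, y, hy, hxy⟩ := not_anticomplete.mp (ht u hu b hb hub)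
    obtain ⟨x', hx', y', hy', hxy'⟩ := not_anticomplete.mp (ht u hu b' hb' hub')
    refine key ((F s m u ∪ F s m b) ∪ F s m b')
      (((hIP u hu).conn.union (hIP b hb).conn hx hy hxy).union (hIP b' hb').conn (.inl hx') hy' hxy')
      (fun _ h => .inl (.inr h)) Set.subset_union_right
      (Set.union_subset (Set.union_subset (hFW u hu) (hFW b hb)) (hFW b' hb'))
      (Set.disjoint_union_left.mpr ⟨Set.disjoint_union_left.mpr
        ⟨hdisF u hu hua.symm, hdisF b hb (hnea b hΓb)⟩, hdisF b' hb' (hnea b' hΓb')⟩) ?_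
    rintro j hj0 hj d ((hd | hd) | hd)
    · exact hau _ (hsub a ha ⟨j, by omega, rfl⟩) d (hsub u hu hd)
    · exact hmidb j hj0 hj d hd
    · exact hmidb' j hj0 hj d hd

variable (c l o s t : ℕ)

/-- A nonempty path with at most `w` vertices is a `w`-tuple, its last vertex being repeated, so
`exists_not_touching` applies; an empty path is anticomplete to everything. -/
theorem exists_anticomplete_short (w : ℕ) : ∃ q, 0 < q ∧ ∀ {V : Type u} {G : SimpleGraph V},
    Good c l o s t G → ∀ {ι : Type v} (A B : Finset ι) (p : ι → ℕ → V) (n : ι → ℕ),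
      A.card = q → B.card = q → (∀ a ∈ A, n a ≤ w) → (∀ b ∈ B, n b ≤ w) →
      (∀ a ∈ A, ∀ b ∈ A, a ≠ b → Disjoint (seg (p a) (n a)) (seg (p b) (n b))) →
      (∀ a ∈ B, ∀ b ∈ B, a ≠ b → Disjoint (seg (p a) (n a)) (seg (p b) (n b))) →
      ∃ a ∈ A, ∃ b ∈ B, Anticomplete G (seg (p a) (n a)) (seg (p b) (n b)) := by
  obtain ⟨q, hq0, hq⟩ := exists_not_touching.{u, v} c l o s t w
  refine ⟨q, hq0, fun {V G} hG {ι} A B p n hA hB hnA hnB hdA hdB => ?_⟩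
  obtain ⟨a₀, ha₀⟩ := Finset.card_pos.mp (show 0 < A.card by omega)
  obtain ⟨b₀, hb₀⟩ := Finset.card_pos.mp (show 0 < B.card by omega)
  by_cases hposA : ∀ a ∈ A, 0 < n a
  swap
  · push Not at hposA
    obtain ⟨a, ha, h0⟩ := hposA
    refine ⟨a, ha, b₀, hb₀, ?_⟩
    rintro _ ⟨i, hi, rfl⟩
    omega
  by_cases hposB : ∀ a ∈ B, 0 < n a
  swap
  · push Not at hposB
    obtain ⟨b, hb, h0⟩ := hposB
    refine ⟨a₀, ha₀, b, hb, ?_⟩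
    rintro _ - _ ⟨i, hi, rfl⟩
    omega
  obtain ⟨a, ha, b, hb, hab⟩ := hq hG A B (fun a k => p a (min k (n a - 1))) hA hB
    (fun a ha b hb hab k k' h => Set.disjoint_left.mp (hdA a ha b hb hab)
      (mem_seg (by have := hposA a ha; omega))
      (h.symm ▸ (mem_seg (by have := hposA b hb; omega) :
        p b (min k' (n b - 1)) ∈ seg (p b) (n b))))
    (fun a ha b hb hab k k' h => Set.disjoint_left.mp (hdB a ha b hb hab)
      (mem_seg (by have := hposB a ha; omega))
      (h.symm ▸ (mem_seg (by have := hposB b hb; omega) :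
        p b (min k' (n b - 1)) ∈ seg (p b) (n b))))
  refine ⟨a, ha, b, hb, ?_⟩
  rintro _ ⟨i, hi, rfl⟩ _ ⟨j, hj, rfl⟩ hadj
  have h1 := hnA a ha
  have h2 := hnB b hb
  refine hab ⟨i, by omega⟩ ⟨j, by omega⟩ ?_
  simpa only [min_eq_left (show i ≤ n a - 1 by omega), min_eq_left (show j ≤ n b - 1 by omega)]

/-- If all pairs touched, `exists_short_paths` with `Γ` the complete graph would shorten the paths
to at most `o` vertices without losing a contact, against `exists_anticomplete_short`. -/
theorem exists_anticomplete_pair : ∃ q, 0 < q ∧ ∀ {V : Type u} {G : SimpleGraph V},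
    Good c l o s t G → ∀ {W : Set V}, ¬ HasLong G o W → ∀ {ι : Type v} (I : Finset ι)
      (p : ι → ℕ → V) (n : ι → ℕ), I.card = q →
      (∀ a ∈ I, IPath G (p a) (n a) ∧ seg (p a) (n a) ⊆ W) →
      (∀ a ∈ I, ∀ b ∈ I, a ≠ b → Disjoint (seg (p a) (n a)) (seg (p b) (n b))) →
      ∃ a ∈ I, ∃ b ∈ I, a ≠ b ∧ Anticomplete G (seg (p a) (n a)) (seg (p b) (n b)) := by
  classical
  obtain ⟨q, hq0, hq⟩ := exists_anticomplete_short.{u, v} c l o s t o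
  refine ⟨q + q, by omega, fun {V G} hG {W} hW {ι} I p n hI hp hdis => ?_⟩
  by_contra! hcon
  obtain ⟨p', n', h1, h2⟩ := exists_short_paths hG.ho hW I (fun a b => a ≠ b) p n
    (fun a ha => (hp a ha).1) (fun a ha => (hp a ha).2) hdis (fun _ _ h => h.symm)
    (fun _ h => h rfl) hcon (fun a ha b hb b' hb' _ _ h => .inl h)
  obtain ⟨A, hA, hAc⟩ := Finset.exists_subset_card_eq (show q ≤ I.card by omega)
  have hBc : (I \ A).card = q := by
    rw [Finset.card_sdiff_of_subset hA]
    omega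
  obtain ⟨a, ha, b, hb, hab⟩ := hq hG A (I \ A) p' n' hAc hBc
    (fun a ha => (h1 a (hA ha)).2.2) (fun a ha => (h1 a (Finset.sdiff_subset ha)).2.2)
    (fun a ha b hb hab => (hdis a (hA ha) b (hA hb) hab).mono (h1 a (hA ha)).2.1
      (h1 b (hA hb)).2.1)
    (fun a ha b hb hab => (hdis a (Finset.sdiff_subset ha) b (Finset.sdiff_subset hb) hab).mono
      (h1 a (Finset.sdiff_subset ha)).2.1 (h1 b (Finset.sdiff_subset hb)).2.1)
  exact h2 a (hA ha) b (Finset.sdiff_subset hb)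
    (fun h => (Finset.mem_sdiff.mp hb).2 (h ▸ ha)) hab

theorem exists_pairwise_anticomplete (m : ℕ) : ∃ M, 0 < M ∧ ∀ {V : Type u} {G : SimpleGraph V},
    Good c l o s t G → ∀ {W : Set V}, ¬ HasLong G o W → ∀ {ι : Type v} (I : Finset ι)
      (p : ι → ℕ → V) (n : ι → ℕ), M ≤ I.card →
      (∀ a ∈ I, IPath G (p a) (n a) ∧ seg (p a) (n a) ⊆ W) →
      (∀ a ∈ I, ∀ b ∈ I, a ≠ b → Disjoint (seg (p a) (n a)) (seg (p b) (n b))) →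
      ∃ J ⊆ I, J.card = m ∧ ∀ a ∈ J, ∀ b ∈ J, a ≠ b →
        Anticomplete G (seg (p a) (n a)) (seg (p b) (n b)) := by
  classical
  obtain ⟨q, hq0, hq⟩ := exists_anticomplete_pair.{u, v} c l o s t
  obtain ⟨M, hM0, hM⟩ := ramsey.{v} Bool (q + m)
  refine ⟨M, hM0, fun {V G} hG {W} hW {ι} I p n hI hp hdis => ?_⟩
  obtain ⟨g, hg, hginj, k, hk⟩ := hM I hI
    (fun a b => decide (Anticomplete G (seg (p a) (n a)) (seg (p b) (n b))))
  have himg : ∀ r ≤ q + m, (Finset.range r).image (fun i => g (0 + i)) ⊆ I := by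
    intro r hr x hx
    obtain ⟨i, hi, rfl⟩ := Finset.mem_image.mp hx
    exact hg _ (by simp at hi; omega)
  cases k with
  | false =>
    obtain ⟨a, ha, b, hb, hne, hab⟩ := hq hG hW _ p n
      (card_image_shift hginj (a := 0) (q := q) (by omega))
      (fun a ha => hp a (himg q (by omega) ha))
      (fun a ha b hb => hdis a (himg q (by omega) ha) b (himg q (by omega) hb))
    obtain ⟨i, hi, rfl⟩ := Finset.mem_image.mp ha
    obtain ⟨j, hj, rfl⟩ := Finset.mem_image.mp hb
    simp only [Finset.mem_range, zero_add] at hi hj hne hab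
    rcases lt_trichotomy i j with h | h | h
    · exact absurd hab (by simpa using hk i j h (by omega))
    · exact absurd (by rw [h]) hne
    · exact absurd hab.symm (by simpa using hk j i h (by omega))
  | true =>
    refine ⟨_, himg m (by omega), card_image_shift hginj (by omega), ?_⟩
    intro a ha b hb hne
    obtain ⟨i, hi, rfl⟩ := Finset.mem_image.mp ha
    obtain ⟨j, hj, rfl⟩ := Finset.mem_image.mp hb
    simp only [Finset.mem_range, zero_add] at hi hj hne ⊢
    rcases lt_trichotomy i j with h | h | h
    · simpa using hk i j h (by omega)
    · exact absurd (by rw [h]) hne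
    · exact .symm (by simpa using hk j i h (by omega))

/-- In a set without long cycles, two large families of disjoint paths contain an anticomplete
pair. -/
theorem exists_anticomplete_paths : ∃ q, 0 < q ∧ ∀ {V : Type u} {G : SimpleGraph V},
    Good c l o s t G → ∀ {W : Set V}, ¬ HasLong G o W → ∀ {ι : Type v} (I A B : Finset ι)
      (p : ι → ℕ → V) (n : ι → ℕ), A.card = q → B.card = q → Disjoint A B → A ⊆ I → B ⊆ I →
      (∀ a ∈ I, IPath G (p a) (n a) ∧ seg (p a) (n a) ⊆ W) →
      (∀ a ∈ I, ∀ b ∈ I, a ≠ b → Disjoint (seg (p a) (n a)) (seg (p b) (n b))) →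
      ∃ a ∈ A, ∃ b ∈ B, Anticomplete G (seg (p a) (n a)) (seg (p b) (n b)) := by
  classical
  obtain ⟨q, hq0, hq⟩ := exists_anticomplete_short.{u, v} c l o s t o
  obtain ⟨M, hM0, hM⟩ := exists_pairwise_anticomplete.{u, v} c l o s t (q + 1)
  refine ⟨M, hM0, fun {V G} hG {W} hW {ι} I A B p n hA hB hAB hAI hBI hp hdis => ?_⟩
  by_contra! hcon
  obtain ⟨A', hA', hAc, hAa⟩ := hM hG hW A p n hA.ge (fun a ha => hp a (hAI ha))
    (fun a ha b hb => hdis a (hAI ha) b (hAI hb))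
  obtain ⟨B', hB', hBc, hBa⟩ := hM hG hW B p n hB.ge (fun a ha => hp a (hBI ha))
    (fun a ha b hb => hdis a (hBI ha) b (hBI hb))
  have hI' : ∀ a ∈ A' ∪ B', a ∈ I := fun a ha => by
    rcases Finset.mem_union.mp ha with h | h
    · exact hAI (hA' h)
    · exact hBI (hB' h)
  have hnd : ∀ a, a ∈ A' → a ∈ B' → False := fun a h1 h2 =>
    Finset.disjoint_left.mp hAB (hA' h1) (hB' h2)
  -- Here `Γ` is complete bipartite. Two neighbours of `a` lie on the opposite side, and any other
  -- path `u` on the side of `a` touches both and is anticomplete to `a`. This is why each side was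
  -- first made pairwise anticomplete, with `q + 1 ≥ 2` members.
  obtain ⟨p', n', h1, h2⟩ := exists_short_paths hG.ho hW (A' ∪ B')
    (fun a b => (a ∈ A' ∧ b ∈ B') ∨ (a ∈ B' ∧ b ∈ A')) p n
    (fun a ha => (hp a (hI' a ha)).1) (fun a ha => (hp a (hI' a ha)).2)
    (fun a ha b hb => hdis a (hI' a ha) b (hI' b hb))
    (fun a b h => h.symm.imp And.symm And.symm)
    (fun a h => h.elim (fun h => hnd a h.1 h.2) (fun h => hnd a h.2 h.1))
    (by
      rintro a - b - (⟨ha, hb⟩ | ⟨ha, hb⟩)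
      · exact hcon a (hA' ha) b (hB' hb)
      · exact fun h => hcon b (hA' hb) a (hB' ha) h.symm)
    (by
      rintro a - b - b' - hab hab' -
      right
      rcases hab with ⟨ha, hb⟩ | ⟨ha, hb⟩
      · obtain ⟨u, hu, hua⟩ := Finset.exists_mem_ne (show 1 < A'.card by omega) a
        have hb' : b' ∈ B' := hab'.elim (fun h => h.2) (fun h => (hnd a ha h.1).elim)
        exact ⟨u, Finset.mem_union_left _ hu, hua, .inl ⟨hu, hb⟩, .inl ⟨hu, hb'⟩,
          hAa a ha u hu hua.symm⟩
      · obtain ⟨u, hu, hua⟩ := Finset.exists_mem_ne (show 1 < B'.card by omega) a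
        have hb' : b' ∈ A' := hab'.elim (fun h => (hnd a h.1 ha).elim) (fun h => h.2)
        exact ⟨u, Finset.mem_union_right _ hu, hua, .inr ⟨hu, hb⟩, .inr ⟨hu, hb'⟩,
          hBa a ha u hu hua.symm⟩)
  obtain ⟨A₁, hA₁, hA₁c⟩ := Finset.exists_subset_card_eq (show q ≤ A'.card by omega)
  obtain ⟨B₁, hB₁, hB₁c⟩ := Finset.exists_subset_card_eq (show q ≤ B'.card by omega)
  have hl : ∀ a ∈ A₁, a ∈ A' ∪ B' := fun a ha => Finset.mem_union_left _ (hA₁ ha)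
  have hr : ∀ a ∈ B₁, a ∈ A' ∪ B' := fun a ha => Finset.mem_union_right _ (hB₁ ha)
  obtain ⟨a, ha, b, hb, hab⟩ := hq hG A₁ B₁ p' n' hA₁c hB₁c
    (fun a ha => (h1 a (hl a ha)).2.2) (fun a ha => (h1 a (hr a ha)).2.2)
    (fun a ha b hb hab => (hdis a (hI' a (hl a ha)) b (hI' b (hl b hb)) hab).mono
      (h1 a (hl a ha)).2.1 (h1 b (hl b hb)).2.1)
    (fun a ha b hb hab => (hdis a (hI' a (hr a ha)) b (hI' b (hr b hb)) hab).mono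
      (h1 a (hr a ha)).2.1 (h1 b (hr b hb)).2.1)
  exact h2 a (hl a ha) b (hr b hb) (.inl ⟨hA₁ ha, hB₁ hb⟩) hab

/-- A vertex set and disjoint anticomplete paths, all seen by each of the vertices: large
structures of this kind do not exist. -/
theorem exists_not_seen : ∃ q, 0 < q ∧ ∀ {V : Type u} {G : SimpleGraph V},
    Good c l o s t G → ∀ {ι : Type v} (S : Finset V) (B : Finset ι)
      (p : ι → ℕ → V) (n : ι → ℕ), q ≤ S.card → q ≤ B.card →
      (∀ b ∈ B, IPath G (p b) (n b)) →
      (∀ a ∈ B, ∀ b ∈ B, a ≠ b → Disjoint (seg (p a) (n a)) (seg (p b) (n b)) ∧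
        Anticomplete G (seg (p a) (n a)) (seg (p b) (n b))) →
      (∀ x ∈ S, ∀ b ∈ B, x ∉ seg (p b) (n b)) →
      ∃ x ∈ S, ∃ b ∈ B, ∀ y ∈ seg (p b) (n b), ¬ G.Adj x y := by
  classical
  obtain ⟨M, hM0, hM⟩ := exists_stable.{u} c l o s t s
  refine ⟨M + l, by omega, fun {V G} hG {ι} S B p n hS hB hp hdis hnot => ?_⟩
  by_contra! hcon
  obtain ⟨S', hS', hSc, hSs⟩ := hM hG S (by omega)
  obtain ⟨B', hB', hBc⟩ := Finset.exists_subset_card_eq (show l ≤ B.card by omega)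
  obtain ⟨x₀, hx₀⟩ := Finset.card_pos.mp (show 0 < S.card by omega)
  have hpos : ∀ b ∈ B', 0 < n b := fun b hb => by
    obtain ⟨_, ⟨i, hi, -⟩, -⟩ := hcon x₀ hx₀ b (hB' hb)
    omega
  have hinj : Set.InjOn (fun b => seg (p b) (n b)) (B' : Set ι) := by
    intro a ha b hb hab
    by_contra hne
    have := (hdis a (hB' ha) b (hB' hb) hne).1
    simp only at hab
    rw [hab] at this
    exact Set.disjoint_left.mp this (mem_seg (hpos b hb)) (mem_seg (hpos b hb))
  refine hG.plain ⟨S', B'.image (fun b => seg (p b) (n b)), ⟨⟨hSc, ?_, ?_, ?_⟩, ?_, hSs, ?_⟩, ?_⟩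
  · rw [Finset.card_image_of_injOn hinj, hBc]
  · intro L hL
    obtain ⟨b, hb, rfl⟩ := Finset.mem_image.mp hL
    exact (hp b (hB' hb)).isPathIn (hpos b hb)
  · intro L hL L' hL' hne
    obtain ⟨b, hb, rfl⟩ := Finset.mem_image.mp hL
    obtain ⟨b', hb', rfl⟩ := Finset.mem_image.mp hL'
    exact (hdis b (hB' hb) b' (hB' hb') (fun h => hne (by rw [h]))).1
  · intro L hL
    obtain ⟨b, hb, rfl⟩ := Finset.mem_image.mp hL
    exact Set.disjoint_left.mpr fun x hx => hnot x (hS' hx) b (hB' hb)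
  · intro x hx L hL
    obtain ⟨b, hb, rfl⟩ := Finset.mem_image.mp hL
    exact hcon x (hS' hx) b (hB' hb)
  · intro L hL L' hL' hne
    obtain ⟨b, hb, rfl⟩ := Finset.mem_image.mp hL
    obtain ⟨b', hb', rfl⟩ := Finset.mem_image.mp hL'
    exact (hdis b (hB' hb) b' (hB' hb') (fun h => hne (by rw [h]))).2

end

/-! ### Anticomplete subfamilies of paths -/

section

variable {V : Type u} {G : SimpleGraph V}

variable (c l o s t : ℕ)

/-- `exists_not_seen` in the form used to clean families of paths: for a vertex `x a` on each path,
disregarding the path itself. -/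
theorem exists_not_seen_family : ∃ q, 0 < q ∧ ∀ {V : Type u} {G : SimpleGraph V},
    Good c l o s t G → ∀ {ι : Type v} (A B : Finset ι) (x : ι → V)
      (p : ι → ℕ → V) (n : ι → ℕ), A.card = q → B.card = q →
      (∀ a ∈ A, ∀ b ∈ A, a ≠ b → x a ≠ x b) →
      (∀ b ∈ B, IPath G (p b) (n b)) →
      (∀ a ∈ B, ∀ b ∈ B, a ≠ b → Disjoint (seg (p a) (n a)) (seg (p b) (n b)) ∧
        Anticomplete G (seg (p a) (n a)) (seg (p b) (n b))) →
      (∀ a ∈ A, ∀ b ∈ B, x a ∉ seg (p b) (n b)) →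
      ∃ a ∈ A, ∃ b ∈ B, ∀ y ∈ seg (p b) (n b), ¬ G.Adj (x a) y := by
  classical
  obtain ⟨q, hq0, hq⟩ := exists_not_seen.{u, v} c l o s t
  refine ⟨q, hq0, fun {V G} hG {ι} A B x p n hA hB hx hp hdis hnot => ?_⟩
  have hc : (A.image x).card = q := by
    rw [Finset.card_image_of_injOn, hA]
    intro a ha b hb hab
    by_contra hne
    exact hx a ha b hb hne hab
  obtain ⟨y, hy, b, hb, h⟩ := hq hG (A.image x) B p n hc.ge hB.ge hp hdis (by
    intro y hy
    obtain ⟨a, ha, rfl⟩ := Finset.mem_image.mp hy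
    exact hnot a ha)
  obtain ⟨a, ha, rfl⟩ := Finset.mem_image.mp hy
  exact ⟨a, ha, b, hb, h⟩

/-- Large families of disjoint paths whose interiors lie in a set without long cycles contain
large pairwise anticomplete subfamilies. -/
theorem exists_clean_paths (N m : ℕ) : ∃ M, 0 < M ∧ ∀ {V : Type u} {G : SimpleGraph V},
    Good c l o s t G → ∀ {W : Set V}, ¬ HasLong G o W → ∀ {ε : Type w} {ι : Type v}
      (E : Finset ε) (I : ε → Finset ι) (p : ι → ℕ → V) (n : ι → ℕ), E.card ≤ N →
      (∀ e ∈ E, M ≤ (I e).card) → (∀ e ∈ E, ∀ f ∈ E, e ≠ f → Disjoint (I e) (I f)) →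
      (∀ e ∈ E, ∀ a ∈ I e, IPath G (p a) (n a) ∧ 0 < n a ∧
        ∀ i, 0 < i → i + 1 < n a → p a i ∈ W) →
      (∀ e ∈ E, ∀ f ∈ E, ∀ a ∈ I e, ∀ b ∈ I f, a ≠ b →
        Disjoint (seg (p a) (n a)) (seg (p b) (n b))) →
      ∃ J : ε → Finset ι, (∀ e ∈ E, J e ⊆ I e ∧ (J e).card = m) ∧
        ∀ e ∈ E, ∀ f ∈ E, ∀ a ∈ J e, ∀ b ∈ J f, a ≠ b →
          Anticomplete G (seg (p a) (n a)) (seg (p b) (n b)) := by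
  classical
  obtain ⟨q₁, -, hq₁⟩ := exists_anticomplete_paths.{u, v} c l o s t
  obtain ⟨q₂, -, hq₂⟩ := exists_not_touching.{u, v} c l o s t 2
  obtain ⟨q₃, -, hq₃⟩ := exists_not_seen_family.{u, v} c l o s t
  -- Four rounds of `clean`, used in the order `M₁`, `M₂`, `M₃`, `M₄`, remove edges between
  -- interiors, between ends, and from first and then last vertices to interiors. The last two
  -- rounds need anticomplete interiors in order to use `exists_not_seen_family`.
  obtain ⟨M₄, -, hM₄⟩ := clean.{w, v} N q₃ m
  obtain ⟨M₃, -, hM₃⟩ := clean.{w, v} N q₃ M₄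
  obtain ⟨M₂, -, hM₂⟩ := clean.{w, v} N q₂ M₃
  obtain ⟨M₁, hM₁0, hM₁⟩ := clean.{w, v} N q₁ M₂
  refine ⟨M₁, hM₁0, fun {V G} hG {W} hW {ε ι} E I p n hE hI hdI hp hdis => ?_⟩
  let x : ι → ℕ → V := fun a i => p a (1 + i)
  have hx : ∀ e ∈ E, ∀ a ∈ I e, IPath G (x a) (n a - 2) := by
    intro e he a ha
    by_cases h2 : 2 ≤ n a
    · exact (hp e he a ha).1.shift (by omega)
    · rw [show n a - 2 = 0 by omega]
      exact ⟨by intro i hi; simp at hi, by simp⟩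
  have hxs : ∀ a, seg (x a) (n a - 2) ⊆ seg (p a) (n a) := by
    rintro a _ ⟨i, hi, rfl⟩
    exact mem_seg (by omega)
  have hxW : ∀ e ∈ E, ∀ a ∈ I e, seg (x a) (n a - 2) ⊆ W := by
    rintro e he a ha _ ⟨i, hi, rfl⟩
    exact (hp e he a ha).2.2 _ (by omega) (by omega)
  have hxd : ∀ e ∈ E, ∀ f ∈ E, ∀ a ∈ I e, ∀ b ∈ I f, a ≠ b →
      Disjoint (seg (x a) (n a - 2)) (seg (x b) (n b - 2)) :=
    fun e he f hf a ha b hb hab => (hdis e he f hf a ha b hb hab).mono (hxs a) (hxs b)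
  obtain ⟨J₁, hJ₁, h₁⟩ := hM₁ E I
    (fun a b => ¬ Anticomplete G (seg (x a) (n a - 2)) (seg (x b) (n b - 2))) hE hI hdI (by
      intro A B hA hB hAB hAI hBI
      have hI' : ∀ a ∈ E.biUnion I, ∃ e ∈ E, a ∈ I e := fun a ha => by simpa using ha
      obtain ⟨a, ha, b, hb, h⟩ := hq₁ hG hW (E.biUnion I) A B x (fun a => n a - 2) hA hB hAB
        (fun a ha => by simpa using hAI a ha) (fun a ha => by simpa using hBI a ha)
        (fun a ha => by
          obtain ⟨e, he, hae⟩ := hI' a ha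
          exact ⟨hx e he a hae, hxW e he a hae⟩)
        (fun a ha b hb hab => by
          obtain ⟨e, he, hae⟩ := hI' a ha
          obtain ⟨f, hf, hbf⟩ := hI' b hb
          exact hxd e he f hf a hae b hbf hab)
      exact ⟨a, ha, b, hb, not_not.mpr h⟩)
  have hne : ∀ e ∈ E, ∀ f ∈ E, ∀ a ∈ I e, ∀ b ∈ I f, a ≠ b → ∀ i < n a, ∀ j < n b,
      p a i ≠ p b j := fun e he f hf a ha b hb hab i hi j hj h =>
    Set.disjoint_left.mp (hdis e he f hf a ha b hb hab) (mem_seg hi) (h ▸ mem_seg hj)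
  have hpos : ∀ e ∈ E, ∀ a ∈ I e, 0 < n a := fun e he a ha => (hp e he a ha).2.1
  let F : ι → Fin 2 → V := fun a => ![p a 0, p a (n a - 1)]
  have hF : ∀ e ∈ E, ∀ a ∈ I e, ∀ k, ∃ i < n a, F a k = p a i := by
    intro e he a ha k
    have := hpos e he a ha
    fin_cases k
    · exact ⟨0, this, rfl⟩
    · exact ⟨n a - 1, by omega, rfl⟩
  have hFne : ∀ e ∈ E, ∀ f ∈ E, ∀ a ∈ I e, ∀ b ∈ I f, a ≠ b → ∀ k k', F a k ≠ F b k' := by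
    intro e he f hf a ha b hb hab k k'
    obtain ⟨i, hi, hi'⟩ := hF e he a ha k
    obtain ⟨j, hj, hj'⟩ := hF f hf b hb k'
    rw [hi', hj']
    exact hne e he f hf a ha b hb hab i hi j hj
  have hJ₁I : ∀ e ∈ E, J₁ e ⊆ I e := fun e he => (hJ₁ e he).1
  obtain ⟨J₂, hJ₂, h₂⟩ := hM₂ E J₁ (fun a b => ∃ k k', G.Adj (F a k) (F b k')) hE
    (fun e he => (hJ₁ e he).2.ge)
    (fun e he f hf hef => (hdI e he f hf hef).mono (hJ₁I e he) (hJ₁I f hf)) (by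
      intro A B hA hB hAB hAI hBI
      have key : ∀ A : Finset ι, (∀ a ∈ A, ∃ e ∈ E, a ∈ J₁ e) →
          ∀ a ∈ A, ∀ b ∈ A, a ≠ b → ∀ k k', F a k ≠ F b k' := by
        intro A hA a ha b hb
        obtain ⟨e, he, hae⟩ := hA a ha
        obtain ⟨f, hf, hbf⟩ := hA b hb
        exact hFne e he f hf a (hJ₁I e he hae) b (hJ₁I f hf hbf)
      obtain ⟨a, ha, b, hb, h⟩ := hq₂ hG A B F hA hB (key A hAI) (key B hBI)
      exact ⟨a, ha, b, hb, by simpa using h⟩)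
  have hJ₂I : ∀ e ∈ E, J₂ e ⊆ J₁ e := fun e he => (hJ₂ e he).1
  -- the relation "the vertex with index `r a` sees the interior of the path"
  have key : ∀ (J : ε → Finset ι), (∀ e ∈ E, J e ⊆ J₁ e) → ∀ k : Fin 2, ∀ A B : Finset ι,
      A.card = q₃ → B.card = q₃ → Disjoint A B → (∀ a ∈ A, ∃ e ∈ E, a ∈ J e) →
      (∀ b ∈ B, ∃ e ∈ E, b ∈ J e) →
      ∃ a ∈ A, ∃ b ∈ B, ¬ ∃ y ∈ seg (x b) (n b - 2), G.Adj (F a k) y := by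
    intro J hJ k A B hA hB hAB hAI hBI
    obtain ⟨a, ha, b, hb, h⟩ := hq₃ hG A B (fun a => F a k) x (fun a => n a - 2) hA hB
      (fun a ha b hb hab => by
        obtain ⟨e, he, hae⟩ := hAI a ha
        obtain ⟨f, hf, hbf⟩ := hAI b hb
        exact hFne e he f hf a (hJ₁I e he (hJ e he hae)) b (hJ₁I f hf (hJ f hf hbf)) hab k k)
      (fun b hb => by
        obtain ⟨f, hf, hbf⟩ := hBI b hb
        exact hx f hf b (hJ₁I f hf (hJ f hf hbf)))
      (fun a ha b hb hab => by
        obtain ⟨e, he, hae⟩ := hBI a ha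
        obtain ⟨f, hf, hbf⟩ := hBI b hb
        exact ⟨hxd e he f hf a (hJ₁I e he (hJ e he hae)) b (hJ₁I f hf (hJ f hf hbf)) hab,
          not_not.mp (h₁ e he f hf a (hJ e he hae) b (hJ f hf hbf) hab)⟩)
      (by
        rintro a ha b hb ⟨j, hj, hjb⟩
        obtain ⟨e, he, hae⟩ := hAI a ha
        obtain ⟨f, hf, hbf⟩ := hBI b hb
        obtain ⟨i, hi, hi'⟩ := hF e he a (hJ₁I e he (hJ e he hae)) k
        simp only [hi'] at hjb
        exact hne e he f hf a (hJ₁I e he (hJ e he hae)) b (hJ₁I f hf (hJ f hf hbf))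
          (fun h => Finset.disjoint_left.mp hAB ha (h ▸ hb)) i hi (1 + j) (by omega) hjb.symm)
    exact ⟨a, ha, b, hb, by simpa using h⟩
  obtain ⟨J₃, hJ₃, h₃⟩ := hM₃ E J₂ (fun a b => ∃ y ∈ seg (x b) (n b - 2), G.Adj (F a 0) y) hE
    (fun e he => (hJ₂ e he).2.ge) (fun e he f hf hef => (hdI e he f hf hef).mono
      ((hJ₂I e he).trans (hJ₁I e he)) ((hJ₂I f hf).trans (hJ₁I f hf))) (key J₂ hJ₂I 0)
  have hJ₃I : ∀ e ∈ E, J₃ e ⊆ J₂ e := fun e he => (hJ₃ e he).1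
  obtain ⟨J₄, hJ₄, h₄⟩ := hM₄ E J₃ (fun a b => ∃ y ∈ seg (x b) (n b - 2), G.Adj (F a 1) y) hE
    (fun e he => (hJ₃ e he).2.ge) (fun e he f hf hef => (hdI e he f hf hef).mono
      ((hJ₃I e he).trans ((hJ₂I e he).trans (hJ₁I e he)))
      ((hJ₃I f hf).trans ((hJ₂I f hf).trans (hJ₁I f hf))))
    (key J₃ (fun e he => (hJ₃I e he).trans (hJ₂I e he)) 1)
  have hJ₄₃ : ∀ e ∈ E, ∀ a ∈ J₄ e, a ∈ J₃ e := fun e he a ha => (hJ₄ e he).1 ha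
  have hJ₄₂ : ∀ e ∈ E, ∀ a ∈ J₄ e, a ∈ J₂ e := fun e he a ha => hJ₃I e he (hJ₄₃ e he a ha)
  have hJ₄₁ : ∀ e ∈ E, ∀ a ∈ J₄ e, a ∈ J₁ e := fun e he a ha => hJ₂I e he (hJ₄₂ e he a ha)
  refine ⟨J₄, fun e he => ⟨fun a ha => hJ₁I e he (hJ₄₁ e he a ha), (hJ₄ e he).2⟩, ?_⟩
  have hcases : ∀ a, ∀ i < n a, (∃ k, F a k = p a i) ∨ p a i ∈ seg (x a) (n a - 2) := by
    intro a i hi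
    rcases Nat.eq_zero_or_pos i with rfl | h0
    · exact .inl ⟨0, rfl⟩
    by_cases h1 : i + 1 < n a
    · exact .inr ⟨i - 1, by omega, by simp only [x]; congr 1; omega⟩
    · exact .inl ⟨1, by simp only [F, Matrix.cons_val_one, Matrix.cons_val_fin_one]; congr 1; omega⟩
  have hend : ∀ e ∈ E, ∀ f ∈ E, ∀ a ∈ J₄ e, ∀ b ∈ J₄ f, a ≠ b → ∀ k, ∀ y ∈ seg (x b) (n b - 2),
      ¬ G.Adj (F a k) y := by
    intro e he f hf a ha b hb hab k y hy hadj
    fin_cases k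
    · exact h₃ e he f hf a (hJ₄₃ e he a ha) b (hJ₄₃ f hf b hb) hab ⟨y, hy, hadj⟩
    · exact h₄ e he f hf a ha b hb hab ⟨y, hy, hadj⟩
  rintro e he f hf a ha b hb hab _ ⟨i, hi, rfl⟩ _ ⟨j, hj, rfl⟩ hadj
  rcases hcases a i hi with ⟨k, hk⟩ | hi' <;> rcases hcases b j hj with ⟨k', hk'⟩ | hj'
  · rw [← hk, ← hk'] at hadj
    exact h₂ e he f hf a (hJ₄₂ e he a ha) b (hJ₄₂ f hf b hb) hab ⟨k, k', hadj⟩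
  · rw [← hk] at hadj
    exact hend e he f hf a ha b hb hab k _ hj' hadj
  · rw [← hk'] at hadj
    exact hend f hf e he b hb a ha hab.symm k' _ hi' hadj.symm
  · exact not_not.mp (h₁ e he f hf a (hJ₄₁ e he a ha) b (hJ₄₁ f hf b hb) hab) _ hi' _ hj' hadj

end

section

variable {V : Type u} {G : SimpleGraph V}

/-! ### Attachments of vertices to a path -/

/-- Disjoint anticomplete connected sets attached to the two ends of pairwise independent intervals
of an induced path yield anticomplete long cycles. -/
theorem not_isPerforated_of_intervals {c o n : ℕ} {q : ℕ → V} (hq : IPath G q n) (ho : 1 ≤ o)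
    (D : Fin c → Set V) (α β : Fin c → ℕ) (hαβ : ∀ e, α e + o ≤ β e) (hβn : ∀ e, β e < n)
    (hD : ∀ e, Conn G (D e)) (hDq : ∀ e, Disjoint (D e) (seg q n))
    (hDD : ∀ e f, e ≠ f → Disjoint (D e) (D f) ∧ Anticomplete G (D e) (D f))
    (hα : ∀ e, ∃ d ∈ D e, G.Adj d (q (α e))) (hβ : ∀ e, ∃ d ∈ D e, G.Adj d (q (β e)))
    (hmid : ∀ e x, α e < x → x < β e → ∀ d ∈ D e, ¬ G.Adj d (q x))
    (hconf : ∀ e f, e ≠ f → ∀ x < n, α f ≤ x + 1 → x ≤ β f + 1 → ∀ d ∈ D e, ¬ G.Adj d (q x)) :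
    ¬ IsPerforated G c o := by
  -- If two intervals were not separated, the left end of one, which is a neighbour of its own set,
  -- would lie in the widened other one, against `hconf`.
  have hsep : ∀ e f, e ≠ f → β e + 1 < α f ∨ β f + 1 < α e := by
    intro e f hef
    obtain ⟨d₁, h₁, h₁'⟩ := hα e
    obtain ⟨d₂, h₂, h₂'⟩ := hα f
    have h3 := hαβ e
    have h4 := hαβ f
    have h5 := hβn e
    have h6 := hβn f
    have hx := fun h h' => hconf e f hef (α e) (by omega) h h' d₁ h₁ h₁'
    have hy := fun h h' => hconf f e hef.symm (α f) (by omega) h h' d₂ h₂ h₂'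
    by_contra hcon
    rcases Nat.lt_or_ge (α e + 1) (α f) with h | h
    · exact hy (by omega) (by omega)
    · exact hx h (by omega)
  refine not_isPerforated (fun e => D e ∪ seg (fun i => q (α e + i)) (β e - α e + 1)) ?_ ?_
  · intro e
    have h3 := hαβ e
    have h5 := hβn e
    refine hasLong_of_path (hq.shift (by omega)) (by omega) (by omega) (hD e)
      ((hDq e).mono_right (seg_shift_subset (by omega))) ?_ ?_ ?_
    · obtain ⟨d, hd, h⟩ := hα e
      exact ⟨d, hd, h.symm⟩
    · obtain ⟨d, hd, h⟩ := hβ e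
      refine ⟨d, hd, ?_⟩
      simpa only [show α e + (β e - α e + 1 - 1) = β e by omega] using h.symm
    · intro i hi0 hi d hd h
      exact hmid e (α e + i) (by omega) (by omega) d hd h.symm
  · intro e f hef
    have h3 := hαβ e
    have h4 := hαβ f
    have h5 := hβn e
    have h6 := hβn f
    have h7 := hsep e f hef
    constructor
    · rw [Set.disjoint_left]
      rintro x (hx | ⟨i, hi, rfl⟩) (hy | ⟨j, hj, hjx⟩)
      · exact Set.disjoint_left.mp (hDD e f hef).1 hx hy
      · exact Set.disjoint_left.mp (hDq e) hx (hjx ▸ mem_seg (p := q) (by omega))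
      · exact Set.disjoint_left.mp (hDq f) hy (mem_seg (p := q) (by omega))
      · have := hq.1 (show α f + j < n by omega) (show α e + i < n by omega) hjx
        omega
    · rintro x (hx | ⟨i, hi, rfl⟩) y (hy | ⟨j, hj, rfl⟩) hxy
      · exact (hDD e f hef).2 x hx y hy hxy
      · exact hconf e f hef (α f + j) (by omega) (by omega) (by omega) x hx hxy
      · exact hconf f e hef.symm (α e + i) (by omega) (by omega) (by omega) y hy hxy.symm
      · have := (hq.2 (α e + i) (by omega) (α f + j) (by omega)).mp hxy
        omega

/-! ### Runs of neighbours on a path -/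

open Classical in
/-- The indices of the neighbours of `v` on the path which are not followed by another neighbour
of `v` within distance `τ`. -/
noncomputable def ends (G : SimpleGraph V) (q : ℕ → V) (n τ : ℕ) (v : V) : Finset ℕ :=
  (Finset.range n).filter fun a => G.Adj v (q a) ∧ ∀ x < n, G.Adj v (q x) → x ≤ a ∨ a + τ < x

theorem mem_ends {q : ℕ → V} {n τ : ℕ} {v : V} {a : ℕ} : a ∈ ends G q n τ v ↔
    a < n ∧ G.Adj v (q a) ∧ ∀ x < n, G.Adj v (q x) → x ≤ a ∨ a + τ < x := by
  simp [ends]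

/-- The greatest neighbour of `v` up to `b`. -/
theorem exists_last_neighbor {q : ℕ → V} {v : V} {x b : ℕ} (hxb : x ≤ b)
    (hx : G.Adj v (q x)) :
    ∃ a, x ≤ a ∧ a ≤ b ∧ G.Adj v (q a) ∧ ∀ y, G.Adj v (q y) → y ≤ b → y ≤ a := by
  classical
  exact ⟨Nat.findGreatest (fun y => G.Adj v (q y)) b, Nat.le_findGreatest hxb hx,
    Nat.findGreatest_le b, Nat.findGreatest_spec (P := fun y => G.Adj v (q y)) hxb hx,
    fun y hy hyb => Nat.le_findGreatest hyb hy⟩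

theorem exists_first_end {q : ℕ → V} {n τ : ℕ} {v : V} {y : ℕ} (hyn : y < n)
    (hy : G.Adj v (q y)) :
    ∃ e ∈ ends G q n τ v, y ≤ e ∧ ∀ e' ∈ ends G q n τ v, y ≤ e' → e ≤ e' := by
  classical
  have hex : ∃ e, e ∈ ends G q n τ v ∧ y ≤ e := by
    obtain ⟨a, h1, h2, h3, h4⟩ := exists_last_neighbor (b := n - 1) (by omega) hy
    exact ⟨a, mem_ends.mpr ⟨by omega, h3, fun x hx hxa => .inl (h4 x hxa (by omega))⟩, h1⟩
  obtain ⟨h1, h2⟩ := Nat.find_spec hex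
  exact ⟨Nat.find hex, h1, h2, fun e' he' hy' => Nat.find_min' hex ⟨he', hy'⟩⟩

/-- Closeness of two neighbours is passed on to an end, so that `exists_far` can count positions
near ends, of which there are few, instead of positions near neighbours. If `y' < e`, the last
neighbour of `v'` up to `e` is within `g + τ` of `e`, since otherwise it would be an end of `v'`
smaller than `e'`. -/
theorem near_end {q : ℕ → V} {n τ g : ℕ} {v v' : V} {y y' e e' : ℕ} (hy'n : y' < n)
    (hy' : G.Adj v' (q y')) (hclose : y ≤ y' + g ∧ y' ≤ y + g)
    (he : e ∈ ends G q n τ v) (hye : y ≤ e)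
    (hmin' : ∀ x ∈ ends G q n τ v', y' ≤ x → e' ≤ x) (hee' : e ≤ e') :
    ∃ z < n, G.Adj v' (q z) ∧ e ≤ z + (g + τ) ∧ z ≤ e + (g + τ) := by
  rcases Nat.lt_or_ge y' e with h | h
  · obtain ⟨a, h1, h2, h3, h4⟩ := exists_last_neighbor h.le hy'
    have hen := (mem_ends.mp he).1
    refine ⟨a, by omega, h3, ?_, by omega⟩
    by_contra hcon
    have := hmin' a (mem_ends.mpr ⟨by omega, h3, fun x hx hxa => ?_⟩) h1
    · omega
    · by_cases hxe : x ≤ e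
      · exact .inl (h4 x hxa hxe)
      · right
        omega
  · exact ⟨y', hy'n, hy', by omega, by omega⟩

/-- If no vertex of the path sees many members of the family, and each member has few runs of
neighbours, then large subfamilies have neighbours which are pairwise far apart. -/
theorem exists_far (N K d m g τ : ℕ) : ∃ M, 0 < M ∧ ∀ {V : Type u} {G : SimpleGraph V}
    {q : ℕ → V} {n : ℕ} {ε : Type w} {ι : Type v} (E : Finset ε) (I : ε → Finset ι) (x : ι → V),
      E.card ≤ N → (∀ e ∈ E, M ≤ (I e).card) → (∀ e ∈ E, ∀ f ∈ E, e ≠ f → Disjoint (I e) (I f)) →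
      (∀ e ∈ E, ∀ a ∈ I e, (ends G q n τ (x a)).card ≤ K) →
      (∀ y < n, ∀ B : Finset ι, (∀ b ∈ B, ∃ e ∈ E, b ∈ I e) → (∀ b ∈ B, G.Adj (x b) (q y)) →
        B.card ≤ d) →
      ∃ J : ε → Finset ι, (∀ e ∈ E, J e ⊆ I e ∧ (J e).card = m) ∧
        ∀ e ∈ E, ∀ f ∈ E, ∀ a ∈ J e, ∀ b ∈ J f, a ≠ b → ∀ y < n, ∀ y' < n,
          G.Adj (x a) (q y) → G.Adj (x b) (q y') → y + g < y' ∨ y' + g < y := by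
  classical
  -- Each element has at most `K` ends, each end has at most `2 * (g + τ) + 1` positions nearby, and
  -- each position is seen by at most `d` members. The product bounds the members related to a given
  -- element.
  obtain ⟨M, hM0, hM⟩ := clean.{w, v} N (K * (2 * (g + τ) + 1) * d + 1) m
  refine ⟨M, hM0, fun {V G q n ε ι} E I x hE hI hdis hK hd => ?_⟩
  let ρ : ι → ι → Prop := fun a b => ∃ z ∈ ends G q n τ (x a), ∃ y < n, G.Adj (x b) (q y) ∧
    z ≤ y + (g + τ) ∧ y ≤ z + (g + τ)
  obtain ⟨J, hJ, hJ'⟩ := hM E I ρ hE hI hdis (by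
    intro A B hA hB hAB hAI hBI
    by_contra! hcon
    obtain ⟨a, ha⟩ := Finset.card_pos.mp (show 0 < A.card by omega)
    obtain ⟨e, he, hae⟩ := hAI a ha
    let Y : Finset ℕ := (ends G q n τ (x a)).biUnion
      fun z => (Finset.range (2 * (g + τ) + 1)).image fun r => z + r - (g + τ)
    have hY : Y.card ≤ K * (2 * (g + τ) + 1) := by
      refine (Finset.card_biUnion_le_card_mul _ _ (2 * (g + τ) + 1) fun z _ => ?_).trans
        (Nat.mul_le_mul_right _ (hK e he a hae))
      exact Finset.card_image_le.trans (by simp)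
    have hBY : B ⊆ (Y.filter (· < n)).biUnion fun y => B.filter fun b => G.Adj (x b) (q y) := by
      intro b hb
      obtain ⟨z, hz, y, hy, hby, h1, h2⟩ := hcon a ha b hb
      refine Finset.mem_biUnion.mpr ⟨y, ?_, Finset.mem_filter.mpr ⟨hb, hby⟩⟩
      refine Finset.mem_filter.mpr ⟨Finset.mem_biUnion.mpr ⟨z, hz, ?_⟩, hy⟩
      exact Finset.mem_image.mpr ⟨y + (g + τ) - z, by simp; omega, by omega⟩
    have h1 := Finset.card_le_card hBY
    have h2 := Finset.card_biUnion_le_card_mul (Y.filter (· < n))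
      (fun y => B.filter fun b => G.Adj (x b) (q y)) d (fun y hy =>
        hd y (Finset.mem_filter.mp hy).2 _ (fun b hb => hBI b (Finset.mem_filter.mp hb).1)
          (fun b hb => (Finset.mem_filter.mp hb).2))
    have h3 : (Y.filter (· < n)).card * d ≤ K * (2 * (g + τ) + 1) * d :=
      Nat.mul_le_mul_right _ ((Finset.card_filter_le _ _).trans hY)
    omega)
  refine ⟨J, hJ, fun e he f hf a ha b hb hab y hy y' hy' hay hby => ?_⟩
  by_contra hcon
  obtain ⟨z, hz, hyz, hzmin⟩ := exists_first_end (τ := τ) hy hay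
  obtain ⟨z', hz', hyz', hzmin'⟩ := exists_first_end (τ := τ) hy' hby
  rcases le_total z z' with h | h
  · obtain ⟨r, hr, h1, h2, h3⟩ := near_end (g := g) hy' hby ⟨by omega, by omega⟩ hz hyz hzmin' h
    exact hJ' e he f hf a ha b hb hab ⟨z, hz, r, hr, h1, h2, h3⟩
  · obtain ⟨r, hr, h1, h2, h3⟩ := near_end (g := g) hy hay ⟨by omega, by omega⟩ hz' hyz' hzmin h
    exact hJ' f hf e he b hb a ha hab.symm ⟨z', hz', r, hr, h1, h2, h3⟩

/-- A vertex with few runs of neighbours, all far from the right ends of separated intervals, sees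
few of these intervals. -/
theorem card_conflicts_le {q : ℕ → V} {n τ : ℕ} {κ : Type w} (T : Finset κ) (α β : κ → ℕ) (v : V)
    (hτ : 1 ≤ τ) (hβ : ∀ k ∈ T, β k < n)
    (hord : ∀ k ∈ T, ∀ k' ∈ T, k ≠ k' → β k + 1 < α k' ∨ β k' + 1 < α k)
    (hfar : ∀ k ∈ T, ∀ x < n, G.Adj v (q x) → x + τ < β k ∨ β k + τ < x)
    (hsee : ∀ k ∈ T, ∃ x < n, α k ≤ x + 1 ∧ x ≤ β k + 1 ∧ G.Adj v (q x)) :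
    T.card ≤ (ends G q n τ v).card := by
  -- As `v` has no neighbour within `τ` of `β k`, its last neighbour up to `β k` is an end; since
  -- the intervals are separated, distinct `k` give distinct ends.
  have hex : ∀ k, ∃ a, k ∈ T → α k ≤ a + 1 ∧ a ≤ β k ∧ a ∈ ends G q n τ v := by
    intro k
    by_cases hk : k ∈ T
    swap
    · exact ⟨0, fun h => absurd h hk⟩
    obtain ⟨x, hx, h1, h2, h3⟩ := hsee k hk
    have h4 := hfar k hk x hx h3
    obtain ⟨a, h5, h6, h7, h8⟩ := exists_last_neighbor (b := β k) (by omega) h3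
    have h9 := hβ k hk
    have h10 := hfar k hk a (by omega) h7
    refine ⟨a, fun _ => ⟨by omega, h6, mem_ends.mpr ⟨by omega, h7, fun y hy hy' => ?_⟩⟩⟩
    rcases hfar k hk y hy hy' with h | h
    · exact .inl (h8 y hy' (by omega))
    · right
      omega
  choose a ha using hex
  refine Finset.card_le_card_of_injOn a (fun k hk => (ha k hk).2.2) fun k hk k' hk' h => ?_
  by_contra hne
  have h1 := ha k hk
  have h2 := ha k' hk'
  have := hord k hk k' hk' hne
  omega

/-- An end is followed by a gap of more than `τ` before the next neighbour. Using only every other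
end also separates consecutive gaps by more than `τ`. -/
theorem exists_gap_intervals {q : ℕ → V} {n τ K : ℕ} {v : V}
    (hK : 2 * K ≤ (ends G q n τ v).card) : ∃ a b : ℕ → ℕ,
      (∀ k < K, b k < n ∧ a k + τ < b k ∧ G.Adj v (q (a k)) ∧ G.Adj v (q (b k)) ∧
        ∀ x, a k < x → x < b k → ¬ G.Adj v (q x)) ∧
      ∀ k k', k < k' → k' < K → b k + τ < a k' := by
  classical
  let E := (ends G q n τ v).orderEmbOfFin rfl
  let e : ℕ → ℕ := fun i => if h : i < (ends G q n τ v).card then E ⟨i, h⟩ else 0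
  have he : ∀ i < 2 * K, e i ∈ ends G q n τ v := by
    intro i hi
    simp only [e, show i < (ends G q n τ v).card by omega, dif_pos]
    exact Finset.orderEmbOfFin_mem _ _ _
  have hlt : ∀ i j, i < j → j < 2 * K → e i + τ < e j := by
    intro i j hij hj
    have h1 : e i < e j := by
      simp only [e, show i < (ends G q n τ v).card by omega,
        show j < (ends G q n τ v).card by omega, dif_pos]
      exact (OrderEmbedding.lt_iff_lt E).mpr (by simpa using hij)
    have h2 := mem_ends.mp (he j hj)
    have := (mem_ends.mp (he i (by omega))).2.2 _ h2.1 h2.2.1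
    omega
  have hnext : ∀ k, ∃ b, k < K → b ≤ e (2 * k + 1) ∧ e (2 * k) < b ∧ G.Adj v (q b) ∧
      ∀ x, e (2 * k) < x → x < b → ¬ G.Adj v (q x) := by
    intro k
    by_cases hk : k < K
    swap
    · exact ⟨0, fun h => absurd h hk⟩
    have hex : ∃ b, e (2 * k) < b ∧ G.Adj v (q b) :=
      ⟨e (2 * k + 1), by have := hlt (2 * k) (2 * k + 1) (by omega) (by omega); omega,
        (mem_ends.mp (he (2 * k + 1) (by omega))).2.1⟩
    refine ⟨Nat.find hex, fun _ => ⟨Nat.find_min' hex ⟨?_, ?_⟩, (Nat.find_spec hex).1,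
      (Nat.find_spec hex).2, fun x hx1 hx2 hx => Nat.find_min hex hx2 ⟨hx1, hx⟩⟩⟩
    · have := hlt (2 * k) (2 * k + 1) (by omega) (by omega)
      omega
    · exact (mem_ends.mp (he (2 * k + 1) (by omega))).2.1
  choose b hb using hnext
  refine ⟨fun k => e (2 * k), b, fun k hk => ?_, fun k k' hkk hk' => ?_⟩
  · obtain ⟨h1, h2, h3, h4⟩ := hb k hk
    have h5 := mem_ends.mp (he (2 * k) (by omega))
    have h6 := mem_ends.mp (he (2 * k + 1) (by omega))
    have h7 := h5.2.2 (b k) (by omega) h3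
    exact ⟨by omega, by simp only; omega, h5.2.1, h3, h4⟩
  · obtain ⟨h1, h2, h3, h4⟩ := hb k (by omega)
    have := hlt (2 * k + 1) (2 * k') (by omega) (by omega)
    simp only
    omega

variable (c l o s t : ℕ)

/-- Few vertices have many runs of neighbours on a given path. -/
theorem exists_few_ends (τ : ℕ) (hτo : o ≤ τ) (hτ : 4 ≤ τ) : ∃ R K : ℕ, 0 < R ∧
    ∀ {V : Type u} {G : SimpleGraph V}, Good c l o s t G → ∀ {q : ℕ → V} {n : ℕ}, IPath G q n →
      ∀ S : Finset V, R ≤ S.card → (∀ v ∈ S, v ∉ seg q n) →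
        ∃ v ∈ S, (ends G q n τ v).card ≤ K := by
  classical
  obtain ⟨r, hr0, hr⟩ := exists_not_seen.{u, 0} c l o s t
  obtain ⟨R₂, -, hR₂⟩ := ramsey.{u} (Fin (r + r) → Bool × Bool) (c + r + 1)
  obtain ⟨R₁, hR₁0, hR₁⟩ := exists_stable.{u} c l o s t R₂
  refine ⟨R₁, 2 * (r + r), hR₁0, fun {V G} hG {q n} hq S hS hSq => ?_⟩
  by_contra! hcon
  obtain ⟨S', hS', hS'c, hst⟩ := hR₁ hG S hS
  have hab : ∀ v, ∃ a b : ℕ → ℕ, v ∈ S →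
      (∀ k < r + r, b k < n ∧ a k + τ < b k ∧ G.Adj v (q (a k)) ∧ G.Adj v (q (b k)) ∧
        ∀ x, a k < x → x < b k → ¬ G.Adj v (q x)) ∧
      ∀ k k', k < k' → k' < r + r → b k + τ < a k' := by
    intro v
    by_cases hv : v ∈ S
    · obtain ⟨a, b, h⟩ := exists_gap_intervals (hcon v hv).le
      exact ⟨a, b, fun _ => h⟩
    · exact ⟨fun _ => 0, fun _ => 0, fun h => absurd h hv⟩
  choose a b hab using hab
  -- The gaps are widened by one vertex on both sides, because cycles through them must be
  -- anticomplete and not merely disjoint.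
  let sees : V → V → ℕ → Prop := fun w v k => ∃ x < n, a v k ≤ x + 1 ∧ x ≤ b v k + 1 ∧
    G.Adj w (q x)
  -- Since `τ ≥ 4`, the widened gaps of one vertex are disjoint anticomplete subpaths of `q`, so `r`
  -- vertices cannot all see `r` of them.
  have hseen : ∀ v ∈ S, ∀ T ⊆ S, r ≤ T.card → ∀ B : Finset (Fin (r + r)), r ≤ B.card →
      (∀ w ∈ T, ∀ k ∈ B, sees w v k) → False := by
    intro v hv T hT hTc B hB hsee
    let n' : Fin (r + r) → ℕ := fun k => min (b v k + 2) n - (a v k - 1)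
    have hn' : ∀ k : Fin (r + r), a v k - 1 + n' k ≤ n := fun k => by
      have := (hab v hv).1 k k.2
      simp only [n']
      omega
    have hord : ∀ k k' : Fin (r + r), k ≠ k' → b v k + τ < a v k' ∨ b v k' + τ < a v k := by
      intro k k' hne
      rcases lt_or_gt_of_ne hne with h | h
      · exact .inl ((hab v hv).2 k k' h k'.2)
      · exact .inr ((hab v hv).2 k' k h k.2)
    obtain ⟨w, hw, k, hk, h⟩ := hr hG T B (fun k i => q (a v k - 1 + i)) n' hTc hB
      (fun k _ => hq.shift (hn' k))
      (by
        intro k _ k' _ hne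
        have h1 := hn' k
        have h2 := hn' k'
        have h3 := hord k k' hne
        constructor
        · rw [Set.disjoint_left]
          rintro _ ⟨i, hi, rfl⟩ ⟨j, hj, hij⟩
          have := hq.1 (show a v k' - 1 + j < n by omega) (show a v k - 1 + i < n by omega) hij
          simp only [n'] at hi hj
          omega
        · rintro _ ⟨i, hi, rfl⟩ _ ⟨j, hj, rfl⟩ hij
          have := (hq.2 _ (show a v k - 1 + i < n by omega) _
            (show a v k' - 1 + j < n by omega)).mp hij
          simp only [n'] at hi hj
          omega)
      (fun w hw k _ h => hSq w (hT hw) (seg_shift_subset (hn' k) h))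
    obtain ⟨x, hx, h1, h2, h3⟩ := hsee w hw k hk
    refine h (q x) ⟨x - (a v k - 1), ?_, ?_⟩ h3
    · simp only [n']
      omega
    · simp only
      congr 1
      omega
  obtain ⟨g, hg, hginj, χ, hχ⟩ := hR₂ S' hS'c.ge
    (fun v w k => (decide (sees w v k), decide (sees v w k)))
  have hgS : ∀ i < c + r + 1, g i ∈ S := fun i hi => hS' (hg i hi)
  have hχ1 : ∀ i j, i < j → j < c + r + 1 → ∀ k, (χ k).1 = true ↔ sees (g j) (g i) k := by
    intro i j hij hj k
    have := congrArg Prod.fst (congrFun (hχ i j hij hj) k)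
    simp [← this]
  have hχ2 : ∀ i j, i < j → j < c + r + 1 → ∀ k, (χ k).2 = true ↔ sees (g i) (g j) k := by
    intro i j hij hj k
    have := congrArg Prod.snd (congrFun (hχ i j hij hj) k)
    simp [← this]
  -- If for some `k` no chosen vertex sees the `k`-th gap of another, then `c` of the vertices with
  -- these gaps close `c` anticomplete long cycles. Otherwise each of the `r + r` gaps is seen from
  -- later to earlier vertices or conversely, and one direction holds for at least `r` of them.
  by_cases hk : ∃ k, (χ k).1 = false ∧ (χ k).2 = false
  · obtain ⟨k, hk1, hk2⟩ := hk
    have hns : ∀ i < c + r + 1, ∀ j < c + r + 1, i ≠ j → ¬ sees (g i) (g j) k := by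
      intro i hi j hj hij h
      rcases lt_or_gt_of_ne hij with h' | h'
      · rw [(hχ2 i j h' hj k).mpr h] at hk2
        cases hk2
      · rw [(hχ1 j i h' hi k).mpr h] at hk1
        cases hk1
    have hlt : ∀ e : Fin c, (e : ℕ) < c + r + 1 := fun e => by
      have := e.2
      omega
    have hI := fun e : Fin c => (hab (g e) (hgS e (hlt e))).1 k k.2
    refine not_isPerforated_of_intervals hq hG.ho (fun e => {g e}) (fun e => a (g e) k)
      (fun e => b (g e) k) (fun e => ?_) (fun e => (hI e).1) (fun e => conn_singleton _)
      (fun e => Set.disjoint_singleton_left.mpr (hSq _ (hgS e (hlt e)))) ?_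
      (fun e => ⟨_, rfl, (hI e).2.2.1⟩) (fun e => ⟨_, rfl, (hI e).2.2.2.1⟩) ?_ ?_ hG.perforated
    · have := hI e
      omega
    · intro e f hef
      have hne : g e ≠ g f := fun h => hef (Fin.ext (hginj (hlt e) (hlt f) h))
      refine ⟨by simpa using hne, ?_⟩
      rintro _ rfl _ rfl
      exact hst (hg e (hlt e)) (hg f (hlt f)) hne
    · rintro e x h1 h2 _ rfl
      exact (hI e).2.2.2.2 x h1 h2
    · rintro e f hef x hx h1 h2 _ rfl h3
      exact hns e (hlt e) f (hlt f) (fun h => hef (Fin.ext h)) ⟨x, hx, h1, h2, h3⟩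
  · have hsum : r + r ≤ ((Finset.univ : Finset (Fin (r + r))).filter fun k => (χ k).1 = true).card +
        ((Finset.univ : Finset (Fin (r + r))).filter fun k => (χ k).2 = true).card := by
      refine le_trans (le_of_eq ?_) (Finset.card_union_le _ _)
      rw [← Finset.filter_or, Finset.filter_true_of_mem, Finset.card_univ, Fintype.card_fin]
      intro k _
      by_contra h
      exact hk ⟨k, by simpa using h⟩
    have himg : ∀ x, x + r ≤ c + r + 1 → (Finset.range r).image (fun i => g (x + i)) ⊆ S := by
      intro x hx y hy
      obtain ⟨i, hi, rfl⟩ := Finset.mem_image.mp hy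
      exact hgS _ (by simp at hi; omega)
    rcases Nat.lt_or_ge
      ((Finset.univ : Finset (Fin (r + r))).filter fun k => (χ k).1 = true).card r with h | h
    · refine hseen (g r) (hgS r (by omega)) _ (himg 0 (by omega))
        (card_image_shift hginj (a := 0) (q := r) (by omega)).ge
        (Finset.univ.filter fun k => (χ k).2 = true) (by omega) ?_
      intro w hw k hk
      obtain ⟨i, hi, rfl⟩ := Finset.mem_image.mp hw
      simp only [Finset.mem_range] at hi
      exact (hχ2 _ _ (by omega) (by omega) k).mp (Finset.mem_filter.mp hk).2
    · refine hseen (g 0) (hgS 0 (by omega)) _ (himg 1 (by omega))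
        (card_image_shift hginj (a := 1) (q := r) (by omega)).ge
        (Finset.univ.filter fun k => (χ k).1 = true) h ?_
      intro w hw k hk
      obtain ⟨i, hi, rfl⟩ := Finset.mem_image.mp hw
      simp only [Finset.mem_range] at hi
      exact (hχ1 _ _ (by omega) (by omega) k).mp (Finset.mem_filter.mp hk).2

end

section

variable {V : Type u} {G : SimpleGraph V}

/-! ### Packings of long cycles -/

/-- Deleting one vertex makes the results on attachments to induced paths available for cycles. -/
theorem exists_iPath_of_isCycleIn {C : Set V} {n : ℕ} (h : IsCycleIn G C n) :
    ∃ (q : ℕ → V) (z : V), IPath G q (n - 1) ∧ C = insert z (seg q (n - 1)) := by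
  obtain ⟨h3, f, hf⟩ := h
  let q : ℕ → V := fun i => if hi : i < n then f ⟨i, hi⟩ else f ⟨0, by omega⟩
  have hq : ∀ i, (hi : i < n) → q i = f ⟨i, hi⟩ := fun i hi => dif_pos hi
  refine ⟨q, q (n - 1), ⟨?_, ?_⟩, ?_⟩
  · intro i hi j hj hij
    simp only [Set.mem_Iio] at hi hj
    rw [hq i (by omega), hq j (by omega)] at hij
    simpa using f.injective hij
  · have key : ∀ i j, i < j → j < n - 1 → (G.Adj (q i) (q j) ↔ i + 1 = j) := by
      intro i j hij hj
      rw [hq i (by omega), hq j (by omega), f.map_adj_iff, SimpleGraph.cycleGraph_adj',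
        Fin.coe_sub_iff_lt.mpr (by simpa using hij), Fin.sub_val_of_le (by simpa using hij.le)]
      simp only
      omega
    intro i hi j hj
    rcases lt_trichotomy i j with h | h | h
    · rw [key i j h hj]
      omega
    · subst h
      simp
    · rw [G.adj_comm, key j i h hi]
      omega
  · rw [← hf]
    ext v
    constructor
    · rintro ⟨i, rfl⟩
      have hi := i.2
      by_cases h : i.val < n - 1
      · exact .inr ⟨i, h, hq i i.2⟩
      · left
        rw [hq _ (by omega)]
        congr 1
        ext
        simp only
        omega
    · rintro (rfl | ⟨i, hi, rfl⟩)
      · exact ⟨_, (hq _ (by omega)).symm⟩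
      · exact ⟨_, (hq i (by omega)).symm⟩

/-- A packing of long cycles inside `U` outside of whose closed neighbourhood there are no long
cycles in `U`. -/
theorem exists_maximal_packing {c o : ℕ} (hG : IsPerforated G c o) (U : Set V) :
    ∃ k < c, ∃ C : ℕ → Set V, (∀ i < k, C i ⊆ U ∧ ∃ n, o + 2 ≤ n ∧ IsCycleIn G (C i) n) ∧
      ¬ HasLong G o {v | v ∈ U ∧ ∀ i < k, v ∉ C i ∧ ∀ h ∈ C i, ¬ G.Adj v h} := by
  classical
  -- Perforation says that `P c` fails. With `k + 1` the first failure of `P`, a long cycle away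
  -- from a packing of `k` cycles would extend it.
  let P : ℕ → Prop := fun k => ∃ C : ℕ → Set V,
    (∀ i < k, C i ⊆ U ∧ ∃ n, o + 2 ≤ n ∧ IsCycleIn G (C i) n) ∧
    ∀ i < k, ∀ j < k, i ≠ j → Disjoint (C i) (C j) ∧ Anticomplete G (C i) (C j)
  have hc : ¬ P c := by
    rintro ⟨C, h1, h2⟩
    exact hG ⟨fun i => C i, fun i => (h1 i i.2).2,
      fun i j hij => h2 i i.2 j j.2 (fun h => hij (Fin.ext h))⟩
  have hex : ∃ k, ¬ P k := ⟨c, hc⟩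
  have h0 : P 0 := ⟨fun _ => ∅, by simp, by simp⟩
  have hK0 : Nat.find hex ≠ 0 := fun h => by
    have := Nat.find_spec hex
    rw [h] at this
    exact this h0
  have hKc : Nat.find hex ≤ c := Nat.find_min' hex hc
  obtain ⟨k, hk⟩ : ∃ k, Nat.find hex = k + 1 := ⟨Nat.find hex - 1, by omega⟩
  have hPk : P k := not_not.mp (Nat.find_min hex (show k < Nat.find hex by omega))
  have hPk1 : ¬ P (k + 1) := hk ▸ Nat.find_spec hex
  obtain ⟨C, h1, h2⟩ := hPk
  refine ⟨k, by omega, C, h1, ?_⟩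
  rintro ⟨D, hD, n, hn, hcyc⟩
  have hupd : ∀ i, i ≠ k → Function.update C k D i = C i := fun i hi =>
    Function.update_of_ne hi _ _
  have hCD : ∀ i < k, Disjoint (C i) D ∧ Anticomplete G (C i) D := by
    intro i hi
    constructor
    · exact Set.disjoint_left.mpr fun x hx hxD => ((hD hxD).2 i hi).1 hx
    · exact fun x hx y hy hxy => ((hD hy).2 i hi).2 x hx hxy.symm
  refine hPk1 ⟨Function.update C k D, ?_, ?_⟩
  · intro i hi
    by_cases hik : i = k
    · subst hik
      rw [Function.update_self]
      exact ⟨fun x hx => (hD hx).1, n, hn, hcyc⟩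
    · rw [hupd i hik]
      exact h1 i (by omega)
  · intro i hi j hj hij
    by_cases hik : i = k
    · subst hik
      rw [Function.update_self, hupd j hij.symm]
      exact ⟨(hCD j (by omega)).1.symm, (hCD j (by omega)).2.symm⟩
    · rw [hupd i hik]
      by_cases hjk : j = k
      · subst hjk
        rw [Function.update_self]
        exact hCD i (by omega)
      · rw [hupd j hjk]
        exact h2 i (by omega) j (by omega) hij

theorem exists_fin_family {ε : Type w} {E : Finset ε} {c : ℕ} (hE : c ≤ E.card) :
    ∃ en : Fin c → ε, Function.Injective en ∧ ∀ i, en i ∈ E := by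
  obtain ⟨E', hE', hc⟩ := Finset.exists_subset_card_eq hE
  let f := (E'.equivFinOfCardEq hc).symm
  exact ⟨fun i => f i, fun i j hij => f.injective (Subtype.ext hij), fun i => hE' (f i).2⟩

theorem exists_sorted {ι : Type v} {S : Finset ι} (hS : S.Nonempty) {key : ι → ℕ}
    (hkey : Set.InjOn key S) :
    ∃ s : ℕ → ι, (∀ i < S.card, s i ∈ S) ∧ ∀ i j, i < j → j < S.card → key (s i) < key (s j) := by
  classical
  obtain ⟨x₀, hx₀⟩ := hS
  have hT : (S.image key).card = S.card := Finset.card_image_of_injOn hkey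
  let E := (S.image key).orderEmbOfFin hT
  have hE : ∀ i, ∃ x ∈ S, key x = E i := fun i =>
    Finset.mem_image.mp ((S.image key).orderEmbOfFin_mem hT i)
  choose f hf hf' using hE
  refine ⟨fun i => if h : i < S.card then f ⟨i, h⟩ else x₀, fun i hi => ?_, fun i j hij hj => ?_⟩
  · simp only [hi, dif_pos]
    exact hf _
  · simp only [show i < S.card by omega, hj, dif_pos, hf']
    exact (OrderEmbedding.lt_iff_lt E).mpr (by simpa using hij)

theorem exists_first_neighbor {q : ℕ → V} {n : ℕ} {v : V} (h : ∃ y < n, G.Adj v (q y)) :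
    ∃ y < n, G.Adj v (q y) ∧ ∀ z < y, ¬ G.Adj v (q z) := by
  classical
  obtain ⟨y, hy, hvy⟩ := h
  have hex : ∃ y, G.Adj v (q y) := ⟨y, hvy⟩
  exact ⟨Nat.find hex, (Nat.find_min' hex hvy).trans_lt hy, Nat.find_spec hex,
    fun z hz => Nat.find_min hex hz⟩

variable (c l o s t : ℕ)

/-- Families of legs ending at a path, each starting next to a vertex `x e`, cannot have their
attachments spread over the path. -/
theorem not_spread (M₁ : ℕ) : ∃ M, 0 < M ∧ ∀ {V : Type u} {G : SimpleGraph V},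
    Good c l o s t G → ∀ {W : Set V}, ¬ HasLong G o W → ∀ {q : ℕ → V} {n : ℕ}, IPath G q n →
    ∀ {ε : Type w} {ι : Type v} (E : Finset ε) (I : ε → Finset ι) (x : ε → V) (p : ι → ℕ → V)
      (r : ι → ℕ), E.card = c → (∀ e ∈ E, M ≤ (I e).card) →
      (∀ e ∈ E, ∀ f ∈ E, e ≠ f → Disjoint (I e) (I f)) →
      (∀ e ∈ E, ∀ a ∈ I e, IPath G (p a) (r a + 1) ∧ ∀ i, 0 < i → i < r a → p a i ∈ W) →
      (∀ e ∈ E, ∀ f ∈ E, ∀ a ∈ I e, ∀ b ∈ I f, a ≠ b →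
        Disjoint (seg (p a) (r a + 1)) (seg (p b) (r b + 1))) →
      (∀ e ∈ E, x e ∉ seg q n ∧ ∀ y < n, ¬ G.Adj (x e) (q y)) →
      (∀ e ∈ E, ∀ f ∈ E, e ≠ f → x e ≠ x f ∧ ¬ G.Adj (x e) (x f)) →
      (∀ e ∈ E, ∀ f ∈ E, ∀ a ∈ I f, x e ∉ seg (p a) (r a + 1) ∧
        (e ≠ f → ∀ i ≤ r a, ¬ G.Adj (x e) (p a i))) →
      (∀ e ∈ E, ∀ a ∈ I e, G.Adj (x e) (p a 0)) →
      (∀ e ∈ E, ∀ a ∈ I e, (∀ i ≤ r a, p a i ∉ seg q n) ∧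
        (∀ i < r a, ∀ y < n, ¬ G.Adj (p a i) (q y)) ∧ ∃ y < n, G.Adj (p a (r a)) (q y)) →
      (∀ e ∈ E, ∀ y < n, ∀ B ⊆ I e, (∀ b ∈ B, G.Adj (p b (r b)) (q y)) → B.card ≤ M₁) →
      False := by
  classical
  -- The scale `o + 4` is at least `o`, so that gaps close long cycles, and at least `4`, so that
  -- widened gaps stay anticomplete.
  obtain ⟨R, K, -, hRK⟩ := exists_few_ends.{u} c l o s t (o + 4) (by omega) (by omega)
  -- The two legs at an interval see at most `K + K` intervals of each other family, and there are
  -- `c` families; hence a set of more than `c * (K + K)` intervals cannot be entirely in conflict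
  -- with a given one.
  obtain ⟨L, hL0, hL⟩ := clean.{w, w} c (c * (K + K) + 1) 1
  obtain ⟨M₂, hM₂0, hM₂⟩ := exists_far.{u, v, w} c K (c * M₁) (2 * L) (o + 4) (o + 4)
  obtain ⟨M₃, hM₃0, hM₃⟩ := exists_clean_paths.{u, v, w} c l o s t c M₂
  refine ⟨M₃ + R, by omega, ?_⟩
  intro V G hG W hW q n hq ε ι E I₀ x p r hE hI₀ hdI₀ hp₀ hdis₀ hxq hxx hxp₀ hx0₀ hpq₀ hhub₀
  let v : ι → V := fun a => p a (r a)
  have hvmem : ∀ a, v a ∈ seg (p a) (r a + 1) := fun a => mem_seg (Nat.lt_succ_self _)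
  -- discard the legs whose last vertex has many runs of neighbours
  let I₁ : ε → Finset ι := fun e => (I₀ e).filter fun a =>
    (ends G q n (o + 4) (v a)).card ≤ K
  have hI₁ : ∀ e ∈ E, M₃ ≤ (I₁ e).card := by
    intro e he
    by_contra hlt
    let B := (I₀ e).filter fun a => ¬ (ends G q n (o + 4) (v a)).card ≤ K
    have hB : R ≤ B.card := by
      have h1 := Finset.card_filter_add_card_filter_not (s := I₀ e)
        (fun a => (ends G q n (o + 4) (v a)).card ≤ K)
      have h2 := hI₀ e he
      have h3 : (I₁ e).card + B.card = (I₀ e).card := h1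
      omega
    have hBI : ∀ a ∈ B, a ∈ I₀ e := fun a ha => (Finset.mem_filter.mp ha).1
    obtain ⟨y, hy, hyK⟩ := hRK hG hq (B.image v) (by
      rw [Finset.card_image_of_injOn]
      · exact hB
      · intro a ha b hb hab
        by_contra hne
        exact Set.disjoint_left.mp (hdis₀ e he e he a (hBI a ha) b (hBI b hb) hne) (hvmem a)
          (hab ▸ hvmem b)) (by
      intro y hy
      obtain ⟨a, ha, rfl⟩ := Finset.mem_image.mp hy
      exact (hpq₀ e he a (hBI a ha)).1 _ le_rfl)
    obtain ⟨a, ha, rfl⟩ := Finset.mem_image.mp hy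
    exact (Finset.mem_filter.mp ha).2 hyK
  have hI₁₀ : ∀ e, I₁ e ⊆ I₀ e := fun e => Finset.filter_subset _ _
  obtain ⟨I₂, hI₂, hanti⟩ := hM₃ hG hW E I₁ p (fun a => r a + 1) hE.le hI₁
    (fun e he f hf hef => (hdI₀ e he f hf hef).mono (hI₁₀ e) (hI₁₀ f))
    (fun e he a ha => ⟨(hp₀ e he a (hI₁₀ e ha)).1, by omega, fun i h0 hi =>
      (hp₀ e he a (hI₁₀ e ha)).2 i h0 (by omega)⟩)
    (fun e he f hf a ha b hb => hdis₀ e he f hf a (hI₁₀ e ha) b (hI₁₀ f hb))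
  have hI₂₀ : ∀ e ∈ E, I₂ e ⊆ I₀ e := fun e he => (hI₂ e he).1.trans (hI₁₀ e)
  obtain ⟨I, hI, hfar⟩ := hM₂ (G := G) (q := q) (n := n) E I₂ v hE.le (fun e he => (hI₂ e he).2.ge)
    (fun e he f hf hef => (hdI₀ e he f hf hef).mono (hI₂₀ e he) (hI₂₀ f hf))
    (fun e he a ha => (Finset.mem_filter.mp ((hI₂ e he).1 ha)).2)
    (by
      intro y hy B hB hBy
      have hsub : B ⊆ E.biUnion fun e => B ∩ I₂ e := by
        intro b hb
        obtain ⟨e, he, hbe⟩ := hB b hb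
        exact Finset.mem_biUnion.mpr ⟨e, he, Finset.mem_inter.mpr ⟨hb, hbe⟩⟩
      refine (Finset.card_le_card hsub).trans ?_
      rw [← hE]
      exact Finset.card_biUnion_le_card_mul _ _ _ fun e he => hhub₀ e he y hy _
        (Finset.inter_subset_right.trans (hI₂₀ e he))
        (fun b hb => hBy b (Finset.mem_inter.mp hb).1))
  have hII₂ : ∀ e ∈ E, I e ⊆ I₂ e := fun e he => (hI e he).1
  have hII₀ : ∀ e ∈ E, I e ⊆ I₀ e := fun e he => (hII₂ e he).trans (hI₂₀ e he)
  have hK : ∀ e ∈ E, ∀ a ∈ I e, (ends G q n (o + 4) (v a)).card ≤ K := fun e he a ha =>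
    (Finset.mem_filter.mp ((hI₂ e he).1 (hII₂ e he ha))).2
  have hdII : ∀ e ∈ E, ∀ f ∈ E, ∀ a ∈ I e, ∀ b ∈ I f, e ≠ f → a ≠ b :=
    fun e he f hf a ha b hb hef hab => Finset.disjoint_left.mp (hdI₀ e he f hf hef)
      (hII₀ e he ha) (hab ▸ hII₀ f hf hb)
  -- sort the legs by first attachment
  have hfst : ∀ a, ∃ y, ∀ e ∈ E, a ∈ I e → y < n ∧ G.Adj (v a) (q y) ∧
      ∀ z < y, ¬ G.Adj (v a) (q z) := by
    intro a
    by_cases ha : ∃ e ∈ E, a ∈ I e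
    · obtain ⟨e, he, hae⟩ := ha
      obtain ⟨y, h1, h2, h3⟩ := exists_first_neighbor (hpq₀ e he a (hII₀ e he hae)).2.2
      exact ⟨y, fun _ _ _ => ⟨h1, h2, h3⟩⟩
    · exact ⟨0, fun e he hae => absurd ⟨e, he, hae⟩ ha⟩
  choose fst hfst using hfst
  have hsort : ∀ e, ∃ s : ℕ → ι, e ∈ E → (∀ i < 2 * L, s i ∈ I e) ∧
      ∀ i j, i < j → j < 2 * L → fst (s i) < fst (s j) := by
    intro e
    by_cases he : e ∈ E
    · have hne : (I e).Nonempty := Finset.card_pos.mp (by rw [(hI e he).2]; omega)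
      obtain ⟨s, h1, h2⟩ := exists_sorted hne (key := fst) (by
        intro a ha b hb hab
        by_contra hne
        have h1 := hfst a e he ha
        have h2 := hfst b e he hb
        have := hfar e he e he a ha b hb hne _ h1.1 _ h2.1 h1.2.1 h2.2.1
        omega)
      rw [(hI e he).2] at h1 h2
      exact ⟨s, fun _ => ⟨h1, h2⟩⟩
    · obtain ⟨a⟩ : Nonempty ι := by
        obtain ⟨e', he'⟩ := Finset.card_pos.mp (show 0 < E.card by rw [hE]; exact hG.hc)
        obtain ⟨a, -⟩ := Finset.card_pos.mp (show 0 < (I e').card by rw [(hI e' he').2]; omega)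
        exact ⟨a⟩
      exact ⟨fun _ => a, fun h => absurd h he⟩
  choose s hs using hsort
  have hsI : ∀ e ∈ E, ∀ i < 2 * L, s e i ∈ I e := fun e he => (hs e he).1
  have hslt : ∀ e ∈ E, ∀ i j, i < j → j < 2 * L → fst (s e i) < fst (s e j) :=
    fun e he => (hs e he).2
  have hsne : ∀ e ∈ E, ∀ i < 2 * L, ∀ j < 2 * L, i ≠ j → s e i ≠ s e j := by
    intro e he i hi j hj hij h
    rcases lt_or_gt_of_ne hij with h' | h'
    · have := hslt e he i j h' hj
      rw [h] at this
      omega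
    · have := hslt e he j i h' hi
      rw [h] at this
      omega
  have hfs : ∀ e ∈ E, ∀ i < 2 * L, fst (s e i) < n ∧ G.Adj (v (s e i)) (q (fst (s e i))) ∧
      ∀ z < fst (s e i), ¬ G.Adj (v (s e i)) (q z) :=
    fun e he i hi => hfst _ e he (hsI e he i hi)
  -- the interval between two consecutive legs
  let β : ε → ℕ → ℕ := fun e k => fst (s e (2 * k + 1))
  have hα : ∀ e k, ∃ α, e ∈ E → k < L → fst (s e (2 * k)) ≤ α ∧ α ≤ β e k ∧
      G.Adj (v (s e (2 * k))) (q α) ∧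
      ∀ y, G.Adj (v (s e (2 * k))) (q y) → y ≤ β e k → y ≤ α := by
    intro e k
    by_cases h : e ∈ E ∧ k < L
    · obtain ⟨α, hα⟩ := exists_last_neighbor
        (hslt e h.1 (2 * k) (2 * k + 1) (by omega) (by omega)).le
        (hfs e h.1 (2 * k) (by omega)).2.1
      exact ⟨α, fun _ _ => hα⟩
    · exact ⟨0, fun h1 h2 => absurd ⟨h1, h2⟩ h⟩
  choose α hα using hα
  have hβn : ∀ e ∈ E, ∀ k < L, β e k < n ∧ G.Adj (v (s e (2 * k + 1))) (q (β e k)) :=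
    fun e he k hk => ⟨(hfs e he _ (by omega)).1, (hfs e he _ (by omega)).2.1⟩
  have hαβ : ∀ e ∈ E, ∀ k < L, α e k + (o + 4) < β e k := by
    intro e he k hk
    have h1 := hα e k he hk
    have h2 := hβn e he k hk
    have := hfar e he e he _ (hsI e he (2 * k) (by omega)) _ (hsI e he (2 * k + 1) (by omega))
      (hsne e he _ (by omega) _ (by omega) (by omega)) (α e k) (by omega) (β e k) h2.1 h1.2.2.1 h2.2
    omega
  have hord : ∀ e ∈ E, ∀ k < L, ∀ k' < L, k < k' → β e k + (o + 4) < α e k' := by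
    intro e he k hk k' hk' hkk
    have h1 := hα e k' he hk'
    have h2 := hβn e he k hk
    have h3 := hαβ e he k' hk'
    have h4 := hβn e he k' hk'
    have h5 := hslt e he (2 * k + 1) (2 * k') (by omega) (by omega)
    have := hfar e he e he _ (hsI e he (2 * k + 1) (by omega)) _ (hsI e he (2 * k') (by omega))
      (hsne e he _ (by omega) _ (by omega) (by omega)) (β e k) h2.1 (α e k') (by omega) h2.2 h1.2.2.1
    have h6 : β e k = fst (s e (2 * k + 1)) := rfl
    omega
  -- choose non-conflicting intervals
  let sees : ι → ε × ℕ → Prop := fun a z => ∃ y < n, α z.1 z.2 ≤ y + 1 ∧ y ≤ β z.1 z.2 + 1 ∧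
    G.Adj (v a) (q y)
  have hsees : ∀ e ∈ E, ∀ f ∈ E, e ≠ f → ∀ a ∈ I e, ∀ T : Finset (ε × ℕ),
      (∀ z ∈ T, z.1 = f ∧ z.2 < L ∧ sees a z) → T.card ≤ K := by
    intro e he f hf hef a ha T hT
    refine (card_conflicts_le (q := q) (n := n) (τ := o + 4) T (fun z => α z.1 z.2)
      (fun z => β z.1 z.2) (v a) (by omega) ?_ ?_ ?_ ?_).trans (hK e he a ha)
    · rintro ⟨f', k⟩ hz
      obtain ⟨rfl, h1, h2⟩ := hT _ hz
      exact (hβn _ hf k h1).1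
    · rintro ⟨f', k⟩ hz ⟨f'', k'⟩ hz' hne
      obtain ⟨rfl, h1, h2⟩ := hT _ hz
      obtain ⟨rfl, h1', h2'⟩ := hT _ hz'
      simp only at h1 h1' hf ⊢
      rcases lt_trichotomy k k' with h | h | h
      · have := hord _ hf k h1 k' h1' h
        omega
      · exact absurd (by rw [h]) hne
      · have := hord _ hf k' h1' k h1 h
        omega
    · rintro ⟨f', k⟩ hz y hy hay
      obtain ⟨rfl, h1, h2⟩ := hT _ hz
      have hb := hβn _ hf k h1
      have hmem := hsI _ hf (2 * k + 1) (by simp only at h1; omega)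
      exact hfar e he _ hf a ha _ hmem (hdII e he _ hf a ha _ hmem hef) y hy _ hb.1 hay hb.2
    · intro z hz
      exact (hT z hz).2.2
  obtain ⟨J, hJ, hJ'⟩ := hL E (fun e => (Finset.range L).image fun k => (e, k))
    (fun z z' => z.1 ≠ z'.1 ∧ (sees (s z.1 (2 * z.2)) z' ∨ sees (s z.1 (2 * z.2 + 1)) z')) hE.le
    (fun e he => by
      rw [Finset.card_image_of_injective _ (fun k k' h => (Prod.ext_iff.mp h).2),
        Finset.card_range])
    (fun e he f hf hef => by
      rw [Finset.disjoint_left]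
      intro z hz hz'
      obtain ⟨k, -, rfl⟩ := Finset.mem_image.mp hz
      obtain ⟨k', -, h⟩ := Finset.mem_image.mp hz'
      exact hef (Prod.ext_iff.mp h).1.symm)
    (by
      intro A B hA hB hAB hAI hBI
      by_contra! hcon
      obtain ⟨z, hz⟩ := Finset.card_pos.mp (show 0 < A.card by omega)
      obtain ⟨e, he, hze⟩ := hAI z hz
      obtain ⟨k, hk, rfl⟩ := Finset.mem_image.mp hze
      simp only [Finset.mem_range] at hk
      have hBI' : ∀ z ∈ B, z.1 ∈ E ∧ z.2 < L := by
        intro z hz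
        obtain ⟨f, hf, hzf⟩ := hBI z hz
        obtain ⟨k, hk, rfl⟩ := Finset.mem_image.mp hzf
        exact ⟨hf, by simpa using hk⟩
      have hsub : B ⊆ E.biUnion fun f => B.filter fun z => z.1 = f := fun z hzB =>
        Finset.mem_biUnion.mpr ⟨z.1, (hBI' z hzB).1, Finset.mem_filter.mpr ⟨hzB, rfl⟩⟩
      have h1 := Finset.card_le_card hsub
      have h2 : (E.biUnion fun f => B.filter fun z => z.1 = f).card ≤ E.card * (K + K) := by
        refine Finset.card_biUnion_le_card_mul _ _ _ fun f hf => ?_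
        by_cases hef : e = f
        · rw [Finset.filter_false_of_mem]
          · simp
          · intro z hzB h
            exact (hcon _ hz z hzB).1 (hef.trans h.symm)
        · have hsub' : (B.filter fun z => z.1 = f) ⊆
              (B.filter fun z => z.1 = f ∧ sees (s e (2 * k)) z) ∪
                (B.filter fun z => z.1 = f ∧ sees (s e (2 * k + 1)) z) := by
            intro z hzf
            obtain ⟨hzB, hzf⟩ := Finset.mem_filter.mp hzf
            rcases (hcon _ hz z hzB).2 with h | h
            · exact Finset.mem_union_left _ (Finset.mem_filter.mpr ⟨hzB, hzf, h⟩)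
            · exact Finset.mem_union_right _ (Finset.mem_filter.mpr ⟨hzB, hzf, h⟩)
          refine (Finset.card_le_card hsub').trans ((Finset.card_union_le _ _).trans
            (add_le_add ?_ ?_))
          · refine hsees e he f hf hef _ (hsI e he (2 * k) (by omega)) _ fun z hz' => ?_
            obtain ⟨hzB, h1, h2⟩ := Finset.mem_filter.mp hz'
            exact ⟨h1, (hBI' z hzB).2, h2⟩
          · refine hsees e he f hf hef _ (hsI e he (2 * k + 1) (by omega)) _ fun z hz' => ?_
            obtain ⟨hzB, h1, h2⟩ := Finset.mem_filter.mp hz'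
            exact ⟨h1, (hBI' z hzB).2, h2⟩
      rw [hE] at h2
      omega)
  have hκ : ∀ e, ∃ k, e ∈ E → k < L ∧ (e, k) ∈ J e := by
    intro e
    by_cases he : e ∈ E
    · obtain ⟨z, hz⟩ := Finset.card_pos.mp (show 0 < (J e).card by rw [(hJ e he).2]; omega)
      obtain ⟨k, hk, rfl⟩ := Finset.mem_image.mp ((hJ e he).1 hz)
      exact ⟨k, fun _ => ⟨by simpa using hk, hz⟩⟩
    · exact ⟨0, fun h => absurd h he⟩
  choose κ hκ using hκ
  obtain ⟨en, heninj, hen⟩ := exists_fin_family hE.ge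
  have hκL : ∀ e ∈ E, κ e < L := fun e he => (hκ e he).1
  let a : ε → ι := fun e => s e (2 * κ e)
  let b : ε → ι := fun e => s e (2 * κ e + 1)
  have ha : ∀ e ∈ E, a e ∈ I e := fun e he => hsI e he _ (by have := hκL e he; omega)
  have hb : ∀ e ∈ E, b e ∈ I e := fun e he => hsI e he _ (by have := hκL e he; omega)
  -- Two consecutive legs joined at `x e` attach to both ends of their interval and nowhere between:
  -- `β` is the first neighbour of one leg, and `α` the last neighbour of the other up to `β`.
  let D : ε → Set V := fun e => ({x e} ∪ seg (p (a e)) (r (a e) + 1)) ∪ seg (p (b e)) (r (b e) + 1)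
  have hDmem : ∀ e ∈ E, ∀ d ∈ D e, d = x e ∨ ∃ j ∈ I e, (j = a e ∨ j = b e) ∧
      d ∈ seg (p j) (r j + 1) := by
    rintro e he d ((hd | hd) | hd)
    · exact .inl hd
    · exact .inr ⟨a e, ha e he, .inl rfl, hd⟩
    · exact .inr ⟨b e, hb e he, .inr rfl, hd⟩
  -- only the last vertices of the legs see the path
  have hDadj : ∀ e ∈ E, ∀ d ∈ D e, ∀ y < n, G.Adj d (q y) → d = v (a e) ∨ d = v (b e) := by
    intro e he d hd y hy hdy
    rcases hDmem e he d hd with rfl | ⟨j, hj, hj', i, hi, rfl⟩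
    · exact absurd hdy ((hxq e he).2 y hy)
    · have hir : i = r j := by
        by_contra hne
        exact (hpq₀ e he j (hII₀ e he hj)).2.1 i (by omega) y hy hdy
      subst hir
      rcases hj' with rfl | rfl
      · exact .inl rfl
      · exact .inr rfl
  refine not_isPerforated_of_intervals hq hG.ho (fun i => D (en i)) (fun i => α (en i) (κ (en i)))
    (fun i => β (en i) (κ (en i))) ?_ (fun i => (hβn _ (hen i) _ (hκL _ (hen i))).1) ?_ ?_ ?_
    ?_ ?_ ?_ ?_ hG.perforated
  · intro i
    have := hαβ _ (hen i) _ (hκL _ (hen i))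
    omega
  · intro i
    have hai := hII₀ _ (hen i) (ha _ (hen i))
    have hbi := hII₀ _ (hen i) (hb _ (hen i))
    exact ((conn_singleton _).union (hp₀ _ (hen i) _ hai).1.conn rfl (mem_seg (Nat.succ_pos _))
      (hx0₀ _ (hen i) _ hai)).union (hp₀ _ (hen i) _ hbi).1.conn (.inl rfl)
      (mem_seg (Nat.succ_pos _)) (hx0₀ _ (hen i) _ hbi)
  · intro i
    rw [Set.disjoint_left]
    intro d hd hdq
    rcases hDmem _ (hen i) d hd with rfl | ⟨j, hj, -, i', hi', rfl⟩
    · exact (hxq _ (hen i)).1 hdq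
    · exact (hpq₀ _ (hen i) j (hII₀ _ (hen i) hj)).1 i' (by omega) hdq
  · intro i i' hii
    have hef : en i ≠ en i' := fun h => hii (heninj h)
    have he := hen i
    have hf := hen i'
    have hxp : ∀ e ∈ E, ∀ f ∈ E, e ≠ f → ∀ j ∈ I f, ∀ d ∈ seg (p j) (r j + 1),
        d ≠ x e ∧ ¬ G.Adj (x e) d := by
      rintro e he f hf hef j hj _ ⟨m, hm, rfl⟩
      have := hxp₀ e he f hf j (hII₀ f hf hj)
      exact ⟨fun h => this.1 (h ▸ mem_seg hm), this.2 hef m (by omega)⟩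
    constructor
    · rw [Set.disjoint_left]
      intro d hd hd'
      rcases hDmem _ he d hd with h' | ⟨j, hj, -, hdj⟩ <;>
        rcases hDmem _ hf d hd' with h | ⟨j', hj', -, hdj'⟩
      · exact (hxx _ he _ hf hef).1 (h'.symm.trans h)
      · exact (hxp _ he _ hf hef j' hj' _ hdj').1 h'
      · exact (hxp _ hf _ he hef.symm j hj _ hdj).1 h
      · exact Set.disjoint_left.mp (hdis₀ _ he _ hf j (hII₀ _ he hj) j' (hII₀ _ hf hj')
          (hdII _ he _ hf j hj j' hj' hef)) hdj hdj'
    · intro d hd d' hd' hadj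
      rcases hDmem _ he d hd with rfl | ⟨j, hj, -, hdj⟩ <;>
        rcases hDmem _ hf d' hd' with rfl | ⟨j', hj', -, hdj'⟩
      · exact (hxx _ he _ hf hef).2 hadj
      · exact (hxp _ he _ hf hef j' hj' _ hdj').2 hadj
      · exact (hxp _ hf _ he hef.symm j hj _ hdj).2 hadj.symm
      · exact hanti _ he _ hf j (hII₂ _ he hj) j' (hII₂ _ hf hj')
          (hdII _ he _ hf j hj j' hj' hef) _ hdj _ hdj' hadj
  · intro i
    exact ⟨v (a (en i)), .inl (.inr (hvmem _)), (hα _ _ (hen i) (hκL _ (hen i))).2.2.1⟩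
  · intro i
    exact ⟨v (b (en i)), .inr (hvmem _), (hβn _ (hen i) _ (hκL _ (hen i))).2⟩
  · intro i y h1 h2 d hd hdy
    have h3 := hα _ _ (hen i) (hκL _ (hen i))
    have h4 := hβn _ (hen i) _ (hκL _ (hen i))
    rcases hDadj _ (hen i) d hd y (by omega) hdy with rfl | rfl
    · have := h3.2.2.2 y hdy h2.le
      omega
    · exact (hfs _ (hen i) (2 * κ (en i) + 1) (by have := hκL _ (hen i); omega)).2.2 y h2 hdy
  · intro i i' hii y hy h1 h2 d hd hdy
    have hef : en i ≠ en i' := fun h => hii (heninj h)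
    refine hJ' _ (hen i) _ (hen i') _ (hκ _ (hen i)).2 _ (hκ _ (hen i')).2
      (fun h => hef (Prod.ext_iff.mp h).1) ⟨hef, ?_⟩
    rcases hDadj _ (hen i) d hd y hy hdy with rfl | rfl
    · exact .inl ⟨y, hy, h1, h2, hdy⟩
    · exact .inr ⟨y, hy, h1, h2, hdy⟩

end

section

variable {V : Type u} {G : SimpleGraph V}

/-! ### Clean systems of long paths -/

/-- Pairs `x e, y e` of vertices with families of disjoint long paths between them, such that the
only edges between the end vertices and the paths (their interiors) are the obvious ones. -/
structure CleanSystem (G : SimpleGraph V) (o : ℕ) {ε : Type w} {ι : Type v} (E : Finset ε)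
    (I : ε → Finset ι) (x y : ε → V) (p : ι → ℕ → V) (n : ι → ℕ) : Prop where
  disjoint_index : ∀ e ∈ E, ∀ f ∈ E, e ≠ f → Disjoint (I e) (I f)
  path : ∀ e ∈ E, ∀ a ∈ I e, IPath G (p a) (n a) ∧ o + 1 ≤ n a
  disjoint : ∀ e ∈ E, ∀ f ∈ E, ∀ a ∈ I e, ∀ b ∈ I f, a ≠ b →
    Disjoint (seg (p a) (n a)) (seg (p b) (n b))
  first : ∀ e ∈ E, ∀ a ∈ I e, G.Adj (x e) (p a 0) ∧ ∀ i < n a, G.Adj (x e) (p a i) → i = 0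
  last : ∀ e ∈ E, ∀ a ∈ I e, G.Adj (y e) (p a (n a - 1)) ∧
    ∀ i < n a, G.Adj (y e) (p a i) → i + 1 = n a
  other : ∀ e ∈ E, ∀ f ∈ E, e ≠ f → ∀ a ∈ I f, ∀ i < n a,
    ¬ G.Adj (x e) (p a i) ∧ ¬ G.Adj (y e) (p a i)
  not_mem : ∀ e ∈ E, ∀ f ∈ E, ∀ a ∈ I f, x e ∉ seg (p a) (n a) ∧ y e ∉ seg (p a) (n a)
  stable : ∀ e ∈ E, ∀ f ∈ E, ¬ G.Adj (x e) (x f) ∧ ¬ G.Adj (x e) (y f) ∧ ¬ G.Adj (y e) (y f)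
  distinct : ∀ e ∈ E, ∀ f ∈ E, e ≠ f → x e ≠ x f ∧ y e ≠ y f ∧ x e ≠ y f

theorem CleanSystem.mono {o : ℕ} {ε : Type w} {ι : Type v} {E E' : Finset ε}
    {I I' : ε → Finset ι} {x y : ε → V} {p : ι → ℕ → V} {n : ι → ℕ}
    (h : CleanSystem G o E I x y p n) (hE : E' ⊆ E) (hI : ∀ e ∈ E', I' e ⊆ I e) :
    CleanSystem G o E' I' x y p n where
  disjoint_index e he f hf hef := (h.disjoint_index e (hE he) f (hE hf) hef).mono (hI e he) (hI f hf)
  path e he a ha := h.path e (hE he) a (hI e he ha)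
  disjoint e he f hf a ha b hb := h.disjoint e (hE he) f (hE hf) a (hI e he ha) b (hI f hf hb)
  first e he a ha := h.first e (hE he) a (hI e he ha)
  last e he a ha := h.last e (hE he) a (hI e he ha)
  other e he f hf hef a ha := h.other e (hE he) f (hE hf) hef a (hI f hf ha)
  not_mem e he f hf a ha := h.not_mem e (hE he) f (hE hf) a (hI f hf ha)
  stable e he f hf := h.stable e (hE he) f (hE hf)
  distinct e he f hf := h.distinct e (hE he) f (hE hf)

variable (c l o s t : ℕ)

/-- A clean system of long paths cannot have its paths inside a set without long cycles. -/
theorem not_through : ∃ M, 0 < M ∧ ∀ {V : Type u} {G : SimpleGraph V}, Good c l o s t G →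
    ∀ {W : Set V}, ¬ HasLong G o W → ∀ {ε : Type w} {ι : Type v} (E : Finset ε)
      (I : ε → Finset ι) (x y : ε → V) (p : ι → ℕ → V) (n : ι → ℕ),
      CleanSystem G o E I x y p n → E.card = c → (∀ e ∈ E, M ≤ (I e).card) →
      (∀ e ∈ E, ∀ a ∈ I e, ∀ i, 0 < i → i + 1 < n a → p a i ∈ W) → False := by
  classical
  obtain ⟨M, hM0, hM⟩ := exists_clean_paths.{u, v, w} c l o s t c 2
  refine ⟨M, hM0, fun {V G} hG {W} hW {ε ι} E I x y p n hsys hE hI hpW => ?_⟩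
  obtain ⟨J, hJ, hanti⟩ := hM hG hW E I p n hE.le hI hsys.disjoint_index
    (fun e he a ha => ⟨(hsys.path e he a ha).1, by have := (hsys.path e he a ha).2; omega,
      hpW e he a ha⟩) hsys.disjoint
  have hsys' := hsys.mono (E' := E) (I' := J) subset_rfl (fun e he => (hJ e he).1)
  have hab : ∀ e, ∃ a b : ι, e ∈ E → a ∈ J e ∧ b ∈ J e ∧ a ≠ b := by
    intro e
    by_cases he : e ∈ E
    · obtain ⟨a, ha, b, hb, hab⟩ := Finset.one_lt_card.mp
        (show 1 < (J e).card by rw [(hJ e he).2]; omega)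
      exact ⟨a, b, fun _ => ⟨ha, hb, hab⟩⟩
    · obtain ⟨e', he'⟩ := Finset.card_pos.mp (show 0 < E.card by rw [hE]; exact hG.hc)
      obtain ⟨a, -⟩ := Finset.card_pos.mp (show 0 < (J e').card by rw [(hJ e' he').2]; omega)
      exact ⟨a, a, fun h => absurd h he⟩
  choose a b hab using hab
  obtain ⟨en, heninj, hen⟩ := exists_fin_family hE.ge
  -- The path `a e` has at least `o + 1` vertices; the return through `x e`, the path `b e`
  -- anticomplete to it, and `y e` makes a long cycle.
  let D : ε → Set V := fun e => ({x e} ∪ seg (p (b e)) (n (b e))) ∪ {y e}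
  let U : ε → Set V := fun e => D e ∪ seg (p (a e)) (n (a e))
  have hU : ∀ e ∈ E, ∀ d ∈ U e, d = x e ∨ d = y e ∨ ∃ j ∈ J e, d ∈ seg (p j) (n j) := by
    rintro e he d (((hd | hd) | hd) | hd)
    · exact .inl hd
    · exact .inr (.inr ⟨b e, (hab e he).2.1, hd⟩)
    · exact .inr (.inl hd)
    · exact .inr (.inr ⟨a e, (hab e he).1, hd⟩)
  refine not_isPerforated (fun i => U (en i)) ?_ ?_ hG.perforated
  · intro i
    have he := hen i
    obtain ⟨ha, hb, hne⟩ := hab _ he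
    obtain ⟨hpa, hna⟩ := hsys'.path _ he _ ha
    obtain ⟨hpb, hnb⟩ := hsys'.path _ he _ hb
    have ho := hG.ho
    refine hasLong_of_path hpa (by omega) hna
      (((conn_singleton _).union hpb.conn rfl (mem_seg (by omega)) (hsys'.first _ he _ hb).1).union
        (conn_singleton _) (.inr (mem_seg (show n (b (en i)) - 1 < n (b (en i)) by omega))) rfl
        (hsys'.last _ he _ hb).1.symm) ?_ ?_ ?_ ?_
    · rw [Set.disjoint_left]
      rintro d ((rfl | hd) | rfl)
      · exact (hsys'.not_mem _ he _ he _ ha).1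
      · exact Set.disjoint_left.mp (hsys'.disjoint _ he _ he _ hb _ ha hne.symm) hd
      · exact (hsys'.not_mem _ he _ he _ ha).2
    · exact ⟨x (en i), .inl (.inl rfl), (hsys'.first _ he _ ha).1.symm⟩
    · exact ⟨y (en i), .inr rfl, (hsys'.last _ he _ ha).1.symm⟩
    · rintro j hj0 hj d ((rfl | hd) | rfl) hadj
      · have := (hsys'.first _ he _ ha).2 j (by omega) hadj.symm
        omega
      · exact hanti _ he _ he _ ha _ hb hne _ (mem_seg (show j < n (a (en i)) by omega)) _ hd hadj
      · have := (hsys'.last _ he _ ha).2 j (by omega) hadj.symm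
        omega
  · intro i i' hii
    have hef : en i ≠ en i' := fun h => hii (heninj h)
    have he := hen i
    have hf := hen i'
    have hJne : ∀ j ∈ J (en i), ∀ j' ∈ J (en i'), j ≠ j' := fun j hj j' hj' h =>
      Finset.disjoint_left.mp (hsys'.disjoint_index _ he _ hf hef) hj (h ▸ hj')
    have hd1 := hsys'.distinct _ he _ hf hef
    have hd2 := hsys'.distinct _ hf _ he hef.symm
    have hst := hsys'.stable _ he _ hf
    have hst' := hsys'.stable _ hf _ he
    have hoth : ∀ e ∈ E, ∀ f ∈ E, e ≠ f → ∀ j ∈ J f, ∀ d ∈ seg (p j) (n j),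
        d ≠ x e ∧ d ≠ y e ∧ ¬ G.Adj (x e) d ∧ ¬ G.Adj (y e) d := by
      rintro e he f hf hef j hj _ ⟨m, hm, rfl⟩
      have h1 := hsys'.other e he f hf hef j hj m hm
      have h2 := hsys'.not_mem e he f hf j hj
      exact ⟨fun h => h2.1 (h ▸ mem_seg hm), fun h => h2.2 (h ▸ mem_seg hm), h1⟩
    constructor
    · rw [Set.disjoint_left]
      intro d hd hd'
      rcases hU _ he d hd with h | h | ⟨j, hj, h⟩ <;>
        rcases hU _ hf d hd' with h' | h' | ⟨j', hj', h'⟩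
      · exact hd1.1 (h.symm.trans h')
      · exact hd1.2.2 (h.symm.trans h')
      · exact (hoth _ he _ hf hef j' hj' d h').1 h
      · exact hd2.2.2 (h'.symm.trans h)
      · exact hd1.2.1 (h.symm.trans h')
      · exact (hoth _ he _ hf hef j' hj' d h').2.1 h
      · exact (hoth _ hf _ he hef.symm j hj d h).1 h'
      · exact (hoth _ hf _ he hef.symm j hj d h).2.1 h'
      · exact Set.disjoint_left.mp
          (hsys'.disjoint _ he _ hf j hj j' hj' (hJne j hj j' hj')) h h'
    · intro d hd d' hd' hadj
      rcases hU _ he d hd with rfl | rfl | ⟨j, hj, h⟩ <;>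
        rcases hU _ hf d' hd' with rfl | rfl | ⟨j', hj', h'⟩
      · exact hst.1 hadj
      · exact hst.2.1 hadj
      · exact (hoth _ he _ hf hef j' hj' _ h').2.2.1 hadj
      · exact hst'.2.1 hadj.symm
      · exact hst.2.2 hadj
      · exact (hoth _ he _ hf hef j' hj' _ h').2.2.2 hadj
      · exact (hoth _ hf _ he hef.symm j hj _ h).2.2.1 hadj.symm
      · exact (hoth _ hf _ he hef.symm j hj _ h).2.2.2 hadj.symm
      · exact hanti _ he _ hf j hj j' hj' (hJne j hj j' hj') _ h _ h' hadj

/-- In a large clean system avoiding `Z` there are a vertex outside `Z` and many anticomplete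
initial segments of paths with a common start, all ending at neighbours of this vertex. -/
theorem exists_hub : ∃ N, 0 < N ∧ ∀ m, ∃ M, 0 < M ∧ ∀ {V : Type u} {G : SimpleGraph V},
    Good c l o s t G → ∀ {ε : Type w} {ι : Type v} (E : Finset ε)
      (I : ε → Finset ι) (x y : ε → V) (p : ι → ℕ → V) (n : ι → ℕ),
      CleanSystem G o E I x y p n → N ≤ E.card → (∀ e ∈ E, M ≤ (I e).card) →
      ∀ Z : Finset V, (∀ e ∈ E, ∀ a ∈ I e, ∀ i < n a, p a i ∉ Z) →
      ∃ e ∈ E, ∃ h ∉ Z, ∃ J ⊆ I e, J.card = m ∧ ∃ r : ι → ℕ,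
        (∀ a ∈ J, r a < n a ∧ G.Adj h (p a (r a))) ∧
        ∀ a ∈ J, ∀ b ∈ J, a ≠ b →
          Anticomplete G (seg (p a) (r a + 1)) (seg (p b) (r b + 1)) := by
  classical
  -- With this many pairs, either `c` of them have many paths avoiding the packing, or more than `c
  -- * c` have many paths reaching it. As the packing has fewer than `c` cycles, in the second case
  -- `c` pairs share one.
  refine ⟨c + c * c + 1, by omega, fun m => ?_⟩
  obtain ⟨M₁, hM₁0, hM₁⟩ := exists_clean_paths.{u, v, w} c l o s t 1 m
  obtain ⟨M₂, hM₂0, hM₂⟩ := not_spread.{u, v, w} c l o s t M₁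
  obtain ⟨M₃, hM₃0, hM₃⟩ := not_through.{u, v, w} c l o s t
  -- If fewer than `M₃` paths of a pair avoid the packing, at least `c * (M₂ + M₁)` reach it, and
  -- `M₂ + M₁` of them reach the same cycle. The term `M₁` covers those attached to the vertex
  -- deleted to turn this cycle into a path.
  refine ⟨M₃ + c * (M₂ + M₁), by omega, ?_⟩
  intro V G hG ε ι E I x y p n hsys hE hI Z hZ
  by_contra hcon
  -- Keeping the packing away from the neighbours of `x e` and `y e` ensures that legs do not start
  -- inside it; leaving out `Z` makes every hub found new.
  let U : Set V := {v | v ∉ Z ∧ ∀ e ∈ E, v ≠ x e ∧ v ≠ y e ∧ ¬ G.Adj (x e) v ∧ ¬ G.Adj (y e) v}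
  obtain ⟨k, hkc, C, hC, hW⟩ := exists_maximal_packing hG.perforated U
  let NH : V → Prop := fun v => ∃ i < k, v ∈ C i ∨ ∃ h ∈ C i, G.Adj v h
  have hWmem : ∀ v ∈ U, ¬ NH v →
      v ∈ {v | v ∈ U ∧ ∀ i < k, v ∉ C i ∧ ∀ h ∈ C i, ¬ G.Adj v h} := by
    intro v hv hNH
    refine ⟨hv, fun i hi => ⟨fun h => hNH ⟨i, hi, .inl h⟩, fun h hh hadj =>
      hNH ⟨i, hi, .inr ⟨h, hh, hadj⟩⟩⟩⟩
  -- A leg stops at the first vertex in the closed neighbourhood of the packing, or at the end of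
  -- the path if there is none. Its interior then lies in the set without long cycles.
  have hr : ∀ a, ∃ r, ∀ e ∈ E, a ∈ I e → r < n a ∧ (∀ i < r, ¬ NH (p a i)) ∧
      (¬ NH (p a r) → r + 1 = n a) := by
    intro a
    by_cases hex : ∃ i < n a, NH (p a i)
    · refine ⟨Nat.find hex, fun e he ha => ⟨(Nat.find_spec hex).1, fun i hi h => ?_,
        fun h => absurd (Nat.find_spec hex).2 h⟩⟩
      exact Nat.find_min hex hi ⟨hi.trans (Nat.find_spec hex).1, h⟩
    · refine ⟨n a - 1, fun e he ha => ⟨?_, fun i hi h => hex ⟨i, by omega, h⟩, fun _ => ?_⟩⟩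
      · have := (hsys.path e he a ha).2
        omega
      · have := (hsys.path e he a ha).2
        omega
  choose r hr using hr
  have hint : ∀ e ∈ E, ∀ a ∈ I e, ∀ i, 0 < i → i + 1 < n a → p a i ∈ U := by
    intro e he a ha i hi0 hi
    refine ⟨hZ e he a ha i (by omega), fun f hf => ?_⟩
    have h1 := hsys.not_mem f hf e he a ha
    refine ⟨fun h => h1.1 (h ▸ mem_seg (by omega)), fun h => h1.2 (h ▸ mem_seg (by omega)), ?_⟩
    by_cases hfe : f = e
    · subst hfe
      refine ⟨fun h => ?_, fun h => ?_⟩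
      · have := (hsys.first f hf a ha).2 i (by omega) h
        omega
      · have := (hsys.last f hf a ha).2 i (by omega) h
        omega
    · exact hsys.other f hf e he hfe a ha i (by omega)
  have hintW : ∀ e ∈ E, ∀ a ∈ I e, ∀ i, 0 < i → i < r a →
      p a i ∈ {v | v ∈ U ∧ ∀ i < k, v ∉ C i ∧ ∀ h ∈ C i, ¬ G.Adj v h} := by
    intro e he a ha i hi0 hi
    have := hr a e he ha
    exact hWmem _ (hint e he a ha i hi0 (by omega)) (this.2.1 i hi)
  have hipath : ∀ e ∈ E, ∀ a ∈ I e, IPath G (p a) (r a + 1) := fun e he a ha =>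
    (hsys.path e he a ha).1.mono (hr a e he ha).1
  have hdisr : ∀ e ∈ E, ∀ f ∈ E, ∀ a ∈ I e, ∀ b ∈ I f, a ≠ b →
      Disjoint (seg (p a) (r a + 1)) (seg (p b) (r b + 1)) := fun e he f hf a ha b hb hab =>
    (hsys.disjoint e he f hf a ha b hb hab).mono (seg_mono (hr a e he ha).1)
      (seg_mono (hr b f hf hb).1)
  -- no vertex of the packing is adjacent to the ends of many legs
  have hnohub : ∀ e ∈ E, ∀ j < k, ∀ h ∈ C j, ∀ B ⊆ I e, (∀ b ∈ B, G.Adj (p b (r b)) h) →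
      B.card < M₁ := by
    intro e he j hj h hh B hB hadj
    by_contra hcard
    obtain ⟨J, hJ, hanti⟩ := hM₁ hG hW {e} (fun _ => B) p (fun a => r a + 1) (by simp)
      (fun _ _ => by omega)
      (fun e he f hf hef => absurd ((Finset.mem_singleton.mp he).trans
        (Finset.mem_singleton.mp hf).symm) hef)
      (fun _ _ a ha => ⟨hipath e he a (hB ha), by omega, fun i h0 hi =>
        hintW e he a (hB ha) i h0 (by omega)⟩)
      (fun _ _ _ _ a ha b hb => hdisr e he e he a (hB ha) b (hB hb))
    have hJe := hJ e (Finset.mem_singleton_self e)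
    exact hcon ⟨e, he, h, ((hC j hj).1 hh).1, J e, hJe.1.trans hB, hJe.2, r,
      fun a ha => ⟨(hr a e he (hB (hJe.1 ha))).1, (hadj a (hJe.1 ha)).symm⟩,
      hanti e (Finset.mem_singleton_self e) e (Finset.mem_singleton_self e)⟩
  let IH : ε → Finset ι := fun e => (I e).filter fun a => NH (p a (r a))
  let IY : ε → Finset ι := fun e => (I e).filter fun a => ¬ NH (p a (r a))
  have hIHI : ∀ e, IH e ⊆ I e := fun e => Finset.filter_subset _ _
  have hsum : ∀ e, (IH e).card + (IY e).card = (I e).card := fun e =>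
    Finset.card_filter_add_card_filter_not _
  by_cases hEY : c ≤ (E.filter fun e => M₃ ≤ (IY e).card).card
  · obtain ⟨E', hE', hE'c⟩ := Finset.exists_subset_card_eq hEY
    have hE'E : ∀ e ∈ E', e ∈ E := fun e he => (Finset.mem_filter.mp (hE' he)).1
    refine hM₃ hG hW E' IY x y p n
      (hsys.mono hE'E fun e _ => Finset.filter_subset _ _) hE'c
      (fun e he => (Finset.mem_filter.mp (hE' he)).2) ?_
    intro e he a ha i hi0 hi
    obtain ⟨haI, haNH⟩ := Finset.mem_filter.mp ha
    have := (hr a e (hE'E e he) haI).2.2 haNH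
    exact hintW e (hE'E e he) a haI i hi0 (by omega)
  have hEH : c * c < (E.filter fun e => ¬ M₃ ≤ (IY e).card).card := by
    have := Finset.card_filter_add_card_filter_not (s := E) (fun e => M₃ ≤ (IY e).card)
    omega
  set EH := E.filter fun e => ¬ M₃ ≤ (IY e).card with hEHdef
  have hEHE : ∀ e ∈ EH, e ∈ E := fun e he => (Finset.mem_filter.mp he).1
  have hIH : ∀ e ∈ EH, c * (M₂ + M₁) ≤ (IH e).card := by
    intro e he
    have h1 := (Finset.mem_filter.mp he).2
    have h2 := hsum e
    have h3 := hI e (hEHE e he)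
    omega
  -- the last vertex of a leg is outside the packing and adjacent to it
  have hlast : ∀ e ∈ E, ∀ a ∈ I e, ∀ j < k, p a (r a) ∉ C j := by
    intro e he a ha j hj hmem
    have hra := hr a e he ha
    rcases Nat.eq_zero_or_pos (r a) with h0 | h0
    · refine ((((hC j hj).1 hmem).2) e he).2.2.1 ?_
      rw [h0]
      exact (hsys.first e he a ha).1
    · refine hra.2.1 (r a - 1) (by omega) ⟨j, hj, .inr ⟨_, hmem, ?_⟩⟩
      exact ((hsys.path e he a ha).1.2 _ (by omega) _ hra.1).mpr (.inl (by omega))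
  have hcomp : ∀ a, ∃ j, ∀ e ∈ E, a ∈ IH e → j < k ∧ ∃ h ∈ C j, G.Adj (p a (r a)) h := by
    intro a
    by_cases h : NH (p a (r a))
    · obtain ⟨j, hj, h | h⟩ := h
      · exact ⟨j, fun e he ha => absurd h (hlast e he a (hIHI e ha) j hj)⟩
      · exact ⟨j, fun _ _ _ => ⟨hj, h⟩⟩
    · exact ⟨0, fun e he ha => absurd (Finset.mem_filter.mp ha).2 h⟩
  choose j hj using hcomp
  have hk0 : 0 < k := by
    obtain ⟨e, he⟩ := Finset.card_pos.mp (show 0 < EH.card by omega)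
    have h1 := hIH e he
    have h2 : 0 < c * (M₂ + M₁) := Nat.mul_pos hG.hc (by omega)
    obtain ⟨a, ha⟩ := Finset.card_pos.mp (show 0 < (IH e).card by omega)
    have := (hj a e (hEHE e he) ha).1
    omega
  have hje : ∀ e, ∃ j', e ∈ EH → j' < k ∧ M₂ + M₁ ≤ ((IH e).filter fun a => j a = j').card := by
    intro e
    by_cases he : e ∈ EH
    · obtain ⟨j', h1, h2⟩ := Finset.exists_le_card_fiber_of_mul_le_card_of_maps_to (s := IH e)
        (t := Finset.range k) (f := j) (n := M₂ + M₁)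
        (fun a ha => by simpa using (hj a e (hEHE e he) ha).1) ⟨0, by simpa using hk0⟩
        (by
          rw [Finset.card_range]
          exact (Nat.mul_le_mul_right _ hkc.le).trans (hIH e he))
      exact ⟨j', fun _ => ⟨by simpa using h1, h2⟩⟩
    · exact ⟨0, fun h => absurd h he⟩
  choose je hje using hje
  obtain ⟨j₀, hj₀, hE₁⟩ := Finset.exists_le_card_fiber_of_mul_le_card_of_maps_to (s := EH)
    (t := Finset.range k) (f := je) (n := c) (fun e he => by simpa using (hje e he).1)
    ⟨0, by simpa using hk0⟩ (by
      rw [Finset.card_range]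
      exact (Nat.mul_le_mul_right _ hkc.le).trans hEH.le)
  have hj₀k : j₀ < k := by simpa using hj₀
  obtain ⟨E', hE', hE'c⟩ := Finset.exists_subset_card_eq hE₁
  have hE'H : ∀ e ∈ E', e ∈ EH := fun e he => (Finset.mem_filter.mp (hE' he)).1
  have hE'E : ∀ e ∈ E', e ∈ E := fun e he => hEHE e (hE'H e he)
  obtain ⟨n', -, hcyc⟩ := (hC j₀ hj₀k).2
  obtain ⟨q, z, hq, hqz⟩ := exists_iPath_of_isCycleIn hcyc
  have hqC : seg q (n' - 1) ⊆ C j₀ := by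
    rw [hqz]
    exact Set.subset_insert _ _
  let I' : ε → Finset ι := fun e => (I e).filter fun a => ∃ i < n' - 1, G.Adj (p a (r a)) (q i)
  have hI'I : ∀ e, I' e ⊆ I e := fun e => Finset.filter_subset _ _
  have hI' : ∀ e ∈ E', M₂ ≤ (I' e).card := by
    intro e he
    have h1 := (hje e (hE'H e he)).2
    rw [(Finset.mem_filter.mp (hE' he)).2] at h1
    have hsub : ((IH e).filter fun a => j a = j₀) ⊆
        I' e ∪ (I e).filter fun a => G.Adj (p a (r a)) z := by
      intro a ha
      obtain ⟨haH, haj⟩ := Finset.mem_filter.mp ha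
      obtain ⟨-, h, hh, hadj⟩ := hj a e (hE'E e he) haH
      rw [haj, hqz] at hh
      rcases hh with rfl | ⟨i, hi, rfl⟩
      · exact Finset.mem_union_right _ (Finset.mem_filter.mpr ⟨hIHI e haH, hadj⟩)
      · exact Finset.mem_union_left _ (Finset.mem_filter.mpr ⟨hIHI e haH, i, hi, hadj⟩)
    have h2 := (Finset.card_le_card hsub).trans (Finset.card_union_le _ _)
    have h3 := hnohub e (hE'E e he) j₀ hj₀k z (by rw [hqz]; exact Set.mem_insert _ _)
      ((I e).filter fun a => G.Adj (p a (r a)) z) (Finset.filter_subset _ _)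
      (fun b hb => (Finset.mem_filter.mp hb).2)
    omega
  refine hM₂ hG hW hq E' I' x p r hE'c hI'
    (fun e he f hf hef => (hsys.disjoint_index e (hE'E e he) f (hE'E f hf) hef).mono (hI'I e)
      (hI'I f))
    (fun e he a ha => ⟨hipath e (hE'E e he) a (hI'I e ha), hintW e (hE'E e he) a (hI'I e ha)⟩)
    (fun e he f hf a ha b hb => hdisr e (hE'E e he) f (hE'E f hf) a (hI'I e ha) b (hI'I f hb))
    ?_ (fun e he f hf hef => ⟨(hsys.distinct e (hE'E e he) f (hE'E f hf) hef).1,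
      (hsys.stable e (hE'E e he) f (hE'E f hf)).1⟩)
    ?_ (fun e he a ha => (hsys.first e (hE'E e he) a (hI'I e ha)).1) ?_ ?_
  · intro e he
    have hU : ∀ v ∈ seg q (n' - 1), v ≠ x e ∧ ¬ G.Adj (x e) v := fun v hv =>
      ⟨(((hC j₀ hj₀k).1 (hqC hv)).2 e (hE'E e he)).1,
        (((hC j₀ hj₀k).1 (hqC hv)).2 e (hE'E e he)).2.2.1⟩
    exact ⟨fun h => (hU _ h).1 rfl, fun i hi => (hU _ (mem_seg hi)).2⟩
  · intro e he f hf a ha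
    have hra := (hr a f (hE'E f hf) (hI'I f ha)).1
    refine ⟨fun h => (hsys.not_mem e (hE'E e he) f (hE'E f hf) a (hI'I f ha)).1
      (seg_mono hra h), fun hef i hi => ?_⟩
    exact (hsys.other e (hE'E e he) f (hE'E f hf) hef a (hI'I f ha) i (by omega)).1
  · intro e he a ha
    have hra := hr a e (hE'E e he) (hI'I e ha)
    refine ⟨fun i hi h => ?_, fun i hi i' hi' hadj => ?_, (Finset.mem_filter.mp ha).2⟩
    · rcases eq_or_lt_of_le hi with rfl | hi
      · exact hlast e (hE'E e he) a (hI'I e ha) j₀ hj₀k (hqC h)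
      · exact hra.2.1 i hi ⟨j₀, hj₀k, .inl (hqC h)⟩
    · exact hra.2.1 i hi ⟨j₀, hj₀k, .inr ⟨_, hqC (mem_seg hi'), hadj⟩⟩
  · intro e he i hi B hB hadj
    exact (hnohub e (hE'E e he) j₀ hj₀k (q i) (hqC (mem_seg hi)) B (hB.trans (hI'I e)) hadj).le

end

/-! ### Collecting hubs; exclusion of clean systems -/

section

variable {V : Type u} {G : SimpleGraph V}

variable (c l o s t : ℕ)

/-- A large clean system contains a clean system with a prescribed total number of vertices
adjacent to all members of a family. -/
theorem exists_hubs : ∃ N, 0 < N ∧ ∀ T m, ∃ M, 0 < M ∧ ∀ {V : Type u} {G : SimpleGraph V},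
    Good c l o s t G → ∀ {ε : Type w} {ι : Type v} (E : Finset ε)
      (I : ε → Finset ι) (x y : ε → V) (p : ι → ℕ → V) (n : ι → ℕ),
      CleanSystem G o E I x y p n → N ≤ E.card → (∀ e ∈ E, M ≤ (I e).card) →
      ∃ (H : ε → Finset V) (J : ε → Finset ι), ∑ e ∈ E, (H e).card = T ∧
        (∀ e ∈ E, J e ⊆ I e ∧ m ≤ (J e).card) ∧
        (∀ e ∈ E, ∀ f ∈ E, ∀ h ∈ H e, ∀ a ∈ J f, ∀ i < n a, p a i ≠ h) ∧
        ∀ e ∈ E, ∀ h ∈ H e, ∃ r : ι → ℕ, (∀ a ∈ J e, r a < n a ∧ G.Adj h (p a (r a))) ∧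
          ∀ a ∈ J e, ∀ b ∈ J e, a ≠ b →
            Anticomplete G (seg (p a) (r a + 1)) (seg (p b) (r b + 1)) := by
  classical
  obtain ⟨N, hN0, hN⟩ := exists_hub.{u, v, w} c l o s t
  refine ⟨N, hN0, fun T => ?_⟩
  induction T with
  | zero =>
    refine fun m => ⟨m + 1, by omega, fun {V G} hG {ε ι} E I x y p n hsys hE hI => ?_⟩
    exact ⟨fun _ => ∅, I, by simp, fun e he => ⟨subset_rfl, by have := hI e he; omega⟩,
      by simp, by simp⟩
  | succ T ih =>
    intro m
    obtain ⟨M₁, hM₁0, hM₁⟩ := hN (m + 1)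
    obtain ⟨M, hM0, hM⟩ := ih (M₁ + m + 1)
    refine ⟨M, hM0, fun {V G} hG {ε ι} E I x y p n hsys hE hI => ?_⟩
    obtain ⟨H, J, hHc, hJ, hHJ, hH⟩ := hM hG E I x y p n hsys hE hI
    have hsys' := hsys.mono (E' := E) (I' := J) subset_rfl (fun e he => (hJ e he).1)
    -- The remaining paths avoid all hubs found so far, which can therefore play the role of `Z`;
    -- this makes the next hub different from them.
    obtain ⟨e₀, he₀, h, hh, J₀, hJ₀, hJ₀c, r, hr, hanti⟩ := hM₁ hG E J x y p n hsys' hE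
      (fun e he => by have := (hJ e he).2; omega) (E.biUnion H) (by
        intro e he a ha i hi hmem
        obtain ⟨f, hf, hmem⟩ := Finset.mem_biUnion.mp hmem
        exact hHJ f hf e he _ hmem a ha i hi rfl)
    -- By disjointness at most one path of each family contains the new hub, and it is discarded.
    have hdrop : ∀ e ∈ E, ∀ A ⊆ J e,
        A.card ≤ (A.filter fun a => ∀ i < n a, p a i ≠ h).card + 1 := by
      intro e he A hA
      have h1 := Finset.card_filter_add_card_filter_not (s := A) (fun a => ∀ i < n a, p a i ≠ h)
      have h2 : (A.filter fun a => ¬ ∀ i < n a, p a i ≠ h).card ≤ 1 := by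
        rw [Finset.card_le_one]
        intro a ha b hb
        by_contra hab
        simp only [Finset.mem_filter, not_forall, not_not] at ha hb
        obtain ⟨haA, i, hi, hai⟩ := ha
        obtain ⟨hbA, j, hj, hbj⟩ := hb
        exact Set.disjoint_left.mp (hsys'.disjoint e he e he a (hA haA) b (hA hbA) hab)
          ⟨i, hi, hai⟩ ⟨j, hj, hbj⟩
      omega
    let H' : ε → Finset V := Function.update H e₀ (insert h (H e₀))
    let A : ε → Finset ι := Function.update J e₀ J₀
    have hAJ : ∀ e, A e ⊆ J e := by
      intro e
      by_cases hee : e = e₀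
      · subst hee
        simpa [A] using hJ₀
      · simp [A, hee]
    have hAc : ∀ e ∈ E, m + 1 ≤ (A e).card := by
      intro e he
      by_cases hee : e = e₀
      · subst hee
        simp [A, hJ₀c]
      · have := (hJ e he).2
        simp only [A, Function.update_of_ne hee]
        omega
    have hhH : h ∉ H e₀ := fun hmem => hh (Finset.mem_biUnion.mpr ⟨e₀, he₀, hmem⟩)
    refine ⟨H', fun e => (A e).filter fun a => ∀ i < n a, p a i ≠ h, ?_, ?_, ?_, ?_⟩
    · rw [← Finset.add_sum_erase E _ he₀, ← hHc, ← Finset.add_sum_erase E (fun e => (H e).card) he₀]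
      have : ∑ e ∈ E.erase e₀, (H' e).card = ∑ e ∈ E.erase e₀, (H e).card :=
        Finset.sum_congr rfl fun e he => by simp [H', Finset.ne_of_mem_erase he]
      rw [this]
      simp only [H', Function.update_self, Finset.card_insert_of_notMem hhH]
      omega
    · intro e he
      refine ⟨(Finset.filter_subset _ _).trans ((hAJ e).trans (hJ e he).1), ?_⟩
      exact Nat.le_of_add_le_add_right ((hAc e he).trans (hdrop e he (A e) (hAJ e)))
    · intro e he f hf g hg a ha i hi
      obtain ⟨haA, hah⟩ := Finset.mem_filter.mp ha
      by_cases hgh : g = h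
      · exact hgh ▸ hah i hi
      · refine hHJ e he f hf g ?_ a (hAJ f haA) i hi
        by_cases hee : e = e₀
        · subst hee
          simpa [H', hgh] using hg
        · simpa [H', hee] using hg
    · intro e he g hg
      by_cases hee : e = e₀
      · subst hee
        have hAJ₀ : A e = J₀ := by simp [A]
        simp only [H', Function.update_self, Finset.mem_insert] at hg
        rcases hg with rfl | hg
        · refine ⟨r, fun a ha => hr a ?_, fun a ha b hb => hanti a ?_ b ?_⟩
          · exact hAJ₀ ▸ (Finset.mem_filter.mp ha).1
          · exact hAJ₀ ▸ (Finset.mem_filter.mp ha).1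
          · exact hAJ₀ ▸ (Finset.mem_filter.mp hb).1
        · obtain ⟨r', h1, h2⟩ := hH e he g hg
          exact ⟨r', fun a ha => h1 a (hAJ e (Finset.mem_filter.mp ha).1), fun a ha b hb =>
            h2 a (hAJ e (Finset.mem_filter.mp ha).1) b (hAJ e (Finset.mem_filter.mp hb).1)⟩
      · have hg' : g ∈ H e := by simpa [H', hee] using hg
        obtain ⟨r', h1, h2⟩ := hH e he g hg'
        exact ⟨r', fun a ha => h1 a (hAJ e (Finset.mem_filter.mp ha).1), fun a ha b hb =>
          h2 a (hAJ e (Finset.mem_filter.mp ha).1) b (hAJ e (Finset.mem_filter.mp hb).1)⟩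

/-- Once one pair has `q` hubs, cut each of its paths at the farthest of its contacts with hubs: the
shortened path still sees all of them. Paths cut at a contact with the same hub are anticomplete, so
`q` of these contradict `exists_not_seen`. -/
theorem not_cleanSystem : ∃ N M, 0 < N ∧ 0 < M ∧ ∀ {V : Type u} {G : SimpleGraph V},
    Good c l o s t G → ∀ {ε : Type w} {ι : Type v} (E : Finset ε)
      (I : ε → Finset ι) (x y : ε → V) (p : ι → ℕ → V) (n : ι → ℕ),
      CleanSystem G o E I x y p n → N ≤ E.card → (∀ e ∈ E, M ≤ (I e).card) → False := by
  classical
  obtain ⟨q, hq0, hq⟩ := exists_not_seen.{u, v} c l o s t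
  obtain ⟨N, hN0, hN⟩ := exists_hubs.{u, v, w} c l o s t
  -- A total of `N * q` hubs over `N` pairs leaves `q` at one pair. That pair has at most `N * q`
  -- hubs, so `N * q * q` paths contain `q` with the same farthest hub.
  obtain ⟨M, hM0, hM⟩ := hN (N * q) (N * q * q)
  refine ⟨N, M, hN0, hM0, fun {V G} hG {ε ι} E' I x y p n hsys' hE' hI' => ?_⟩
  obtain ⟨E, hE, hEc⟩ := Finset.exists_subset_card_eq hE'
  have hsys := hsys'.mono hE (fun e _ => subset_rfl (a := I e))
  obtain ⟨H, J, hHc, hJ, hHJ, hH⟩ := hM hG E I x y p n hsys hEc.ge (fun e he => hI' e (hE he))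
  obtain ⟨e, he, heq⟩ := Finset.exists_le_of_sum_le (s := E) (f := fun _ => q)
    (g := fun e => (H e).card) (Finset.card_pos.mp (by omega))
    (by rw [hHc, Finset.sum_const, hEc, smul_eq_mul])
  have hHe : (H e).card ≤ N * q := hHc ▸ Finset.single_le_sum (f := fun e => (H e).card)
    (fun _ _ => Nat.zero_le _) he
  have hHne : (H e).Nonempty := Finset.card_pos.mp (by omega)
  have hr : ∀ h, ∃ r : ι → ℕ, h ∈ H e → (∀ a ∈ J e, r a < n a ∧ G.Adj h (p a (r a))) ∧
      ∀ a ∈ J e, ∀ b ∈ J e, a ≠ b →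
        Anticomplete G (seg (p a) (r a + 1)) (seg (p b) (r b + 1)) := by
    intro h
    by_cases hh : h ∈ H e
    · obtain ⟨r, h1⟩ := hH e he h hh
      exact ⟨r, fun _ => h1⟩
    · exact ⟨fun _ => 0, fun h => absurd h hh⟩
  choose r hr using hr
  have hmax : ∀ a, ∃ h ∈ H e, ∀ h' ∈ H e, r h' a ≤ r h a := fun a =>
    Finset.exists_max_image (H e) (fun h => r h a) hHne
  choose φ hφ hφmax using hmax
  obtain ⟨h₀, hh₀, hB⟩ := Finset.exists_le_card_fiber_of_mul_le_card_of_maps_to (s := J e)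
    (t := H e) (f := φ) (n := q) (fun a _ => hφ a) hHne
    ((Nat.mul_le_mul_right _ hHe).trans (hJ e he).2)
  have hBJ : ∀ b ∈ (J e).filter (fun a => φ a = h₀), b ∈ J e :=
    fun b hb => (Finset.mem_filter.mp hb).1
  obtain ⟨h, hh, b, hb, hno⟩ := hq hG (H e) ((J e).filter fun a => φ a = h₀) p
    (fun a => r h₀ a + 1) heq hB
    (fun b hb => (hsys.path e he b ((hJ e he).1 (hBJ b hb))).1.mono
      ((hr h₀ hh₀).1 b (hBJ b hb)).1)
    (fun a ha b hb hab => ⟨(hsys.disjoint e he e he a ((hJ e he).1 (hBJ a ha)) b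
      ((hJ e he).1 (hBJ b hb)) hab).mono (seg_mono ((hr h₀ hh₀).1 a (hBJ a ha)).1)
        (seg_mono ((hr h₀ hh₀).1 b (hBJ b hb)).1),
      (hr h₀ hh₀).2 a (hBJ a ha) b (hBJ b hb) hab⟩)
    (by
      rintro h hh b hb ⟨i, hi, hbi⟩
      exact hHJ e he e he h hh b (hBJ b hb) i
        (by have := ((hr h₀ hh₀).1 b (hBJ b hb)).1; omega) hbi)
  have h1 := hφmax b h hh
  rw [(Finset.mem_filter.mp hb).2] at h1
  exact hno _ (mem_seg (show r h b < r h₀ b + 1 by omega)) ((hr h hh).1 b (hBJ b hb)).2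

end

section

variable {V : Type u} {G : SimpleGraph V}

/-! ### Constellations -/

/-- The neighbours on the path `q` of the vertices of `S` form few clusters for each vertex, and
the neighbours of distinct vertices are far apart. -/
def Sparse (G : SimpleGraph V) (q : ℕ → V) (n τ K : ℕ) (S : Finset V) : Prop :=
  (∀ v ∈ S, (ends G q n τ v).card ≤ K) ∧ ∀ a ∈ S, ∀ b ∈ S, a ≠ b → ∀ y < n, ∀ y' < n,
    G.Adj a (q y) → G.Adj b (q y') → y + τ < y' ∨ y' + τ < y

theorem Sparse.mono {q : ℕ → V} {n τ K : ℕ} {S S' : Finset V} (h : Sparse G q n τ K S)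
    (hS : S' ⊆ S) : Sparse G q n τ K S' :=
  ⟨fun v hv => h.1 v (hS hv), fun a ha b hb => h.2 a (hS ha) b (hS hb)⟩

/-- The subpath ends at `B k`, the first neighbour of `hi k`, and starts at the last neighbour of
`lo k` before it, so each of the two vertices sees only its own end. By sparsity, `B k` is far from
the neighbours of all vertices of `S` but `hi k`, which is what `card_conflicts_le` needs to bound
the subpaths seen. -/
theorem Sparse.exists_subpaths {q : ℕ → V} {n τ K : ℕ} {S : Finset V}
    (hS : Sparse G q n τ K S) (hq : IPath G q n) (hτ : 1 ≤ τ) {N : ℕ} {lo hi : ℕ → V}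
    {A B : ℕ → ℕ}
    (hlo : ∀ k < N, lo k ∈ S ∧ A k < n ∧ G.Adj (lo k) (q (A k)))
    (hhi : ∀ k < N, hi k ∈ S ∧ B k < n ∧ G.Adj (hi k) (q (B k)) ∧
      ∀ z < B k, ¬ G.Adj (hi k) (q z))
    (hne : ∀ k < N, ∀ k' < N, lo k ≠ hi k') (hAB : ∀ k < N, A k < B k)
    (hord : ∀ k < N, ∀ k' < N, k ≠ k' → B k < A k' ∨ B k' < A k) :
    ∃ (Q : ℕ → ℕ → V) (ℓ : ℕ → ℕ),
      (∀ k < N, IPath G (Q k) (ℓ k) ∧ τ + 1 ≤ ℓ k ∧ seg (Q k) (ℓ k) ⊆ seg q n ∧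
        (G.Adj (lo k) (Q k 0) ∧ ∀ i < ℓ k, G.Adj (lo k) (Q k i) → i = 0) ∧
        (G.Adj (hi k) (Q k (ℓ k - 1)) ∧ ∀ i < ℓ k, G.Adj (hi k) (Q k i) → i + 1 = ℓ k)) ∧
      (∀ k < N, ∀ k' < N, k ≠ k' → Disjoint (seg (Q k) (ℓ k)) (seg (Q k') (ℓ k'))) ∧
      ∀ v ∈ S, ∀ T : Finset ℕ,
        (∀ k ∈ T, k < N ∧ hi k ≠ v ∧ ∃ y ∈ seg (Q k) (ℓ k), G.Adj v y) → T.card ≤ K := by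
  have hα : ∀ k, ∃ a, k < N → A k ≤ a ∧ a ≤ B k ∧ G.Adj (lo k) (q a) ∧
      ∀ y, G.Adj (lo k) (q y) → y ≤ B k → y ≤ a := by
    intro k
    by_cases hk : k < N
    · obtain ⟨a, ha⟩ := exists_last_neighbor (hAB k hk).le (hlo k hk).2.2
      exact ⟨a, fun _ => ha⟩
    · exact ⟨0, fun h => absurd h hk⟩
  choose α hα using hα
  have hαB : ∀ k < N, α k + τ < B k := by
    intro k hk
    obtain ⟨h1, h2, h3, -⟩ := hα k hk
    obtain ⟨h4, h5, h6, -⟩ := hhi k hk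
    have := hS.2 _ (hlo k hk).1 _ h4 (hne k hk k hk) (α k) (by omega) (B k) h5 h3 h6
    omega
  obtain ⟨ℓ, hℓ⟩ : ∃ ℓ : ℕ → ℕ, ∀ k, ℓ k = B k - α k + 1 := ⟨_, fun _ => rfl⟩
  refine ⟨fun k i => q (α k + i), ℓ, ?_, ?_, ?_⟩
  · intro k hk
    have hk' := hℓ k
    obtain ⟨h1, h2, h3, h7⟩ := hα k hk
    obtain ⟨h4, h5, h6, h8⟩ := hhi k hk
    have h9 := hαB k hk
    refine ⟨hq.shift (by omega), by omega, seg_shift_subset (by omega), ⟨h3, fun i hi hadj => ?_⟩,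
      ?_, fun i hi hadj => ?_⟩
    · have := h7 _ hadj (by omega)
      omega
    · have : α k + (ℓ k - 1) = B k := by omega
      simpa only [this] using h6
    · have : ¬ α k + i < B k := fun h => h8 _ h hadj
      omega
  · intro k hk k' hk' hkk
    rw [Set.disjoint_left]
    rintro _ ⟨i, hi, rfl⟩ ⟨j, hj, hij⟩
    have := hℓ k
    have := hℓ k'
    have h1 := hα k hk
    have h2 := hα k' hk'
    have h3 := (hhi k hk).2.1
    have h4 := (hhi k' hk').2.1
    have h5 := hq.1 (show α k' + j < n by omega) (show α k + i < n by omega) hij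
    have := hord k hk k' hk' hkk
    omega
  · intro v hv T hT
    refine (card_conflicts_le T α B v hτ (fun k hk => (hhi k (hT k hk).1).2.1) ?_ ?_ ?_).trans
      (hS.1 v hv)
    · have key : ∀ k < N, ∀ k' < N, B k < A k' → B k + 1 < α k' := by
        intro k hk k' hk' h
        obtain ⟨h1, h2, h3, -⟩ := hα k' hk'
        obtain ⟨h4, h5, h6, -⟩ := hhi k hk
        have h7 := (hhi k' hk').2.1
        have := hS.2 _ (hlo k' hk').1 _ h4 (hne k' hk' k hk) (α k') (by omega) (B k) h5 h3 h6
        omega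
      intro k hk k' hk' hkk
      exact (hord k (hT k hk).1 k' (hT k' hk').1 hkk).imp (key k (hT k hk).1 k' (hT k' hk').1)
        (key k' (hT k' hk').1 k (hT k hk).1)
    · intro k hk x hx hadj
      obtain ⟨hkN, hkv, -⟩ := hT k hk
      obtain ⟨h4, h5, h6, -⟩ := hhi k hkN
      exact hS.2 v hv _ h4 hkv.symm x hx (B k) h5 hadj h6
    · intro k hk
      obtain ⟨hkN, hkv, _, ⟨i, hi, rfl⟩, hadj⟩ := hT k hk
      have h5 := (hhi k hkN).2.1
      have h6 := hα k hkN
      have := hℓ k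
      exact ⟨α k + i, by omega, by omega, by omega, hadj⟩

/-- When the first neighbours occur in decreasing order, the roles of `x` and `y` are exchanged and
the resulting subpaths reversed. -/
theorem Sparse.exists_pair_paths {q : ℕ → V} {n τ K : ℕ} {S : Finset V}
    (hS : Sparse G q n τ K S) (hq : IPath G q n) (hτ : 1 ≤ τ) {N : ℕ} {x y : ℕ → V} {F : V → ℕ}
    (hx : ∀ k < N, x k ∈ S) (hy : ∀ k < N, y k ∈ S) (hne : ∀ k < N, ∀ k' < N, x k ≠ y k')
    (hF : ∀ v ∈ S, F v < n ∧ G.Adj v (q (F v)) ∧ ∀ z < F v, ¬ G.Adj v (q z))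
    (hmono : ((∀ k < N, F (x k) < F (y k)) ∧ ∀ k k', k < k' → k' < N → F (y k) < F (x k')) ∨
      ((∀ k < N, F (y k) < F (x k)) ∧ ∀ k k', k < k' → k' < N → F (x k') < F (y k))) :
    ∃ (Q : ℕ → ℕ → V) (ℓ : ℕ → ℕ),
      (∀ k < N, IPath G (Q k) (ℓ k) ∧ τ + 1 ≤ ℓ k ∧ seg (Q k) (ℓ k) ⊆ seg q n ∧
        (G.Adj (x k) (Q k 0) ∧ ∀ i < ℓ k, G.Adj (x k) (Q k i) → i = 0) ∧
        (G.Adj (y k) (Q k (ℓ k - 1)) ∧ ∀ i < ℓ k, G.Adj (y k) (Q k i) → i + 1 = ℓ k)) ∧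
      (∀ k < N, ∀ k' < N, k ≠ k' → Disjoint (seg (Q k) (ℓ k)) (seg (Q k') (ℓ k'))) ∧
      ∀ v ∈ S, ∀ T : Finset ℕ,
        (∀ k ∈ T, k < N ∧ x k ≠ v ∧ y k ≠ v ∧ ∃ z ∈ seg (Q k) (ℓ k), G.Adj v z) →
          T.card ≤ K := by
  rcases hmono with ⟨h1, h2⟩ | ⟨h1, h2⟩
  · obtain ⟨Q, ℓ, h3, h4, h5⟩ := hS.exists_subpaths hq hτ (lo := x) (hi := y)
      (A := fun k => F (x k)) (B := fun k => F (y k)) (N := N)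
      (fun k hk => ⟨hx k hk, (hF _ (hx k hk)).1, (hF _ (hx k hk)).2.1⟩)
      (fun k hk => ⟨hy k hk, hF _ (hy k hk)⟩) hne h1
      (fun k hk k' hk' hkk => (lt_or_gt_of_ne hkk).imp (fun h => h2 k k' h hk')
        (fun h => h2 k' k h hk))
    exact ⟨Q, ℓ, h3, h4, fun v hv T hT => h5 v hv T fun k hk =>
      ⟨(hT k hk).1, (hT k hk).2.2.1, (hT k hk).2.2.2⟩⟩
  · obtain ⟨Q, ℓ, h3, h4, h5⟩ := hS.exists_subpaths hq hτ (lo := y) (hi := x)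
      (A := fun k => F (y k)) (B := fun k => F (x k)) (N := N)
      (fun k hk => ⟨hy k hk, (hF _ (hy k hk)).1, (hF _ (hy k hk)).2.1⟩)
      (fun k hk => ⟨hx k hk, hF _ (hx k hk)⟩) (fun k hk k' hk' h => hne k' hk' k hk h.symm) h1
      (fun k hk k' hk' hkk => (lt_or_gt_of_ne hkk).symm.imp (fun h => h2 k' k h hk)
        (fun h => h2 k k' h hk'))
    refine ⟨fun k i => Q k (ℓ k - 1 - i), ℓ, fun k hk => ?_, ?_, ?_⟩
    · obtain ⟨h6, h7, h8, h9, h10⟩ := h3 k hk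
      refine ⟨h6.reverse, h7, seg_reverse.trans_subset h8, ⟨h10.1, fun i hi hadj => ?_⟩,
        ?_, fun i hi hadj => ?_⟩
      · have := h10.2 _ (by omega) hadj
        omega
      · simpa using h9.1
      · have := h9.2 _ (by omega) hadj
        omega
    · intro k hk k' hk' hkk
      simpa only [seg_reverse] using h4 k hk k' hk' hkk
    · intro v hv T hT
      refine h5 v hv T fun k hk => ⟨(hT k hk).1, (hT k hk).2.1, ?_⟩
      simpa only [seg_reverse] using (hT k hk).2.2.2

variable (c l o s t : ℕ)

/-- Discard the vertices with many ends. Either one vertex of the path is adjacent to more than `m`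
of the others, or `exists_far` applies with `d = m`. -/
theorem exists_complete_or_sparse (τ : ℕ) (hτo : o ≤ τ) (hτ : 4 ≤ τ) : ∃ K, ∀ m, ∃ R, 0 < R ∧
    ∀ {V : Type u} {G : SimpleGraph V}, Good c l o s t G → ∀ {q : ℕ → V} {n : ℕ}, IPath G q n →
      ∀ S : Finset V, R ≤ S.card → (∀ v ∈ S, v ∉ seg q n) →
        ∃ S' ⊆ S, S'.card = m ∧
          ((∃ y < n, ∀ v ∈ S', G.Adj v (q y)) ∨ Sparse G q n τ K S') := by
  classical
  obtain ⟨R, K, hR0, hR⟩ := exists_few_ends.{u} c l o s t τ hτo hτ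
  refine ⟨K, fun m => ?_⟩
  obtain ⟨M, hM0, hM⟩ := exists_far.{u, u, 0} 1 K m m τ τ
  refine ⟨R + M, by omega, fun {V G} hG {q n} hq S hS hSq => ?_⟩
  let S₁ := S.filter fun v => (ends G q n τ v).card ≤ K
  have hS₁ : M ≤ S₁.card := by
    have h1 := Finset.card_filter_add_card_filter_not (s := S) fun v => (ends G q n τ v).card ≤ K
    by_contra hcon
    obtain ⟨v, hv, hvK⟩ := hR hG hq (S.filter fun v => ¬ (ends G q n τ v).card ≤ K)
      (by simp only [S₁] at hcon; omega) (fun v hv => hSq v (Finset.mem_filter.mp hv).1)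
    exact (Finset.mem_filter.mp hv).2 hvK
  by_cases hcom : ∃ y < n, ∃ B ⊆ S₁, m < B.card ∧ ∀ b ∈ B, G.Adj b (q y)
  · obtain ⟨y, hy, B, hB, hBc, hBy⟩ := hcom
    obtain ⟨S', hS', hS'c⟩ := Finset.exists_subset_card_eq hBc.le
    exact ⟨S', hS'.trans (hB.trans (Finset.filter_subset _ _)), hS'c,
      .inl ⟨y, hy, fun v hv => hBy v (hS' hv)⟩⟩
  · push Not at hcom
    obtain ⟨J, hJ, hfar⟩ := hM (G := G) (q := q) (n := n) {()} (fun _ => S₁) (fun v => v)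
      (by simp) (fun _ _ => hS₁) (by simp) (fun _ _ v hv => (Finset.mem_filter.mp hv).2)
      (fun y hy B hB hBy => by
        by_contra hBm
        obtain ⟨b, hb, hby⟩ := hcom y hy B (fun b hb => by simpa using hB b hb) (by omega)
        exact hby (hBy b hb))
    have hJS := hJ () (Finset.mem_singleton_self _)
    exact ⟨J (), hJS.1.trans (Finset.filter_subset _ _), hJS.2, .inr
      ⟨fun v hv => (Finset.mem_filter.mp (hJS.1 hv)).2,
        hfar () (Finset.mem_singleton_self _) () (Finset.mem_singleton_self _)⟩⟩

/-- The paths are treated one after another, since both alternatives pass to subsets. That `K`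
depends neither on `k` nor on `m` allows later constants to be chosen in terms of it. -/
theorem exists_complete_or_sparse_paths (τ : ℕ) (hτo : o ≤ τ) (hτ : 4 ≤ τ) :
    ∃ K, ∀ k m, ∃ R, 0 < R ∧
      ∀ {V : Type u} {G : SimpleGraph V}, Good c l o s t G → ∀ {q : ℕ → ℕ → V} {n : ℕ → ℕ},
        (∀ i < k, IPath G (q i) (n i)) → ∀ S : Finset V, R ≤ S.card →
        (∀ i < k, ∀ v ∈ S, v ∉ seg (q i) (n i)) →
        ∃ S' ⊆ S, S'.card = m ∧ ∀ i < k,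
          (∃ y < n i, ∀ v ∈ S', G.Adj v (q i y)) ∨ Sparse G (q i) (n i) τ K S' := by
  obtain ⟨K, hK⟩ := exists_complete_or_sparse.{u} c l o s t τ hτo hτ
  refine ⟨K, fun k => ?_⟩
  induction k with
  | zero =>
    refine fun m => ⟨m + 1, by omega, fun {V G} hG {q n} _ S hS _ => ?_⟩
    obtain ⟨S', hS', hc⟩ := Finset.exists_subset_card_eq (show m ≤ S.card by omega)
    exact ⟨S', hS', hc, by simp⟩
  | succ k ih =>
    intro m
    obtain ⟨R₁, hR₁0, hR₁⟩ := hK m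
    obtain ⟨R, hR0, hR⟩ := ih R₁
    refine ⟨R, hR0, fun {V G} hG {q n} hq S hS hSq => ?_⟩
    obtain ⟨S₁, hS₁, hS₁c, h₁⟩ := hR hG (fun i hi => hq i (by omega)) S hS
      (fun i hi => hSq i (by omega))
    obtain ⟨S₂, hS₂, hS₂c, h₂⟩ := hR₁ hG (hq k (by omega)) S₁ hS₁c.ge
      (fun v hv => hSq k (by omega) v (hS₁ hv))
    refine ⟨S₂, hS₂.trans hS₁, hS₂c, fun i hi => ?_⟩
    rcases eq_or_lt_of_le (Nat.le_of_lt_succ hi) with rfl | hi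
    · exact h₂
    · rcases h₁ i hi with ⟨y, hy, h⟩ | h
      · exact .inl ⟨y, hy, fun v hv => h v (hS₂ hv)⟩
      · exact .inr (h.mono hS₂)

/-- Not all vertices of a large set can have neighbours in all of many disjoint paths. -/
theorem exists_not_seen_of_disjoint : ∃ R k, 0 < R ∧ ∀ {V : Type u} {G : SimpleGraph V},
    Good c l o s t G → ∀ {ι : Type v} (S : Finset V) (B : Finset ι)
      (p : ι → ℕ → V) (n : ι → ℕ), R ≤ S.card → k ≤ B.card →
      (∀ b ∈ B, IPath G (p b) (n b)) →
      (∀ a ∈ B, ∀ b ∈ B, a ≠ b → Disjoint (seg (p a) (n a)) (seg (p b) (n b))) →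
      (∀ x ∈ S, ∀ b ∈ B, x ∉ seg (p b) (n b)) →
      ∃ x ∈ S, ∃ b ∈ B, ∀ y ∈ seg (p b) (n b), ¬ G.Adj x y := by
  classical
  obtain ⟨N, M, hN0, hM0, hNM⟩ := not_cleanSystem.{u, 0, 0} c l o s t
  obtain ⟨r, hr0, hr⟩ := exists_not_adj.{u} c l o s t
  obtain ⟨K, hK⟩ := exists_complete_or_sparse_paths.{u} c l o s t (o + 4) (by omega) (by omega)
  -- Of `r + M` paths, `M` will be sparse: `r` others would yield a biclique. Vertices are grouped
  -- in pairs; each vertex sees at most `K` subpaths of other pairs on each of the `M` paths, so a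
  -- pair is in conflict with at most `2 * (K * M)` others.
  obtain ⟨L, hL0, hL⟩ := clean_one.{0} (2 * (K * M) + 1) N
  obtain ⟨R₁, hR₁0, hR₁⟩ := ramsey.{u} (Fin (r + M) → Bool) (2 * L)
  obtain ⟨R₂, hR₂0, hR₂⟩ := hK (r + M) (R₁ + r)
  obtain ⟨R₃, hR₃0, hR₃⟩ := exists_stable.{u} c l o s t R₂
  refine ⟨R₃, r + M, hR₃0, fun {V G} hG {ι} S₀ B p' n' hS₀ hB hp' hdis' hoff' => ?_⟩
  by_contra! hsee'
  obtain ⟨en, hen, heninj, -⟩ := exists_enum B (Finset.card_pos.mp (by omega))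
  let p : ℕ → ℕ → V := fun i => p' (en i)
  let n : ℕ → ℕ := fun i => n' (en i)
  have hp : ∀ i < r + M, IPath G (p i) (n i) := fun i hi => hp' _ (hen i (by omega))
  have hdis : ∀ i < r + M, ∀ j < r + M, i ≠ j →
      Disjoint (seg (p i) (n i)) (seg (p j) (n j)) := fun i hi j hj hij =>
    hdis' _ (hen i (by omega)) _ (hen j (by omega)) fun h =>
      hij (heninj (show i < _ by omega) (show j < _ by omega) h)
  obtain ⟨S₁, hS₁, hS₁c, hst⟩ := hR₃ hG S₀ hS₀
  obtain ⟨S, hS, hSc, hdich⟩ := hR₂ hG hp S₁ hS₁c.ge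
    (fun i hi v hv => hoff' v (hS₁ hv) _ (hen i (by omega)))
  have hoff : ∀ v ∈ S, ∀ i < r + M, v ∉ seg (p i) (n i) := fun v hv i hi =>
    hoff' v (hS₁ (hS hv)) _ (hen i (by omega))
  have hsee : ∀ v ∈ S, ∀ i < r + M, ∃ y < n i, G.Adj v (p i y) := by
    intro v hv i hi
    obtain ⟨_, ⟨y, hy, rfl⟩, hadj⟩ := hsee' v (hS₁ (hS hv)) _ (hen i (by omega))
    exact ⟨y, hy, hadj⟩
  -- most of the paths are sparse
  have hsp : M ≤ ((Finset.range (r + M)).filter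
      fun i => Sparse G (p i) (n i) (o + 4) K S).card := by
    have h1 := Finset.card_filter_add_card_filter_not (s := Finset.range (r + M))
      fun i => Sparse G (p i) (n i) (o + 4) K S
    rw [Finset.card_range] at h1
    by_contra hcon
    obtain ⟨D, hD, hDc⟩ := Finset.exists_subset_card_eq (show r ≤ ((Finset.range (r + M)).filter
      fun i => ¬ Sparse G (p i) (n i) (o + 4) K S).card by omega)
    have hDlt : ∀ i ∈ D, i < r + M := fun i hi => by
      simpa using (Finset.mem_filter.mp (hD hi)).1
    have hy : ∀ i, ∃ y, i ∈ D → y < n i ∧ ∀ v ∈ S, G.Adj v (p i y) := by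
      intro i
      by_cases hi : i ∈ D
      · obtain ⟨y, hy⟩ := (hdich i (hDlt i hi)).resolve_right (Finset.mem_filter.mp (hD hi)).2
        exact ⟨y, fun _ => hy⟩
      · exact ⟨0, fun h => absurd h hi⟩
    choose y hy using hy
    obtain ⟨S', hS', hS'c⟩ := Finset.exists_subset_card_eq (show r ≤ S.card by omega)
    obtain ⟨a, ha, b, hb, hab⟩ := hr hG S' (D.image fun i => p i (y i)) hS'c (by
      rw [Finset.card_image_of_injOn, hDc]
      intro i hi j hj hij
      by_contra hne
      exact Set.disjoint_left.mp (hdis i (hDlt i hi) j (hDlt j hj) hne)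
        (mem_seg (hy i hi).1) ⟨y j, (hy j hj).1, hij.symm⟩)
    obtain ⟨i, hi, rfl⟩ := Finset.mem_image.mp hb
    exact hab ((hy i hi).2 a (hS' ha))
  obtain ⟨T, hT, hTc⟩ := Finset.exists_subset_card_eq hsp
  have hTlt : ∀ i ∈ T, i < r + M := fun i hi => by
    simpa using (Finset.mem_filter.mp (hT hi)).1
  have hTs : ∀ i ∈ T, Sparse G (p i) (n i) (o + 4) K S := fun i hi =>
    (Finset.mem_filter.mp (hT hi)).2
  -- first neighbours and their order
  have hF : ∀ i v, ∃ y, v ∈ S → i ∈ T → y < n i ∧ G.Adj v (p i y) ∧ ∀ z < y, ¬ G.Adj v (p i z) := by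
    intro i v
    by_cases h : v ∈ S ∧ i ∈ T
    · obtain ⟨y, hy⟩ := exists_first_neighbor (hsee v h.1 i (hTlt i h.2))
      exact ⟨y, fun _ _ => hy⟩
    · exact ⟨0, fun h1 h2 => absurd ⟨h1, h2⟩ h⟩
  choose F hF using hF
  -- Make the first neighbours of `g 0, g 1, …` monotone on all sparse paths simultaneously,
  -- increasing or decreasing. Then the pairs `g (2 * k)`, `g (2 * k + 1)` span disjoint subpaths on
  -- each of them.
  obtain ⟨g, hg, hginj, col, hcol⟩ := hR₁ S (by omega)
    (fun v v' (i : Fin (r + M)) => decide (F i v < F i v'))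
  have hgne : ∀ i < 2 * L, ∀ j < 2 * L, i ≠ j → g i ≠ g j := fun i hi j hj hij h =>
    hij (hginj hi hj h)
  have hmono : ∀ i ∈ T, (∀ a b, a < b → b < 2 * L → F i (g a) < F i (g b)) ∨
      ∀ a b, a < b → b < 2 * L → F i (g b) < F i (g a) := by
    intro i hi
    have hi' := hTlt i hi
    cases hc : col ⟨i, hi'⟩ with
    | true =>
      refine .inl fun a b hab hb => ?_
      have := congrFun (hcol a b hab hb) ⟨i, hi'⟩
      simpa [hc] using this
    | false =>
      refine .inr fun a b hab hb => ?_
      have := congrFun (hcol a b hab hb) ⟨i, hi'⟩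
      have hle : F i (g b) ≤ F i (g a) := by simpa [hc] using this
      have ha' := hF i (g a) (hg a (by omega)) hi
      have hb' := hF i (g b) (hg b hb) hi
      have := (hTs i hi).2 _ (hg a (by omega)) _ (hg b hb) (hgne a (by omega) b hb hab.ne)
        _ ha'.1 _ hb'.1 ha'.2.1 hb'.2.1
      omega
  have hQ : ∀ i, ∃ (Q : ℕ → ℕ → V) (ℓ : ℕ → ℕ), i ∈ T →
      (∀ k < L, IPath G (Q k) (ℓ k) ∧ o + 4 + 1 ≤ ℓ k ∧ seg (Q k) (ℓ k) ⊆ seg (p i) (n i) ∧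
        (G.Adj (g (2 * k)) (Q k 0) ∧ ∀ j < ℓ k, G.Adj (g (2 * k)) (Q k j) → j = 0) ∧
        (G.Adj (g (2 * k + 1)) (Q k (ℓ k - 1)) ∧
          ∀ j < ℓ k, G.Adj (g (2 * k + 1)) (Q k j) → j + 1 = ℓ k)) ∧
      (∀ k < L, ∀ k' < L, k ≠ k' → Disjoint (seg (Q k) (ℓ k)) (seg (Q k') (ℓ k'))) ∧
      ∀ v ∈ S, ∀ T : Finset ℕ, (∀ k ∈ T, k < L ∧ g (2 * k) ≠ v ∧ g (2 * k + 1) ≠ v ∧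
        ∃ z ∈ seg (Q k) (ℓ k), G.Adj v z) → T.card ≤ K := by
    intro i
    by_cases hi : i ∈ T
    swap
    · exact ⟨fun _ _ => g 0, fun _ => 0, fun h => absurd h hi⟩
    obtain ⟨Q, ℓ, h⟩ := (hTs i hi).exists_pair_paths (hp i (hTlt i hi)) (by omega)
      (x := fun k => g (2 * k)) (y := fun k => g (2 * k + 1)) (F := F i) (N := L)
      (fun k hk => hg _ (by omega)) (fun k hk => hg _ (by omega))
      (fun k hk k' hk' => hgne _ (by omega) _ (by omega) (by omega))
      (fun v hv => hF i v hv hi) ((hmono i hi).imp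
        (fun h => ⟨fun k hk => h _ _ (by omega) (by omega), fun k k' hkk hk' =>
          h _ _ (by omega) (by omega)⟩)
        (fun h => ⟨fun k hk => h _ _ (by omega) (by omega), fun k k' hkk hk' =>
          h _ _ (by omega) (by omega)⟩))
    exact ⟨Q, ℓ, fun _ => h⟩
  choose Q ℓ hQ using hQ
  -- remove the conflicts between pairs
  let sees : V → ℕ → Prop := fun v k => ∃ i ∈ T, ∃ z ∈ seg (Q i k) (ℓ i k), G.Adj v z
  have hfew : ∀ v ∈ S, ∀ D : Finset ℕ,
      (∀ k ∈ D, k < L ∧ g (2 * k) ≠ v ∧ g (2 * k + 1) ≠ v ∧ sees v k) → D.card ≤ K * M := by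
    intro v hv D hD
    have hsub : D ⊆ T.biUnion fun i => D.filter fun k => ∃ z ∈ seg (Q i k) (ℓ i k), G.Adj v z := by
      intro k hk
      obtain ⟨-, -, -, i, hi, h⟩ := hD k hk
      exact Finset.mem_biUnion.mpr ⟨i, hi, Finset.mem_filter.mpr ⟨hk, h⟩⟩
    refine (Finset.card_le_card hsub).trans ((Finset.card_biUnion_le_card_mul _ _ K ?_).trans ?_)
    · intro i hi
      refine (hQ i hi).2.2 v hv _ fun k hk => ?_
      obtain ⟨hkD, h⟩ := Finset.mem_filter.mp hk
      exact ⟨(hD k hkD).1, (hD k hkD).2.1, (hD k hkD).2.2.1, h⟩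
    · rw [hTc, mul_comm]
  obtain ⟨E, hE, hEc, hclean⟩ := hL (Finset.range L)
    (fun k k' => sees (g (2 * k)) k' ∨ sees (g (2 * k + 1)) k') (by simp) (by
      intro A D hA hD hAD hAL hDL
      by_contra! hcon
      obtain ⟨a, ha⟩ := Finset.card_pos.mp (show 0 < A.card by omega)
      have haL : a < L := by simpa using hAL ha
      have hbL : ∀ k ∈ D, k < L ∧ k ≠ a := fun k hk => ⟨by simpa using hDL hk,
        fun h => Finset.disjoint_left.mp hAD ha (h ▸ hk)⟩
      have h1 := hfew (g (2 * a)) (hg _ (by omega)) (D.filter fun k => sees (g (2 * a)) k) (by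
        intro k hk
        obtain ⟨hkD, h⟩ := Finset.mem_filter.mp hk
        obtain ⟨h2, h3⟩ := hbL k hkD
        exact ⟨h2, hgne _ (by omega) _ (by omega) (by omega),
          hgne _ (by omega) _ (by omega) (by omega), h⟩)
      have h2 := hfew (g (2 * a + 1)) (hg _ (by omega))
        (D.filter fun k => ¬ sees (g (2 * a)) k) (by
        intro k hk
        obtain ⟨hkD, h⟩ := Finset.mem_filter.mp hk
        obtain ⟨h2, h3⟩ := hbL k hkD
        exact ⟨h2, hgne _ (by omega) _ (by omega) (by omega),
          hgne _ (by omega) _ (by omega) (by omega), (hcon a ha k hkD).resolve_left h⟩)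
      have h3 := Finset.card_filter_add_card_filter_not (s := D) fun k => sees (g (2 * a)) k
      omega)
  have hEL : ∀ k ∈ E, k < L := fun k hk => by simpa using hE hk
  refine hNM hG E (fun k => T.image fun i => (k, i)) (fun k => g (2 * k)) (fun k => g (2 * k + 1))
    (fun a => Q a.2 a.1) (fun a => ℓ a.2 a.1) ?_ hEc.ge ?_
  swap
  · intro k hk
    rw [Finset.card_image_of_injective _ (fun i j h => (Prod.ext_iff.mp h).2), hTc]
  have hgS : ∀ k < 2 * L, g k ∈ S := fun k hk => hg k hk
  have hns : ∀ a < 2 * L, ∀ b < 2 * L, ¬ G.Adj (g a) (g b) := fun a ha b hb h =>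
    hst (hS (hg a ha)) (hS (hg b hb)) h.ne h
  constructor
  · intro e he f hf hef
    rw [Finset.disjoint_left]
    intro a ha hb
    obtain ⟨i, -, rfl⟩ := Finset.mem_image.mp ha
    obtain ⟨j, -, h⟩ := Finset.mem_image.mp hb
    exact hef (Prod.ext_iff.mp h).1.symm
  · intro e he a ha
    obtain ⟨i, hi, rfl⟩ := Finset.mem_image.mp ha
    have := (hQ i hi).1 e (hEL e he)
    exact ⟨this.1, by have := this.2.1; simp only; omega⟩
  · intro e he f hf a ha b hb hab
    obtain ⟨i, hi, rfl⟩ := Finset.mem_image.mp ha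
    obtain ⟨j, hj, rfl⟩ := Finset.mem_image.mp hb
    by_cases hij : i = j
    · subst hij
      exact (hQ i hi).2.1 e (hEL e he) f (hEL f hf) fun h => hab (by rw [h])
    · exact (hdis i (hTlt i hi) j (hTlt j hj) hij).mono ((hQ i hi).1 e (hEL e he)).2.2.1
        ((hQ j hj).1 f (hEL f hf)).2.2.1
  · intro e he a ha
    obtain ⟨i, hi, rfl⟩ := Finset.mem_image.mp ha
    exact ((hQ i hi).1 e (hEL e he)).2.2.2.1
  · intro e he a ha
    obtain ⟨i, hi, rfl⟩ := Finset.mem_image.mp ha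
    exact ((hQ i hi).1 e (hEL e he)).2.2.2.2
  · intro e he f hf hef a ha j hj
    obtain ⟨i, hi, rfl⟩ := Finset.mem_image.mp ha
    have := hclean e he f hf hef
    exact ⟨fun h => this (.inl ⟨i, hi, _, mem_seg hj, h⟩),
      fun h => this (.inr ⟨i, hi, _, mem_seg hj, h⟩)⟩
  · intro e he f hf a ha
    obtain ⟨i, hi, rfl⟩ := Finset.mem_image.mp ha
    have h1 := ((hQ i hi).1 f (hEL f hf)).2.2.1
    have h2 := hEL e he
    exact ⟨fun h => hoff _ (hgS _ (by omega)) i (hTlt i hi) (h1 h),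
      fun h => hoff _ (hgS _ (by omega)) i (hTlt i hi) (h1 h)⟩
  · intro e he f hf
    have h1 := hEL e he
    have h2 := hEL f hf
    exact ⟨hns _ (by omega) _ (by omega), hns _ (by omega) _ (by omega),
      hns _ (by omega) _ (by omega)⟩
  · intro e he f hf hef
    have h1 := hEL e he
    have h2 := hEL f hf
    exact ⟨hgne _ (by omega) _ (by omega) (by omega), hgne _ (by omega) _ (by omega) (by omega),
      hgne _ (by omega) _ (by omega) (by omega)⟩

end

section

variable {V : Type u} {G : SimpleGraph V}

/-! ### Rings of short paths -/

theorem conn_chain {b : ℕ → V} {T : ℕ → Set V} (j : ℕ) (hT : ∀ i < j, Conn G (T i))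
    (h0 : ∀ i < j, ∃ z ∈ T i, G.Adj (b i) z) (h1 : ∀ i < j, ∃ z ∈ T i, G.Adj (b (i + 1)) z) :
    Conn G {v | (∃ i ≤ j, b i = v) ∨ ∃ i < j, v ∈ T i} := by
  induction j with
  | zero =>
    convert conn_singleton (G := G) (b 0) using 1
    ext v
    simp [eq_comm]
  | succ j ih =>
    have hU := ih (fun i hi => hT i (by omega)) (fun i hi => h0 i (by omega))
      (fun i hi => h1 i (by omega))
    obtain ⟨z, hz, hzb⟩ := h0 j (by omega)
    obtain ⟨z', hz', hzb'⟩ := h1 j (by omega)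
    convert (hU.union (hT j (by omega)) (.inl ⟨j, le_rfl, rfl⟩) hz hzb).union
      (conn_singleton (b (j + 1))) (.inr hz') rfl hzb'.symm using 1
    ext v
    constructor
    · rintro (⟨i, hi, rfl⟩ | ⟨i, hi, hv⟩)
      · rcases eq_or_lt_of_le hi with rfl | hi
        · exact .inr rfl
        · exact .inl (.inl (.inl ⟨i, by omega, rfl⟩))
      · rcases eq_or_lt_of_le (Nat.le_of_lt_succ hi) with rfl | hi
        · exact .inl (.inr hv)
        · exact .inl (.inl (.inr ⟨i, hi, hv⟩))
    · rintro (((⟨i, hi, rfl⟩ | ⟨i, hi, hv⟩) | hv) | rfl)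
      · exact .inl ⟨i, by omega, rfl⟩
      · exact .inr ⟨i, by omega, hv⟩
      · exact .inr ⟨j, by omega, hv⟩
      · exact .inl ⟨j + 1, le_rfl, rfl⟩

/-- On a shortest path from `b 0` to `b (o + 1)` through the chain, the index grows by at most one
at each step (`hlevel`), so the path has at least `o + 2` vertices. The set `R` sees only its ends
and closes it to a long cycle. -/
theorem hasLong_of_ring {o : ℕ} {b : ℕ → V} {T : ℕ → Set V} {R : Set V} (ho : 1 ≤ o)
    (hb : Set.InjOn b (Set.Iio (o + 2))) (hst : ∀ i < o + 2, ∀ j < o + 2, ¬ G.Adj (b i) (b j))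
    (hT : ∀ i < o + 1, Conn G (T i)) (hR : Conn G R)
    (hbT : ∀ i < o + 1, ∀ h < o + 2, (∃ z ∈ T i, G.Adj (b h) z) ↔ h = i ∨ h = i + 1)
    (hbR : ∀ h < o + 2, (∃ z ∈ R, G.Adj (b h) z) ↔ h = 0 ∨ h = o + 1)
    (hnT : ∀ i < o + 1, ∀ h < o + 2, b h ∉ T i) (hnR : ∀ h < o + 2, b h ∉ R)
    (hTT : ∀ i < o + 1, ∀ j < o + 1, i ≠ j → Anticomplete G (T i) (T j))
    (hTR : ∀ i < o + 1, Disjoint (T i) R ∧ Anticomplete G (T i) R) :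
    HasLong G o ({v | (∃ i ≤ o + 1, b i = v) ∨ ∃ i < o + 1, v ∈ T i} ∪ R) := by
  set U : Set V := {v | (∃ i ≤ o + 1, b i = v) ∨ ∃ i < o + 1, v ∈ T i} with hU
  have hUc : Conn G U := conn_chain (o + 1) hT
    (fun i hi => (hbT i hi i (by omega)).mpr (.inl rfl))
    (fun i hi => (hbT i hi (i + 1) (by omega)).mpr (.inr rfl))
  obtain ⟨k, d, hd, hdU, hd0, hdk, hA, hB⟩ := hUc.exists_shortest (A := {b 0}) (B := {b (o + 1)})
    ⟨_, .inl ⟨0, by omega, rfl⟩, rfl⟩ ⟨_, .inl ⟨o + 1, by omega, rfl⟩, rfl⟩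
  simp only [Set.mem_singleton_iff] at hd0 hdk hA hB
  have hlevel : ∀ i ≤ k, ∃ u ≤ i, u < o + 2 ∧ (d i = b u ∨ u < o + 1 ∧ d i ∈ T u) := by
    intro i
    induction i with
    | zero => exact fun _ => ⟨0, le_rfl, by omega, .inl hd0⟩
    | succ i ih =>
      intro hi
      obtain ⟨u, hui, huo, hu⟩ := ih (by omega)
      have hadj : G.Adj (d i) (d (i + 1)) := (hd.2 i (by omega) _ (by omega)).mpr (.inl rfl)
      rcases hdU (i + 1) hi with ⟨u', hu', hdu'⟩ | ⟨u', hu', hdu'⟩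
      · rcases hu with hu | ⟨hu1, hu⟩
        · rw [hu, ← hdu'] at hadj
          exact absurd hadj (hst u huo u' (by omega))
        · have := (hbT u hu1 u' (by omega)).mp ⟨_, hu, hdu'.symm ▸ hadj.symm⟩
          exact ⟨u', by omega, by omega, .inl hdu'.symm⟩
      · rcases hu with hu | ⟨hu1, hu⟩
        · have := (hbT u' hu' u huo).mp ⟨_, hdu', hu ▸ hadj⟩
          exact ⟨u', by omega, by omega, .inr ⟨hu', hdu'⟩⟩
        · by_cases huu : u = u'
          · exact ⟨u', by omega, by omega, .inr ⟨hu', hdu'⟩⟩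
          · exact absurd hadj (hTT u hu1 u' hu' huu _ hu _ hdu')
  have hk : o + 1 ≤ k := by
    obtain ⟨u, huk, huo, hu | ⟨hu1, hu⟩⟩ := hlevel k le_rfl
    · have := hb (show o + 1 < o + 2 by omega) huo (hdk.symm.trans hu)
      omega
    · exact absurd (hdk ▸ hu) (hnT u hu1 (o + 1) (by omega))
  have hlong := hasLong_of_path (o := o) (D := R) hd (by omega) (by omega) hR ?_ ?_ ?_ ?_
  · refine hlong.mono ?_
    rintro v (hv | ⟨i, hi, rfl⟩)
    · exact .inr hv
    · exact .inl (hdU i (by omega))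
  · rw [Set.disjoint_left]
    rintro _ hvR ⟨i, hi, rfl⟩
    rcases hdU i (by omega) with ⟨u, hu, hdu⟩ | ⟨u, hu, hdu⟩
    · exact hnR u (by omega) (hdu ▸ hvR)
    · exact Set.disjoint_left.mp (hTR u hu).1 hdu hvR
  · rw [hd0]
    exact (hbR 0 (by omega)).mpr (.inl rfl)
  · rw [Nat.add_sub_cancel, hdk]
    exact (hbR (o + 1) (by omega)).mpr (.inr rfl)
  · intro i hi0 hi v hv hadj
    rcases hdU i (by omega) with ⟨u, hu, hdu⟩ | ⟨u, hu, hdu⟩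
    · rcases (hbR u (by omega)).mp ⟨v, hv, hdu ▸ hadj⟩ with rfl | rfl
      · have := hA i (by omega) hdu.symm
        omega
      · have := hB i (by omega) hdu.symm
        omega
    · exact (hTR u hu).2 _ hdu v hv hadj

/-- The vertices are divided into `c` consecutive blocks of `o + 2`, each forming a ring; links
between different blocks are left out. -/
theorem not_isPerforated_of_rings {c o : ℕ} (ho : 1 ≤ o) {x : ℕ → V} {T : ℕ → ℕ → Set V}
    (hx : Set.InjOn x (Set.Iio (c * (o + 2))))
    (hst : ∀ i < c * (o + 2), ∀ j < c * (o + 2), ¬ G.Adj (x i) (x j))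
    (hT : ∀ i j, i < j → j < c * (o + 2) → Conn G (T i j) ∧ ∀ h < c * (o + 2),
      x h ∉ T i j ∧ ((∃ z ∈ T i j, G.Adj (x h) z) ↔ h = i ∨ h = j))
    (hTT : ∀ i j, i < j → j < c * (o + 2) → ∀ i' j', i' < j' → j' < c * (o + 2) →
      (i ≠ i' ∨ j ≠ j') → Disjoint (T i j) (T i' j') ∧ Anticomplete G (T i j) (T i' j')) :
    ¬ IsPerforated G c o := by
  have hlt : ∀ r < c, ∀ i < o + 2, r * (o + 2) + i < c * (o + 2) := by
    intro r hr i hi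
    have := Nat.mul_le_mul_right (o + 2) (show r + 1 ≤ c by omega)
    rw [Nat.add_mul] at this
    omega
  have hdiv : ∀ r, ∀ i < o + 2, (r * (o + 2) + i) / (o + 2) = r := by
    intro r i hi
    rw [Nat.add_comm, Nat.add_mul_div_right _ _ (by omega), Nat.div_eq_of_lt hi, Nat.zero_add]
  let W : ℕ → Set V := fun r => {v | (∃ i < c * (o + 2), i / (o + 2) = r ∧ v = x i) ∨
    ∃ i j, i < j ∧ j < c * (o + 2) ∧ i / (o + 2) = r ∧ j / (o + 2) = r ∧ v ∈ T i j}
  refine not_isPerforated (fun r : Fin c => W r) ?_ ?_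
  · intro r
    have hT' : ∀ i < o + 1, ∀ j < o + 2, i < j → _ := fun i hi j hj hij =>
      hT (r * (o + 2) + i) (r * (o + 2) + j) (by omega) (hlt r r.2 j hj)
    refine (hasLong_of_ring (b := fun i => x (r * (o + 2) + i))
      (T := fun i => T (r * (o + 2) + i) (r * (o + 2) + (i + 1)))
      (R := T (r * (o + 2) + 0) (r * (o + 2) + (o + 1))) ho ?_ ?_ ?_ ?_ ?_ ?_ ?_ ?_ ?_ ?_).mono ?_
    · intro i hi j hj hij
      have := hx (hlt r r.2 i hi) (hlt r r.2 j hj) hij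
      omega
    · exact fun i hi j hj => hst _ (hlt r r.2 i hi) _ (hlt r r.2 j hj)
    · exact fun i hi => (hT' i hi (i + 1) (by omega) (by omega)).1
    · exact (hT' 0 (by omega) (o + 1) (by omega) (by omega)).1
    · intro i hi h hh
      rw [((hT' i hi (i + 1) (by omega) (by omega)).2 _ (hlt r r.2 h hh)).2]
      omega
    · intro h hh
      rw [((hT' 0 (by omega) (o + 1) (by omega) (by omega)).2 _ (hlt r r.2 h hh)).2]
      omega
    · exact fun i hi h hh => ((hT' i hi (i + 1) (by omega) (by omega)).2 _ (hlt r r.2 h hh)).1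
    · exact fun h hh => ((hT' 0 (by omega) (o + 1) (by omega) (by omega)).2 _
        (hlt r r.2 h hh)).1
    · exact fun i hi j hj hij => (hTT _ _ (by omega) (hlt r r.2 _ (by omega)) _ _ (by omega)
        (hlt r r.2 _ (by omega)) (by omega)).2
    · exact fun i hi => hTT _ _ (by omega) (hlt r r.2 _ (by omega)) _ _ (by omega)
        (hlt r r.2 _ (by omega)) (by omega)
    · rintro v ((⟨i, hi, rfl⟩ | ⟨i, hi, hv⟩) | hv)
      · exact .inl ⟨_, hlt r r.2 i (by omega), hdiv r i (by omega), rfl⟩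
      · exact .inr ⟨_, _, by omega, hlt r r.2 (i + 1) (by omega), hdiv r i (by omega),
          hdiv r (i + 1) (by omega), hv⟩
      · exact .inr ⟨_, _, by omega, hlt r r.2 (o + 1) (by omega), hdiv r 0 (by omega),
          hdiv r (o + 1) (by omega), hv⟩
  · intro r r' hrr
    have hne : (r : ℕ) ≠ r' := fun h => hrr (Fin.ext h)
    constructor
    · rw [Set.disjoint_left]
      rintro v (⟨i, hi, hir, rfl⟩ | ⟨i, j, hij, hj, hir, hjr, hv⟩)
        (⟨i', hi', hir', hv'⟩ | ⟨i', j', hij', hj', hir', hjr', hv'⟩)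
      · have := hx hi hi' hv'
        exact hne (by rw [← hir, ← hir', this])
      · exact ((hT i' j' hij' hj').2 i hi).1 hv'
      · exact ((hT i j hij hj).2 i' hi').1 (hv' ▸ hv)
      · exact Set.disjoint_left.mp (hTT i j hij hj i' j' hij' hj'
          (.inl fun h => hne (by rw [← hir, ← hir', h]))).1 hv hv'
    · rintro v (⟨i, hi, hir, rfl⟩ | ⟨i, j, hij, hj, hir, hjr, hv⟩) v'
        (⟨i', hi', hir', rfl⟩ | ⟨i', j', hij', hj', hir', hjr', hv'⟩) hadj
      · exact hst i hi i' hi' hadj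
      · rcases ((hT i' j' hij' hj').2 i hi).2.mp ⟨v', hv', hadj⟩ with rfl | rfl
        · exact hne (by rw [← hir, ← hir'])
        · exact hne (by rw [← hir, ← hjr'])
      · rcases ((hT i j hij hj).2 i' hi').2.mp ⟨v, hv, hadj.symm⟩ with rfl | rfl
        · exact hne (by rw [← hir, ← hir'])
        · exact hne (by rw [← hjr, ← hir'])
      · exact (hTT i j hij hj i' j' hij' hj'
          (.inl fun h => hne (by rw [← hir, ← hir', h]))).2 v hv v' hv' hadj

/-! ### Avoiding bounded sets of exceptions -/

/-- Union bound over the $(k+1)^3$ triples `(a, b, e)`: the values of `g` off `e` leave at most `d`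
bad values at `e`, so each triple spoils at most $d\,n^k$ of the $n^{k+1}$ maps. -/
theorem exists_avoiding {n k d : ℕ} (hn : (k + 1) ^ 3 * d < n)
    (β : Fin n → Fin n → Finset (Fin n)) (hβ : ∀ i j, (β i j).card ≤ d) :
    ∃ g : Fin (k + 1) → Fin n, ∀ a b e, e ≠ a → e ≠ b → g e ∉ β (g a) (g b) := by
  classical
  by_contra! hcon
  let F : Fin (k + 1) × Fin (k + 1) × Fin (k + 1) → Finset (Fin (k + 1) → Fin n) := fun t =>
    Finset.univ.filter fun g => t.2.2 ≠ t.1 ∧ t.2.2 ≠ t.2.1 ∧ g t.2.2 ∈ β (g t.1) (g t.2.1)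
  have hF : ∀ t, (F t).card ≤ d * n ^ k := by
    rintro ⟨a, b, e⟩
    refine (Finset.card_le_mul_card_image (f := fun g => e.removeNth g) (F (a, b, e)) d ?_).trans
      (Nat.mul_le_mul_left _ ((Finset.card_le_univ _).trans (by simp)))
    intro r hr
    obtain ⟨g₀, hg₀, rfl⟩ := Finset.mem_image.mp hr
    obtain ⟨-, hea, heb, -⟩ := Finset.mem_filter.mp hg₀
    have hagree : ∀ g : Fin (k + 1) → Fin n, e.removeNth g = e.removeNth g₀ →
        ∀ i, i ≠ e → g i = g₀ i := by
      intro g hg i hi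
      obtain ⟨j, rfl⟩ := Fin.exists_succAbove_eq hi
      exact congrFun hg j
    refine (Finset.card_le_card_of_injOn (fun g => g e) ?_ ?_).trans (hβ (g₀ a) (g₀ b))
    · intro g hg
      obtain ⟨hgF, hg⟩ := Finset.mem_filter.mp hg
      have := (Finset.mem_filter.mp hgF).2.2.2
      simp only at this
      rwa [hagree g hg a hea.symm, hagree g hg b heb.symm] at this
    · intro g hg g' hg' hgg
      have h1 := (Finset.mem_filter.mp hg).2
      have h2 := (Finset.mem_filter.mp hg').2
      funext i
      by_cases hi : i = e
      · exact hi ▸ hgg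
      · rw [hagree g h1 i hi, hagree g' h2 i hi]
  have huniv : (Finset.univ : Finset (Fin (k + 1) → Fin n)) ⊆ Finset.univ.biUnion F := by
    intro g _
    obtain ⟨a, b, e, h1, h2, h3⟩ := hcon g
    exact Finset.mem_biUnion.mpr ⟨(a, b, e), Finset.mem_univ _,
      Finset.mem_filter.mpr ⟨Finset.mem_univ _, h1, h2, h3⟩⟩
  have hle := (Finset.card_le_card huniv).trans (Finset.card_biUnion_le_card_mul _ _ _
    fun t _ => hF t)
  simp only [Finset.card_univ, Fintype.card_fun, Fintype.card_fin, Fintype.card_prod] at hle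
  have h1 : n ^ (k + 1) ≤ (k + 1) ^ 3 * d * n ^ k := by
    calc n ^ (k + 1) ≤ _ := hle
      _ = _ := by ring
  have h2 : (k + 1) ^ 3 * d * n ^ k < n * n ^ k :=
    Nat.mul_lt_mul_of_pos_right hn (Nat.pow_pos (by omega))
  rw [pow_succ'] at h1
  omega

end

section

variable {V : Type u} {G : SimpleGraph V}

/-! ### Systems of paths between the vertices of a stable set -/

/-- Disjoint paths `p i j a`, for `i < j < n` and `a ∈ I i j`, which are the interiors of paths
between the vertices `x i` and `x j` of the stable set `x 0, …, x (n - 1)`. -/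
structure Links (G : SimpleGraph V) (n : ℕ) (x : ℕ → V) {κ : Type v} (I : ℕ → ℕ → Finset κ)
    (p : ℕ → ℕ → κ → ℕ → V) (ℓ : ℕ → ℕ → κ → ℕ) : Prop where
  inj : Set.InjOn x (Set.Iio n)
  stable : ∀ i < n, ∀ j < n, ¬ G.Adj (x i) (x j)
  path : ∀ i j, i < j → j < n → ∀ a ∈ I i j, IPath G (p i j a) (ℓ i j a) ∧ 0 < ℓ i j a
  first : ∀ i j, i < j → j < n → ∀ a ∈ I i j, G.Adj (x i) (p i j a 0) ∧
    ∀ m < ℓ i j a, G.Adj (x i) (p i j a m) → m = 0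
  last : ∀ i j, i < j → j < n → ∀ a ∈ I i j, G.Adj (x j) (p i j a (ℓ i j a - 1)) ∧
    ∀ m < ℓ i j a, G.Adj (x j) (p i j a m) → m + 1 = ℓ i j a
  disjoint : ∀ i j, i < j → j < n → ∀ i' j', i' < j' → j' < n → ∀ a ∈ I i j, ∀ b ∈ I i' j',
    (i, j, a) ≠ (i', j', b) → Disjoint (seg (p i j a) (ℓ i j a)) (seg (p i' j' b) (ℓ i' j' b))
  not_mem : ∀ i j, i < j → j < n → ∀ a ∈ I i j, ∀ h < n, x h ∉ seg (p i j a) (ℓ i j a)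

theorem Links.comp {n k : ℕ} {x : ℕ → V} {κ : Type v} {I : ℕ → ℕ → Finset κ}
    {p : ℕ → ℕ → κ → ℕ → V} {ℓ : ℕ → ℕ → κ → ℕ} (h : Links G n x I p ℓ) {g : ℕ → ℕ}
    (hg : ∀ i j, i < j → j < k → g i < g j) (hgn : ∀ i < k, g i < n)
    {I' : ℕ → ℕ → Finset κ} (hI : ∀ i j, i < j → j < k → I' i j ⊆ I (g i) (g j)) :
    Links G k (fun i => x (g i)) I' (fun i j => p (g i) (g j)) (fun i j => ℓ (g i) (g j)) where
  inj i hi j hj hij := by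
    have h1 := h.inj (hgn i hi) (hgn j hj) hij
    by_contra hne
    rcases lt_or_gt_of_ne hne with h2 | h2
    · exact (hg i j h2 hj).ne h1
    · exact (hg j i h2 hi).ne h1.symm
  stable i hi j hj := h.stable _ (hgn i hi) _ (hgn j hj)
  path i j hij hj a ha := h.path _ _ (hg i j hij hj) (hgn j hj) a (hI i j hij hj ha)
  first i j hij hj a ha := h.first _ _ (hg i j hij hj) (hgn j hj) a (hI i j hij hj ha)
  last i j hij hj a ha := h.last _ _ (hg i j hij hj) (hgn j hj) a (hI i j hij hj ha)
  disjoint i j hij hj i' j' hij' hj' a ha b hb hne := by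
    have hginj : ∀ i < k, ∀ j < k, g i = g j → i = j := by
      intro i hi j hj hgg
      by_contra hne
      rcases lt_or_gt_of_ne hne with h2 | h2
      · exact (hg i j h2 hj).ne hgg
      · exact (hg j i h2 hi).ne hgg.symm
    refine h.disjoint _ _ (hg i j hij hj) (hgn j hj) _ _ (hg i' j' hij' hj') (hgn j' hj') a
      (hI i j hij hj ha) b (hI i' j' hij' hj' hb) fun heq => hne ?_
    simp only [Prod.mk.injEq] at heq ⊢
    exact ⟨hginj i (by omega) i' (by omega) heq.1, hginj j hj j' hj' heq.2.1, heq.2.2⟩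
  not_mem i j hij hj a ha m hm := h.not_mem _ _ (hg i j hij hj) (hgn j hj) a (hI i j hij hj ha) _
    (hgn m hm)

/-- The paths see no vertices of the stable set but their ends. -/
def Links.IsClean {n : ℕ} {x : ℕ → V} {κ : Type v} {I : ℕ → ℕ → Finset κ}
    {p : ℕ → ℕ → κ → ℕ → V} {ℓ : ℕ → ℕ → κ → ℕ} (_ : Links G n x I p ℓ) : Prop :=
  ∀ i j, i < j → j < n → ∀ a ∈ I i j, ∀ h < n, (∃ z ∈ seg (p i j a) (ℓ i j a), G.Adj (x h) z) →
    h = i ∨ h = j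

theorem Links.IsClean.comp {n k : ℕ} {x : ℕ → V} {κ : Type v} {I : ℕ → ℕ → Finset κ}
    {p : ℕ → ℕ → κ → ℕ → V} {ℓ : ℕ → ℕ → κ → ℕ} {h : Links G n x I p ℓ} (hc : h.IsClean)
    {g : ℕ → ℕ} (hg : ∀ i j, i < j → j < k → g i < g j) (hgn : ∀ i < k, g i < n)
    {I' : ℕ → ℕ → Finset κ} (hI : ∀ i j, i < j → j < k → I' i j ⊆ I (g i) (g j)) :
    (h.comp hg hgn hI).IsClean := by
  have hginj : ∀ i < k, ∀ j < k, g i = g j → i = j := by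
    intro i hi j hj hgg
    by_contra hne
    rcases lt_or_gt_of_ne hne with h2 | h2
    · exact (hg i j h2 hj).ne hgg
    · exact (hg j i h2 hi).ne hgg.symm
  intro i j hij hj a ha m hm hz
  exact (hc _ _ (hg i j hij hj) (hgn j hj) a (hI i j hij hj ha) _ (hgn m hm) hz).imp
    (hginj m hm i (by omega)) (hginj m hm j hj)

variable (c l o s t : ℕ)

/-- For each pair, pigeonhole leaves many paths that see exactly the same set `D i j` of indices.
This set is small by `exists_not_seen_of_disjoint`, and `exists_avoiding` selects vertices outside
the sets of each other's pairs. -/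
theorem exists_isClean (k m : ℕ) : ∃ n M : ℕ, ∀ {V : Type u} {G : SimpleGraph V},
    Good c l o s t G → ∀ {x : ℕ → V} {κ : Type v} {I : ℕ → ℕ → Finset κ}
      {p : ℕ → ℕ → κ → ℕ → V} {ℓ : ℕ → ℕ → κ → ℕ}, Links G n x I p ℓ →
      (∀ i j, i < j → j < n → M ≤ (I i j).card) →
      ∃ (x' : ℕ → V) (I' : ℕ → ℕ → Finset κ) (p' : ℕ → ℕ → κ → ℕ → V) (ℓ' : ℕ → ℕ → κ → ℕ)
        (h : Links G k x' I' p' ℓ'), h.IsClean ∧ ∀ i j, i < j → j < k → m ≤ (I' i j).card := by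
  classical
  obtain ⟨R, q, hR0, hRq⟩ := exists_not_seen_of_disjoint.{u, v} c l o s t
  obtain ⟨n, hn⟩ : ∃ n, n = (k + 1) ^ 3 * (R + 1) + 1 := ⟨_, rfl⟩
  -- There are `2 ^ n` possible traces; a common trace is needed for `q` paths to bound its size and
  -- for `m` paths in the conclusion.
  refine ⟨n, 2 ^ n * (m + q), fun {V G} hG {x κ I p ℓ} h hI => ?_⟩
  let τ : ℕ → ℕ → κ → Finset ℕ := fun i j a =>
    (Finset.range n).filter fun h => ∃ z ∈ seg (p i j a) (ℓ i j a), G.Adj (x h) z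
  have hD : ∀ i j, ∃ D : Finset ℕ, i < j → j < n → D.card < R ∧ D ⊆ Finset.range n ∧
      m ≤ ((I i j).filter fun a => τ i j a = D).card := by
    intro i j
    by_cases hij : i < j ∧ j < n
    swap
    · exact ⟨∅, fun h1 h2 => absurd ⟨h1, h2⟩ hij⟩
    obtain ⟨D, hDn, hD⟩ := Finset.exists_le_card_fiber_of_mul_le_card_of_maps_to (s := I i j)
      (t := (Finset.range n).powerset) (f := τ i j) (n := m + q)
      (fun a _ => Finset.mem_powerset.mpr (Finset.filter_subset _ _))
      ⟨∅, Finset.empty_mem_powerset _⟩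
      (by rw [Finset.card_powerset, Finset.card_range]; exact hI i j hij.1 hij.2)
    rw [Finset.mem_powerset] at hDn
    refine ⟨D, fun _ _ => ⟨?_, hDn, by omega⟩⟩
    by_contra hcard
    have hDlt : ∀ d ∈ D, d < n := fun d hd => by simpa using hDn hd
    obtain ⟨v, hv, a, ha, hno⟩ := hRq hG (D.image x) ((I i j).filter fun a => τ i j a = D)
      (p i j) (ℓ i j)
      (by
        rw [Finset.card_image_of_injOn fun d hd d' hd' => h.inj (hDlt d hd) (hDlt d' hd')]
        omega)
      (by omega) (fun a ha => (h.path i j hij.1 hij.2 a (Finset.mem_filter.mp ha).1).1)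
      (fun a ha b hb hab => h.disjoint i j hij.1 hij.2 i j hij.1 hij.2 a
        (Finset.mem_filter.mp ha).1 b (Finset.mem_filter.mp hb).1 (by simpa using hab))
      (fun v hv a ha => by
        obtain ⟨d, hd, rfl⟩ := Finset.mem_image.mp hv
        exact h.not_mem i j hij.1 hij.2 a (Finset.mem_filter.mp ha).1 d (hDlt d hd))
    obtain ⟨d, hd, rfl⟩ := Finset.mem_image.mp hv
    rw [← (Finset.mem_filter.mp ha).2] at hd
    obtain ⟨-, z, hz, hadj⟩ := Finset.mem_filter.mp hd
    exact hno z hz hadj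
  choose D hD using hD
  -- Adding `i` to the set to be avoided forces the selection to be injective, which accounts for `R
  -- + 1`.
  obtain ⟨g₀, hg₀⟩ := exists_avoiding (n := n) (k := k) (d := R + 1) (by omega)
    (fun i j => insert i (if i < j then Finset.univ.filter fun h : Fin n => (h : ℕ) ∈ D i j else ∅))
    (by
      intro i j
      refine (Finset.card_insert_le _ _).trans (Nat.add_le_add_right ?_ 1)
      by_cases hij : i < j
      · rw [if_pos hij]
        refine (Finset.card_le_card_of_injOn (fun h : Fin n => (h : ℕ))
          (fun h hh => (Finset.mem_filter.mp hh).2)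
          (fun _ _ _ _ h => Fin.ext h)).trans (hD i j hij j.2).1.le
      · simp [hij])
  have hinj₀ : Function.Injective g₀ := by
    intro a b hab
    by_contra hne
    exact hg₀ b b a hne hne (hab ▸ Finset.mem_insert_self _ _)
  have hcard : (Finset.univ.image g₀).card = k + 1 := by
    rw [Finset.card_image_of_injective _ hinj₀, Finset.card_univ, Fintype.card_fin]
  obtain ⟨g, hgmem, hgmono⟩ := exists_sorted (S := Finset.univ.image g₀)
    (Finset.card_pos.mp (by omega)) (key := fun i => (i : ℕ)) (fun _ _ _ _ h => Fin.ext h)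
  rw [hcard] at hgmem hgmono
  have hg' : ∀ i j, i < j → j < k → (g i : ℕ) < g j := fun i j hij hj =>
    hgmono i j hij (by omega)
  have hgI : ∀ i j, i < j → j < k →
      ((I (g i) (g j)).filter fun a => τ (g i) (g j) a = D (g i) (g j)) ⊆ I (g i) (g j) :=
    fun i j _ _ => Finset.filter_subset _ _
  refine ⟨_, _, _, _, h.comp hg' (fun i _ => (g i).2) hgI, ?_,
    fun i j hij hj => (hD _ _ (hg' i j hij hj) (g j).2).2.2⟩
  intro i j hij hj a ha e he hz
  by_contra! hne
  obtain ⟨a', -, ha'⟩ := Finset.mem_image.mp (hgmem i (by omega))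
  obtain ⟨b', -, hb'⟩ := Finset.mem_image.mp (hgmem j (by omega))
  obtain ⟨e', -, he'⟩ := Finset.mem_image.mp (hgmem e (by omega))
  have hgne : ∀ a < k, ∀ b < k, a ≠ b → g a ≠ g b := by
    intro a ha b hb hab h
    rcases lt_or_gt_of_ne hab with h2 | h2
    · exact (hg' a b h2 hb).ne (by rw [h])
    · exact (hg' b a h2 ha).ne (by rw [h])
  refine hg₀ a' b' e' ?_ ?_ ?_
  · rintro rfl
    exact hgne e he i (by omega) hne.1 (he'.symm.trans ha')
  · rintro rfl
    exact hgne e he j hj hne.2 (he'.symm.trans hb')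
  · rw [ha', hb', he', if_pos (show g i < g j from hg' i j hij hj)]
    refine Finset.mem_insert_of_mem (Finset.mem_filter.mpr ⟨Finset.mem_univ _, ?_⟩)
    rw [← (Finset.mem_filter.mp ha).2]
    exact Finset.mem_filter.mpr ⟨Finset.mem_range.mpr (g e).2, hz⟩

/-- The disjoint pairs `2 * e`, `2 * e + 1` with their long links form a clean system. -/
theorem not_links_of_long : ∃ n M : ℕ, ∀ {V : Type u} {G : SimpleGraph V},
    Good c l o s t G → ∀ {x : ℕ → V} {κ : Type v} {I : ℕ → ℕ → Finset κ}
      {p : ℕ → ℕ → κ → ℕ → V} {ℓ : ℕ → ℕ → κ → ℕ} (h : Links G n x I p ℓ), h.IsClean →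
      (∀ i j, i < j → j < n → M ≤ (I i j).card) →
      ¬ ∀ i j, i < j → j < n → ∀ a ∈ I i j, o + 1 ≤ ℓ i j a := by
  classical
  obtain ⟨N, M, -, -, hNM⟩ := not_cleanSystem.{u, v, 0} c l o s t
  refine ⟨2 * N, M, fun {V G} hG {x κ I p ℓ} h hclean hI hlong => ?_⟩
  refine hNM hG (Finset.range N) (fun e => (I (2 * e) (2 * e + 1)).image fun a => (e, a))
    (fun e => x (2 * e)) (fun e => x (2 * e + 1)) (fun a => p (2 * a.1) (2 * a.1 + 1) a.2)
    (fun a => ℓ (2 * a.1) (2 * a.1 + 1) a.2) ?_ (by simp) ?_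
  swap
  · intro e he
    rw [Finset.card_image_of_injective _ (fun a b h => (Prod.ext_iff.mp h).2)]
    exact hI _ _ (by omega) (by have := Finset.mem_range.mp he; omega)
  simp only [Finset.range_eq_Ico]
  constructor
  · intro e he f hf hef
    rw [Finset.disjoint_left]
    intro a ha hb
    obtain ⟨i, -, rfl⟩ := Finset.mem_image.mp ha
    obtain ⟨j, -, h⟩ := Finset.mem_image.mp hb
    exact hef (Prod.ext_iff.mp h).1.symm
  · intro e he a ha
    obtain ⟨a, hma, rfl⟩ := Finset.mem_image.mp ha
    have := (Finset.mem_Ico.mp he).2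
    exact ⟨(h.path _ _ (by omega) (by omega) a hma).1, hlong _ _ (by omega) (by omega) a hma⟩
  · intro e he f hf a ha b hb hab
    obtain ⟨a, hma, rfl⟩ := Finset.mem_image.mp ha
    obtain ⟨b, hmb, rfl⟩ := Finset.mem_image.mp hb
    have := (Finset.mem_Ico.mp he).2
    have := (Finset.mem_Ico.mp hf).2
    refine h.disjoint _ _ (by omega) (by omega) _ _ (by omega) (by omega) a hma b hmb fun heq => ?_
    simp only [Prod.mk.injEq] at heq
    exact hab (Prod.ext (by simp only; omega) heq.2.2)
  · intro e he a ha
    obtain ⟨a, hma, rfl⟩ := Finset.mem_image.mp ha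
    have := (Finset.mem_Ico.mp he).2
    exact h.first _ _ (by omega) (by omega) a hma
  · intro e he a ha
    obtain ⟨a, hma, rfl⟩ := Finset.mem_image.mp ha
    have := (Finset.mem_Ico.mp he).2
    exact h.last _ _ (by omega) (by omega) a hma
  · intro e he f hf hef a ha i hi
    obtain ⟨a, hma, rfl⟩ := Finset.mem_image.mp ha
    have := (Finset.mem_Ico.mp he).2
    have := (Finset.mem_Ico.mp hf).2
    constructor <;> intro hadj
    · have := hclean _ _ (by omega) (by omega) a hma (2 * e) (by omega) ⟨_, mem_seg hi, hadj⟩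
      omega
    · have := hclean _ _ (by omega) (by omega) a hma (2 * e + 1) (by omega) ⟨_, mem_seg hi, hadj⟩
      omega
  · intro e he f hf a ha
    obtain ⟨a, hma, rfl⟩ := Finset.mem_image.mp ha
    have := (Finset.mem_Ico.mp he).2
    have := (Finset.mem_Ico.mp hf).2
    exact ⟨h.not_mem _ _ (by omega) (by omega) a hma _ (by omega),
      h.not_mem _ _ (by omega) (by omega) a hma _ (by omega)⟩
  · intro e he f hf
    have := (Finset.mem_Ico.mp he).2
    have := (Finset.mem_Ico.mp hf).2
    exact ⟨h.stable _ (by omega) _ (by omega), h.stable _ (by omega) _ (by omega),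
      h.stable _ (by omega) _ (by omega)⟩
  · intro e he f hf hef
    have := (Finset.mem_Ico.mp he).2
    have := (Finset.mem_Ico.mp hf).2
    have key : ∀ i < 2 * N, ∀ j < 2 * N, i ≠ j → x i ≠ x j := fun i hi j hj hij heq =>
      hij (h.inj hi hj heq)
    exact ⟨key _ (by omega) _ (by omega) (by omega), key _ (by omega) _ (by omega) (by omega),
      key _ (by omega) _ (by omega) (by omega)⟩

/-- For links of bounded length, `exists_anticomplete_short` and `clean` provide one link for each
pair such that all of them are pairwise anticomplete; these build the rings. -/
theorem not_links_of_short : ∃ n M : ℕ, ∀ {V : Type u} {G : SimpleGraph V},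
    Good c l o s t G → ∀ {x : ℕ → V} {κ : Type v} {I : ℕ → ℕ → Finset κ}
      {p : ℕ → ℕ → κ → ℕ → V} {ℓ : ℕ → ℕ → κ → ℕ} (h : Links G n x I p ℓ), h.IsClean →
      (∀ i j, i < j → j < n → M ≤ (I i j).card) →
      ¬ ∀ i j, i < j → j < n → ∀ a ∈ I i j, ℓ i j a ≤ o := by
  classical
  obtain ⟨q, hq0, hq⟩ := exists_anticomplete_short.{u, v} c l o s t o
  obtain ⟨n, hn⟩ : ∃ n, n = c * (o + 2) := ⟨_, rfl⟩
  obtain ⟨M, hM0, hM⟩ := clean.{0, v} (n * n) q 1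
  refine ⟨n, M, fun {V G} hG {x κ I p ℓ} h hclean hI hshort => ?_⟩
  let E : Finset (ℕ × ℕ) := ((Finset.range n) ×ˢ (Finset.range n)).filter fun e => e.1 < e.2
  have hE : ∀ e, e ∈ E ↔ e.1 < e.2 ∧ e.2 < n := by
    intro e
    simp only [E, Finset.mem_filter, Finset.mem_product, Finset.mem_range]
    omega
  let P : (ℕ × ℕ) × κ → ℕ → V := fun a => p a.1.1 a.1.2 a.2
  let L : (ℕ × ℕ) × κ → ℕ := fun a => ℓ a.1.1 a.1.2 a.2
  let I' : ℕ × ℕ → Finset ((ℕ × ℕ) × κ) := fun e => (I e.1 e.2).image fun a => (e, a)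
  have hI' : ∀ e a, a ∈ I' e ↔ a.1 = e ∧ a.2 ∈ I e.1 e.2 := by
    rintro e ⟨f, a⟩
    simp only [I', Finset.mem_image, Prod.mk.injEq]
    constructor
    · rintro ⟨b, hb, rfl, rfl⟩
      exact ⟨rfl, hb⟩
    · rintro ⟨rfl, hb⟩
      exact ⟨a, hb, rfl, rfl⟩
  have hdis : ∀ a b, a.1 ∈ E → b.1 ∈ E → a.2 ∈ I a.1.1 a.1.2 → b.2 ∈ I b.1.1 b.1.2 → a ≠ b →
      Disjoint (seg (P a) (L a)) (seg (P b) (L b)) := by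
    rintro ⟨⟨i, j⟩, a⟩ ⟨⟨i', j'⟩, b⟩ he hf ha hb hab
    rw [hE] at he hf
    exact h.disjoint i j he.1 he.2 i' j' hf.1 hf.2 a ha b hb fun heq => hab (by
      simp only [Prod.mk.injEq] at heq ⊢
      exact ⟨⟨heq.1, heq.2.1⟩, heq.2.2⟩)
  obtain ⟨J, hJ, hanti⟩ := hM E I' (fun a b => ¬ Anticomplete G (seg (P a) (L a)) (seg (P b) (L b)))
    ((Finset.card_filter_le _ _).trans (by simp))
    (fun e he => by
      rw [Finset.card_image_of_injective _ (fun a b h => (Prod.ext_iff.mp h).2)]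
      exact hI _ _ ((hE e).mp he).1 ((hE e).mp he).2)
    (fun e he f hf hef => by
      rw [Finset.disjoint_left]
      intro a ha hb
      exact hef (((hI' e a).mp ha).1.symm.trans ((hI' f a).mp hb).1))
    (by
      intro A B hA hB hAB hAI hBI
      have key : ∀ C : Finset ((ℕ × ℕ) × κ), (∀ a ∈ C, ∃ e ∈ E, a ∈ I' e) →
          (∀ a ∈ C, a.1 ∈ E ∧ a.2 ∈ I a.1.1 a.1.2) := by
        intro C hC a ha
        obtain ⟨e, he, hae⟩ := hC a ha
        obtain ⟨rfl, h2⟩ := (hI' e a).mp hae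
        exact ⟨he, h2⟩
      have hA' := key A hAI
      have hB' := key B hBI
      obtain ⟨a, ha, b, hb, hab⟩ := hq hG A B P L hA hB
        (fun a ha => hshort _ _ ((hE _).mp (hA' a ha).1).1 ((hE _).mp (hA' a ha).1).2 _
          (hA' a ha).2)
        (fun a ha => hshort _ _ ((hE _).mp (hB' a ha).1).1 ((hE _).mp (hB' a ha).1).2 _
          (hB' a ha).2)
        (fun a ha b hb => hdis a b (hA' a ha).1 (hA' b hb).1 (hA' a ha).2 (hA' b hb).2)
        (fun a ha b hb => hdis a b (hB' a ha).1 (hB' b hb).1 (hB' a ha).2 (hB' b hb).2)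
      exact ⟨a, ha, b, hb, not_not.mpr hab⟩)
  have hsel : ∀ i j, ∃ T : Set V, i < j → j < n → ∃ a ∈ I i j, ((i, j), a) ∈ J (i, j) ∧
      T = seg (P ((i, j), a)) (L ((i, j), a)) := by
    intro i j
    by_cases hij : i < j ∧ j < n
    · have he := (hE (i, j)).mpr hij
      obtain ⟨⟨e, a⟩, ha⟩ := Finset.card_pos.mp (show 0 < (J (i, j)).card by rw [(hJ _ he).2]; omega)
      obtain ⟨rfl, h2⟩ := (hI' (i, j) _).mp ((hJ _ he).1 ha)
      exact ⟨_, fun _ _ => ⟨a, h2, ha, rfl⟩⟩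
    · exact ⟨∅, fun h1 h2 => absurd ⟨h1, h2⟩ hij⟩
  choose T hT using hsel
  refine not_isPerforated_of_rings (x := x) (T := T) hG.ho ?_ ?_ ?_ ?_ hG.perforated <;>
    rw [← hn]
  · exact h.inj
  · exact h.stable
  · intro i j hij hj
    obtain ⟨a, ha, -, hTa⟩ := hT i j hij hj
    have hp := h.path i j hij hj a ha
    rw [hTa]
    refine ⟨hp.1.conn, fun m hm => ⟨h.not_mem i j hij hj a ha m hm,
      hclean i j hij hj a ha m hm, ?_⟩⟩
    rintro (rfl | rfl)
    · exact ⟨_, mem_seg hp.2, (h.first _ _ hij hj a ha).1⟩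
    · exact ⟨_, mem_seg (Nat.sub_lt hp.2 one_pos), (h.last _ _ hij hj a ha).1⟩
  · intro i j hij hj i' j' hij' hj' hne
    obtain ⟨a, ha, haJ, hTa⟩ := hT i j hij hj
    obtain ⟨b, hb, hbJ, hTb⟩ := hT i' j' hij' hj'
    have he := (hE (i, j)).mpr ⟨hij, hj⟩
    have hf := (hE (i', j')).mpr ⟨hij', hj'⟩
    have hab : ((i, j), a) ≠ ((i', j'), b) := by
      intro heq
      simp only [Prod.mk.injEq] at heq
      omega
    rw [hTa, hTb]
    exact ⟨hdis _ _ he hf ha hb hab, not_not.mp (hanti _ he _ hf _ haJ _ hbJ hab)⟩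

/-- Colour a pair by whether many of its links are long. On a homogeneous set of indices, keeping
only the long or only the short links leads to one of the two preceding cases. -/
theorem not_links : ∃ n M : ℕ, ∀ {V : Type u} {G : SimpleGraph V},
    Good c l o s t G → ∀ {x : ℕ → V} {κ : Type v} {I : ℕ → ℕ → Finset κ}
      {p : ℕ → ℕ → κ → ℕ → V} {ℓ : ℕ → ℕ → κ → ℕ}, Links G n x I p ℓ →
      ¬ ∀ i j, i < j → j < n → M ≤ (I i j).card := by
  classical
  obtain ⟨n₁, M₁, h₁⟩ := not_links_of_long.{u, v} c l o s t
  obtain ⟨n₂, M₂, h₂⟩ := not_links_of_short.{u, v} c l o s t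
  obtain ⟨n₃, h₃⟩ := exists_monochromatic Bool (n₁ + n₂ + 1)
  obtain ⟨n, M, h₄⟩ := exists_isClean.{u, v} c l o s t n₃ (M₁ + M₂)
  refine ⟨n, M, fun {V G} hG {x κ I p ℓ} h hI => ?_⟩
  obtain ⟨x, I, p, ℓ, h, hclean, hI⟩ := h₄ hG h hI
  obtain ⟨T, hT, hTc, col, hcol⟩ := h₃ (Finset.range n₃) (by simp)
    (fun i j => decide (M₁ ≤ ((I i j).filter fun a => o + 1 ≤ ℓ i j a).card))
  obtain ⟨g, hg, hgmono⟩ := exists_sorted (S := T) (Finset.card_pos.mp (by omega)) (key := id)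
    (Set.injOn_id _)
  rw [hTc] at hg hgmono
  have hgn : ∀ i < n₁ + n₂ + 1, g i < n₃ := fun i hi => by simpa using hT (hg i hi)
  have hcol' := fun i j (hij : i < j) (hj : j < n₁ + n₂ + 1) =>
    hcol (g i) (hg i (by omega)) (g j) (hg j hj) (hgmono i j hij hj)
  cases col with
  | true =>
    have hg' : ∀ i j, i < j → j < n₁ → g i < g j := fun i j hij hj => hgmono i j hij (by omega)
    exact h₁ hG _ (hclean.comp hg' (fun i hi => hgn i (by omega))
      (I' := fun i j => (I (g i) (g j)).filter fun a => o + 1 ≤ ℓ (g i) (g j) a)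
      (fun i j _ _ => Finset.filter_subset _ _))
      (fun i j hij hj => by simpa using hcol' i j hij (by omega))
      (fun i j hij hj a ha => (Finset.mem_filter.mp ha).2)
  | false =>
    have hg' : ∀ i j, i < j → j < n₂ → g i < g j := fun i j hij hj => hgmono i j hij (by omega)
    refine h₂ hG _ (hclean.comp hg' (fun i hi => hgn i (by omega))
      (I' := fun i j => (I (g i) (g j)).filter fun a => ¬ o + 1 ≤ ℓ (g i) (g j) a)
      (fun i j _ _ => Finset.filter_subset _ _))
      (fun i j hij hj => ?_)
      (fun i j hij hj a ha => by have := (Finset.mem_filter.mp ha).2; omega)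
    have h5 := Finset.card_filter_add_card_filter_not (s := I (g i) (g j))
      fun a => o + 1 ≤ ℓ (g i) (g j) a
    have h6 : ¬ M₁ ≤ ((I (g i) (g j)).filter fun a => o + 1 ≤ ℓ (g i) (g j) a).card := by
      simpa using hcol' i j hij (by omega)
    have h7 := hI (g i) (g j) (hg' i j hij hj) (hgn j (by omega))
    omega

/-! ### From strong blocks to systems of links -/

/-- The interior of a path between two distinct nonadjacent vertices. -/
theorem exists_interior {P : Set V} {x y : V} (hP : IsPathBetween G P x y) (hxy : x ≠ y)
    (hadj : ¬ G.Adj x y) : ∃ (p : ℕ → V) (n : ℕ), IPath G p n ∧ 0 < n ∧ seg p n ⊆ P \ {x, y} ∧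
      (G.Adj x (p 0) ∧ ∀ m < n, G.Adj x (p m) → m = 0) ∧
      (G.Adj y (p (n - 1)) ∧ ∀ m < n, G.Adj y (p m) → m + 1 = n) := by
  obtain ⟨p, n, hp, rfl, rfl, rfl⟩ := exists_iPath_of_isPathBetween hP
  have hn : 1 < n := by
    by_contra hn
    obtain rfl | rfl : n = 0 ∨ n = 1 := by omega
    · exact hxy rfl
    · exact hadj ((hp.2 0 (by omega) 1 (by omega)).mpr (.inl rfl))
  refine ⟨fun i => p (1 + i), n - 1, hp.shift (by omega), by omega, ?_, ⟨?_, fun m hm h => ?_⟩, ?_,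
    fun m hm h => ?_⟩
  · rintro _ ⟨i, hi, rfl⟩
    refine ⟨mem_seg (by omega), ?_⟩
    rintro (h | h)
    · have := hp.1 (show 1 + i < n + 1 by omega) (show 0 < n + 1 by omega) h
      omega
    · have := hp.1 (show 1 + i < n + 1 by omega) (show n < n + 1 by omega) h
      omega
  · exact (hp.2 0 (by omega) _ (by omega)).mpr (.inl rfl)
  · have := (hp.2 0 (by omega) _ (by omega)).mp h
    omega
  · exact (hp.2 n (by omega) _ (by omega)).mpr (.inr (by omega))
  · have := (hp.2 n (by omega) _ (by omega)).mp h
    omega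

/-- A strong block yields links between the vertices of any stable subset. -/
theorem exists_links {k : ℕ} {B X : Finset V} (hB : IsStrongBlock G k B) (hk : 0 < k)
    (hX : X ⊆ B) (hne : X.Nonempty) (hst : G.IsIndepSet (X : Set V)) :
    ∃ (x : ℕ → V) (I : ℕ → ℕ → Finset (Set V)) (p : ℕ → ℕ → Set V → ℕ → V)
      (ℓ : ℕ → ℕ → Set V → ℕ), Links G X.card x I p ℓ ∧
        ∀ i j, i < j → j < X.card → k ≤ (I i j).card := by
  classical
  obtain ⟨-, 𝓟, h𝓟, hdisj⟩ := hB
  obtain ⟨x, hx, hinj, -⟩ := exists_enum X hne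
  have hxne : ∀ i < X.card, ∀ j < X.card, i ≠ j → x i ≠ x j := fun i hi j hj hij h =>
    hij (hinj hi hj h)
  have hstab : ∀ i < X.card, ∀ j < X.card, ¬ G.Adj (x i) (x j) := fun i hi j hj h =>
    hst (hx i hi) (hx j hj) h.ne h
  have hblock : ∀ i j, i < j → j < X.card → _ := fun i j hij hj =>
    h𝓟 (x i) (hX (hx i (by omega))) (x j) (hX (hx j hj)) (hxne i (by omega) j hj hij.ne)
  have hp : ∀ i j P, ∃ (p : ℕ → V) (n : ℕ), i < j → j < X.card → P ∈ 𝓟 s(x i, x j) →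
      IPath G p n ∧ 0 < n ∧ seg p n ⊆ P \ {x i, x j} ∧
      (G.Adj (x i) (p 0) ∧ ∀ m < n, G.Adj (x i) (p m) → m = 0) ∧
      (G.Adj (x j) (p (n - 1)) ∧ ∀ m < n, G.Adj (x j) (p m) → m + 1 = n) := by
    intro i j P
    by_cases h : i < j ∧ j < X.card ∧ P ∈ 𝓟 s(x i, x j)
    · obtain ⟨p, n, h1⟩ := exists_interior ((hblock i j h.1 h.2.1).2.1 P h.2.2)
        (hxne i (by omega) j h.2.1 h.1.ne) (hstab i (by omega) j h.2.1)
      exact ⟨p, n, fun _ _ _ => h1⟩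
    · exact ⟨fun _ => x 0, 0, fun h1 h2 h3 => absurd ⟨h1, h2, h3⟩ h⟩
  choose p ℓ hp using hp
  have hpair : ∀ i j, i < j → j < X.card → ∀ i' j', i' < j' → j' < X.card →
      s(x i, x j) = s(x i', x j') → i = i' ∧ j = j' := by
    intro i j hij hj i' j' hij' hj' heq
    rcases Sym2.eq_iff.mp heq with ⟨h1, h2⟩ | ⟨h1, h2⟩
    · exact ⟨hinj (show i < _ by omega) (show i' < _ by omega) h1, hinj hj hj' h2⟩
    · have h3 := hinj (show i < _ by omega) hj' h1
      have h4 := hinj hj (show i' < _ by omega) h2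
      omega
  refine ⟨x, fun i j => 𝓟 s(x i, x j), p, ℓ, ⟨hinj, hstab, ?_, ?_, ?_, ?_, ?_⟩,
    fun i j hij hj => (hblock i j hij hj).1⟩
  · exact fun i j hij hj P hP => ⟨(hp i j P hij hj hP).1, (hp i j P hij hj hP).2.1⟩
  · exact fun i j hij hj P hP => (hp i j P hij hj hP).2.2.2.1
  · exact fun i j hij hj P hP => (hp i j P hij hj hP).2.2.2.2
  · intro i j hij hj i' j' hij' hj' P hP Q hQ hne'
    have hsP := (hp i j P hij hj hP).2.2.1
    have hsQ := (hp i' j' Q hij' hj' hQ).2.2.1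
    by_cases heq : s(x i, x j) = s(x i', x j')
    · obtain ⟨rfl, rfl⟩ := hpair i j hij hj i' j' hij' hj' heq
      exact ((hblock i j hij hj).2.2 P hP Q hQ fun h => hne' (by rw [h])).mono hsP hsQ
    · rw [Set.disjoint_left]
      intro v hv hv'
      have h1 := hdisj (x i) (hX (hx i (by omega))) (x j) (hX (hx j hj)) (x i')
        (hX (hx i' (by omega))) (x j') (hX (hx j' hj')) (hxne i (by omega) j hj hij.ne)
        (hxne i' (by omega) j' hj' hij'.ne) heq
      have h2 : v ∈ ({x i, x j} ∩ {x i', x j'} : Set V) := h1 ▸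
        ⟨Set.mem_biUnion hP (hsP hv).1, Set.mem_biUnion hQ (hsQ hv').1⟩
      exact (hsP hv).2 h2.1
  · intro i j hij hj P hP m hm hmem
    have hsP := (hp i j P hij hj hP).2.2.1 hmem
    have hmi : m ≠ i := by
      rintro rfl
      exact hsP.2 (.inl rfl)
    have hmj : m ≠ j := by
      rintro rfl
      exact hsP.2 (.inr rfl)
    have hi : i < X.card := by omega
    -- A third vertex `x m` on a path from `x i` to `x j` would also lie on a path from `x i` to `x
    -- m`, which exists as `k > 0`. Paths for these two pairs share only `x i`.
    have h1 := hdisj (x i) (hX (hx i hi)) (x j) (hX (hx j hj)) (x i) (hX (hx i hi)) (x m)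
      (hX (hx m hm)) (hxne i hi j hj hij.ne) (hxne i hi m hm hmi.symm) (by
        intro heq
        rcases Sym2.eq_iff.mp heq with ⟨-, h⟩ | ⟨h, -⟩
        · exact hxne m hm j hj hmj h.symm
        · exact hxne m hm i hi hmi h.symm)
    have h2 := h𝓟 (x i) (hX (hx i hi)) (x m) (hX (hx m hm)) (hxne i hi m hm hmi.symm)
    obtain ⟨Q, hQ⟩ := Finset.card_pos.mp (hk.trans_le h2.1)
    have hmQ : x m ∈ Q := by
      obtain ⟨r, f, -, hl, hr⟩ := h2.2.1 Q hQ
      exact hr ▸ hl ▸ Set.mem_range_self _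
    have h3 : x m ∈ ({x i, x j} ∩ {x i, x m} : Set V) := h1 ▸
      ⟨Set.mem_biUnion hP hsP.1, Set.mem_biUnion hQ hmQ⟩
    exact hsP.2 h3.1

end

end StrongBlock

/-! ### The theorem -/

theorem theorem7p1 :
    ∀ c l o s t : ℕ, 1 ≤ c → 1 ≤ l → 1 ≤ o → 1 ≤ s → 1 ≤ t →
      ∃ Ω : ℕ, 1 ≤ Ω ∧
        ∀ (V : Type*) [Finite V] (G : SimpleGraph V),
          InducedGrid.IsPerforated G c o →
          (∃ B : Finset V, InducedGrid.IsStrongBlock G Ω B) →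
            (SimpleGraph.IsIndContained (⊤ : SimpleGraph (Fin t)) G ∨
              SimpleGraph.IsIndContained (completeBipartiteGraph (Fin t) (Fin t)) G) ∨
            ∃ (S : Finset V) (𝓛 : Finset (Set V)),
              InducedGrid.IsConstellation G s l S 𝓛 ∧ InducedGrid.IsPlain G 𝓛 := by
  intro c l o s t hc _ ho _ _
  obtain ⟨n, M, hM⟩ := StrongBlock.not_links c l o s t
  obtain ⟨R, hR0, hR⟩ := StrongBlock.exists_stable c l o s t (n + 1)
  -- `R` block vertices provide a stable set and `M` bounds the number of paths for each pair; `n +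
  -- 1` instead of `n` only makes the stable set nonempty.
  refine ⟨R + M, by omega, fun V _ G hperf ⟨B, hB⟩ => ?_⟩
  by_contra! hcon
  have hG : StrongBlock.Good c l o s t G := ⟨hc, ho, hperf, hcon.1.1, hcon.1.2,
    fun ⟨S, 𝓛, h1, h2⟩ => hcon.2 S 𝓛 h1 h2⟩
  obtain ⟨X, hX, hXc, hst⟩ := hR hG B (by have := hB.1; omega)
  obtain ⟨x, I, p, ℓ, h, hI⟩ := StrongBlock.exists_links hB (by omega) hX
    (Finset.card_pos.mp (by omega)) hst
  have h' := h.comp (k := n) (g := id) (I' := I) (fun i j hij _ => hij) (fun i hi => by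
    simp only [id]; omega) (fun _ _ _ _ => subset_rfl)
  exact hM hG h' fun i j hij hj => by have := hI i j hij (by omega); omega
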